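/- Let $n\ge 3$, let $\overline D_n=\langle a,b\mid aba=bab,\ ab^2a=b^{n-2}\rangle$, and let $D(2,3,n)=\langle x,y\mid x^2=y^3=(xy)^n=1\rangle$ be the Von Dyck group. There is a homomorphism $\pi:\overline D_n\to D(2,3,n)$ with $\pi(a)=y^2x$ and $\pi(b)=xy^2$; it is surjective, and its kernel is central and is the cyclic group generated by $a^n=b^n$. So $\overline D_n$ is a central extension of $D(2,3,n)$, and moreover: 1. If $n\in\{3,4,5\}$, there is a short exact sequence $1\to\mathbb Z_2\to\overline D_n\xrightarrow{\ \pi\ }D(2,3,n)\to1$, in which the generator of $\mathbb Z_2$ goes to $a^n$. The group $\overline D_n$ is isomorphic to the binary tetrahedral group for $n=3$, the binary octahedral group for $n=4$, and the binary icosahedral group for $n=5$. (These are the groups of unit quaternions whose associated rotations of $\mathbb R^3$ preserve a regular tetrahedron, octahedron or icosahedron centred at the origin.) 2. If $n\ge 6$, the group $D(2,3,n)$ is infinite, and there is a short exact sequence $1\to\mathbb Z\to\overline D_n\xrightarrow{\ \pi\ }D(2,3,n)\to1$, in which the generator $1$ of $\mathbb Z$ goes to $a^n$. In particular $a^n$ has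 infinite order. 3. The extension is universal in the sense that it is induced by a universal covering. Let $G$ be the group of orientation preserving isometries of the sphere if $n\le5$ ($G=SO(3)$), of the Euclidean plane if $n=6$, and of the hyperbolic plane if $n\ge7$ ($G=PSL(2,\mathbb R)$). Let $p:\widetilde G\to G$ be the universal covering group: the homotopy classes, relative to the end points, of paths in $G$ that start at the identity, with pointwise multiplication; $p$ takes the end point. Let $A$, $B$ be two vertices of an equilateral geodesic triangle with angles $2\pi/n$ in the sphere or plane. Then there are homomorphisms $\rho:D(2,3,n)\to G$ and $\Phi:\overline D_n\to\widetilde G$ such that $p\circ\Phi=\rho\circ\pi$, such that $\Phi(a)$ and $\Phi(b)$ are the classes of the continuous rotations about $A$ and about $B$ (in the same sense) by an angle growing from $0$ to $2\pi/n$, and such that $\overline D_n$ is the pull-back of $p$ along $\rho$: for all $d\in D(2,3,n)$ and $g\in\widetilde G$ with $p(g)=\rho(d)$ there is exactly one $w\in\overline D_n$ with $\pi(w)=d$ and $\Phi(w)=g$. -/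

import Mathlib

open scoped unitInterval Quaternion

noncomputable section

namespace VonDyckCover

/-! ### The presented groups -/

/-- The relators of the presentation `⟨x, y | x ^ l = y ^ m = (x y) ^ n = 1⟩`. -/
def vonDyckRels (l m n : ℕ) : Set (FreeGroup (Fin 2)) :=
  {FreeGroup.of 0 ^ l, FreeGroup.of 1 ^ m, (FreeGroup.of 0 * FreeGroup.of 1) ^ n}

/-- The Von Dyck group `D(l, m, n)`. -/
abbrev VonDyck (l m n : ℕ) : Type := PresentedGroup (vonDyckRels l m n)

/-- The generator `x` of `D(l, m, n)`. -/
def VonDyck.x {l m n : ℕ} : VonDyck l m n := PresentedGroup.of 0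

/-- The generator `y` of `D(l, m, n)`. -/
def VonDyck.y {l m n : ℕ} : VonDyck l m n := PresentedGroup.of 1

/-- The relators of the presentation `⟨a, b | a b a = b a b, a b² a = b ^ (n - 2)⟩`, where
`n ≥ 2`. -/
def dBarRels (n : ℕ) : Set (FreeGroup (Fin 2)) :=
  {(FreeGroup.of 0 * FreeGroup.of 1 * FreeGroup.of 0) *
      (FreeGroup.of 1 * FreeGroup.of 0 * FreeGroup.of 1)⁻¹,
    (FreeGroup.of 0 * FreeGroup.of 1 ^ 2 * FreeGroup.of 0) * (FreeGroup.of 1 ^ (n - 2))⁻¹}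

/-- The group `⟨a, b | a b a = b a b, a b² a = b ^ (n - 2)⟩`, where `n ≥ 2`. -/
abbrev DBar (n : ℕ) : Type := PresentedGroup (dBarRels n)

/-- The generator `a`. -/
def DBar.a {n : ℕ} : DBar n := PresentedGroup.of 0

/-- The generator `b`. -/
def DBar.b {n : ℕ} : DBar n := PresentedGroup.of 1

/-! ### The binary polyhedral groups -/

/-- For a set `V` of quaternions (in practice the vertices of a polyhedron in the space `ℝ³` of
pure quaternions), the group of unit quaternions `q` whose rotation `v ↦ q v q⁻¹` maps `V` onto
itself: the preimage in `SU(2)` of the group of rotational symmetries of `V`. -/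
def binarySymmetryGroup (V : Set ℍ[ℝ]) : Subgroup (unitary ℍ[ℝ]) where
  carrier := {q | (fun v : ℍ[ℝ] => (q : ℍ[ℝ]) * v * star (q : ℍ[ℝ])) '' V = V}
  one_mem' := by simp
  mul_mem' := by
    intro p q hp hq
    simp only [Set.mem_ofPred_eq] at hp hq ⊢
    conv_rhs => rw [← hp, ← hq]
    rw [Set.image_image]
    simp [mul_assoc]
  inv_mem' := by
    intro q hq
    simp only [Set.mem_ofPred_eq] at hq ⊢
    have h : star (q : ℍ[ℝ]) * (q : ℍ[ℝ]) = 1 := Unitary.coe_star_mul_self q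
    conv_lhs => rw [← hq]
    rw [Set.image_image]
    have h2 : ∀ v : ℍ[ℝ], ((q⁻¹ : unitary ℍ[ℝ]) : ℍ[ℝ]) * ((q : ℍ[ℝ]) * v * star (q : ℍ[ℝ])) *
        star ((q⁻¹ : unitary ℍ[ℝ]) : ℍ[ℝ]) = v := by
      intro v
      have h3 : ((q⁻¹ : unitary ℍ[ℝ]) : ℍ[ℝ]) = star (q : ℍ[ℝ]) := rfl
      rw [h3, star_star]
      calc star (q : ℍ[ℝ]) * ((q : ℍ[ℝ]) * v * star (q : ℍ[ℝ])) * (q : ℍ[ℝ])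
          = (star (q : ℍ[ℝ]) * (q : ℍ[ℝ])) * v * (star (q : ℍ[ℝ]) * (q : ℍ[ℝ])) := by
            simp only [mul_assoc]
        _ = v := by rw [h, one_mul, mul_one]
    simp [h2]

/-- The vertices of a regular tetrahedron. -/
def tetrahedron : Set ℍ[ℝ] :=
  {⟨0, 1, 1, 1⟩, ⟨0, 1, -1, -1⟩, ⟨0, -1, 1, -1⟩, ⟨0, -1, -1, 1⟩}

/-- The vertices of a regular octahedron. -/
def octahedron : Set ℍ[ℝ] :=
  {⟨0, 1, 0, 0⟩, ⟨0, -1, 0, 0⟩, ⟨0, 0, 1, 0⟩, ⟨0, 0, -1, 0⟩, ⟨0, 0, 0, 1⟩, ⟨0, 0, 0, -1⟩}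

/-- The vertices of a regular icosahedron: the cyclic permutations of `(0, ±1, ±φ)`. -/
def icosahedron : Set ℍ[ℝ] :=
  {v | ∃ s ∈ ({1, -1} : Set ℝ), ∃ t ∈ ({1, -1} : Set ℝ),
    v = ⟨0, 0, s, t * Real.goldenRatio⟩ ∨ v = ⟨0, s, t * Real.goldenRatio, 0⟩ ∨
      v = ⟨0, t * Real.goldenRatio, 0, s⟩}

/-- The binary tetrahedral group. -/
abbrev BinaryTetrahedral : Type := binarySymmetryGroup tetrahedron

/-- The binary octahedral group. -/
abbrev BinaryOctahedral : Type := binarySymmetryGroup octahedron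

/-- The binary icosahedral group. -/
abbrev BinaryIcosahedral : Type := binarySymmetryGroup icosahedron

/-! ### The universal covering group -/

section UniversalCovering

variable (G : Type*) [Group G] [TopologicalSpace G] [IsTopologicalGroup G]

/-- The paths in `G` that start at the identity, with pointwise multiplication. -/
def basedPaths : Subgroup C(I, G) where
  carrier := {γ | γ 0 = 1}
  one_mem' := rfl
  mul_mem' := by
    intro γ δ hγ hδ
    simp only [Set.mem_ofPred_eq, ContinuousMap.mul_apply] at *
    rw [hγ, hδ, one_mul]
  inv_mem' := by
    intro γ hγ
    simp only [Set.mem_ofPred_eq, ContinuousMap.inv_apply] at *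
    rw [hγ, inv_one]

/-- Homotopy of paths relative to both end points, as a congruence. -/
def pathHomotopyCon : Con (basedPaths G) where
  r γ δ := (γ : C(I, G)).HomotopicRel (δ : C(I, G)) {0, 1}
  iseqv :=
    { refl := fun γ => ContinuousMap.HomotopicRel.refl (γ : C(I, G))
      symm := fun h => h.symm
      trans := fun h k => h.trans k }
  mul' := by
    rintro γ γ' δ δ' ⟨H⟩ ⟨K⟩
    refine ⟨⟨⟨⟨fun p => H p * K p, by fun_prop⟩, ?_, ?_⟩, ?_⟩⟩
    · intro s
      simp
    · intro s
      simp
    · intro t s hs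
      have h1 := H.eq_fst t hs
      have h2 := K.eq_fst t hs
      change H (t, s) * K (t, s) = _
      rw [h1, h2]
      rfl

/-- The homotopy classes (relative to the end points) of paths in `G` that start at the identity,
under pointwise multiplication: the universal covering group of `G`, when `G` is a connected Lie
group. -/
abbrev UniversalCoveringGroup : Type _ := (pathHomotopyCon G).Quotient

/-- The universal covering map: the class of a path goes to the end point of the path. -/
def coveringMap : UniversalCoveringGroup G →* G :=
  (pathHomotopyCon G).lift
    { toFun := fun γ => (γ : C(I, G)) 1
      map_one' := rfl
      map_mul' := fun _ _ => rfl }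
    (by
      intro γ δ h
      exact h.fst_eq_snd (by simp))

end UniversalCovering

/-- Let `π` be a homomorphism from `⟨a, b | a b a = b a b, a b² a = b ^ (n - 2)⟩` to
`D(2, 3, n)`, and let `α` and `β` be paths in `G` that start at the identity. Then `π` is the
restriction (pull-back) of the universal covering map of `G`, along a homomorphism `ρ` from
`D(2, 3, n)` to `G`, in such a way that `a` and `b` are the homotopy classes of `α` and `β`. -/
def IsRestrictionOfUniversalCovering {G : Type*} [Group G] [TopologicalSpace G]
    [IsTopologicalGroup G] {n : ℕ} (π : DBar n →* VonDyck 2 3 n) (α β : basedPaths G) : Prop :=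
  ∃ (ρ : VonDyck 2 3 n →* G) (Φ : DBar n →* UniversalCoveringGroup G),
    Φ DBar.a = (α : UniversalCoveringGroup G) ∧
    Φ DBar.b = (β : UniversalCoveringGroup G) ∧
    (∀ w, coveringMap G (Φ w) = ρ (π w)) ∧
    ∀ (d : VonDyck 2 3 n) (g : UniversalCoveringGroup G), coveringMap G g = ρ d →
      ∃! w, π w = d ∧ Φ w = g

/-- If `r θ` is the rotation by the angle `θ` about a base point, this is the continuous rotation
by an angle growing from `0` to `2π / n`, about the image of the base point under `t`
(the path starts at the identity of `G`). -/
def rotationPath {G : Type*} [Group G] [TopologicalSpace G] [IsTopologicalGroup G]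
    (r : C(ℝ, G)) (hr : r 0 = 1) (t : G) (n : ℕ) : basedPaths G :=
  ⟨⟨fun s => t * r ((s : ℝ) * (2 * Real.pi / n)) * t⁻¹, by fun_prop⟩, by
    change t * r (((0 : I) : ℝ) * (2 * Real.pi / n)) * t⁻¹ = 1
    simp [hr]⟩

/-! ### The rotation group of the sphere -/

/-- The rotation group `SO(3)` of the sphere. -/
abbrev SO3 : Type := Matrix.specialOrthogonalGroup (Fin 3) ℝ

instance : IsTopologicalGroup SO3 where
  continuous_mul := by
    refine Continuous.subtype_mk ?_ _
    exact (continuous_subtype_val.comp continuous_fst).mul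
      (continuous_subtype_val.comp continuous_snd)
  continuous_inv := by
    refine Continuous.subtype_mk ?_ _
    exact continuous_subtype_val.matrix_transpose

/-- The rotation by `θ` about the third axis. -/
def sphereRotation : C(ℝ, SO3) where
  toFun θ := ⟨!![Real.cos θ, -Real.sin θ, 0; Real.sin θ, Real.cos θ, 0; 0, 0, 1], by
    rw [Matrix.mem_specialOrthogonalGroup_iff, Matrix.mem_orthogonalGroup_iff]
    have h := Real.sin_sq_add_cos_sq θ
    constructor
    · ext i j
      fin_cases i <;> fin_cases j <;>
        simp [Matrix.mul_apply, Fin.sum_univ_three] <;> linarith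
    · simp [Matrix.det_fin_three]
      linarith⟩
  continuous_toFun := by
    refine Continuous.subtype_mk (continuous_matrix fun i j => ?_) _
    fin_cases i <;> fin_cases j <;> simp <;> fun_prop

/-- The rotation by `c` about the second axis; it moves the north pole by the distance `c`. -/
def sphereShift (c : ℝ) : SO3 :=
  ⟨!![Real.cos c, 0, Real.sin c; 0, 1, 0; -Real.sin c, 0, Real.cos c], by
    rw [Matrix.mem_specialOrthogonalGroup_iff, Matrix.mem_orthogonalGroup_iff]
    have h := Real.sin_sq_add_cos_sq c
    constructor
    · ext i j
      fin_cases i <;> fin_cases j <;>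
        simp [Matrix.mul_apply, Fin.sum_univ_three] <;> linarith
    · simp [Matrix.det_fin_three]
      linarith⟩

theorem sphereRotation_zero : sphereRotation 0 = 1 := by
  apply Subtype.ext
  change !![Real.cos 0, -Real.sin 0, 0; Real.sin 0, Real.cos 0, 0; 0, 0, 1] =
    (1 : Matrix (Fin 3) (Fin 3) ℝ)
  ext i j
  fin_cases i <;> fin_cases j <;> simp

/-- `cos (2π / n) / (1 - cos (2π / n))`. By the law of cosines for angles, this is the cosine
(`n = 3, 4, 5`) or the hyperbolic cosine (`n ≥ 7`) of the side of the equilateral triangle with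
angles `2π / n` in the sphere or the hyperbolic plane. -/
def sideCos (n : ℕ) : ℝ :=
  Real.cos (2 * Real.pi / n) / (1 - Real.cos (2 * Real.pi / n))

/-- The continuous rotation by `2π / n` about a first vertex of the spherical equilateral triangle
with angles `2π / n`. -/
def sphereA (n : ℕ) : basedPaths SO3 := rotationPath sphereRotation sphereRotation_zero 1 n

/-- The continuous rotation by `2π / n` about a second vertex of the spherical equilateral triangle
with angles `2π / n`. -/
def sphereB (n : ℕ) : basedPaths SO3 :=
  rotationPath sphereRotation sphereRotation_zero (sphereShift (Real.arccos (sideCos n))) n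

/-! ### The orientation preserving isometries of the Euclidean plane -/

/-- The group of orientation preserving isometries `z ↦ u z + v`, `‖u‖ = 1`, of the Euclidean plane
`ℂ`, realized by the matrices with rows `(u, v)` and `(0, 1)`. -/
def euclideanIsometries : Subgroup (GL (Fin 2) ℂ) where
  carrier := {g | ‖g 0 0‖ = 1 ∧ g 1 0 = 0 ∧ g 1 1 = 1}
  one_mem' := by simp
  mul_mem' := by
    rintro g h ⟨h1, h2, h3⟩ ⟨k1, k2, k3⟩
    simp [Matrix.mul_apply, Fin.sum_univ_two, h1, h2, h3, k1, k2, k3]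
  inv_mem' := by
    rintro g ⟨h1, h2, h3⟩
    have hne : g 0 0 ≠ 0 := by
      intro h0
      rw [h0, norm_zero] at h1
      exact zero_ne_one h1
    have hd : (g : Matrix (Fin 2) (Fin 2) ℂ).det = g 0 0 := by
      rw [Matrix.det_fin_two, h2, h3]
      ring
    have hv : ((g⁻¹ : GL (Fin 2) ℂ) : Matrix (Fin 2) (Fin 2) ℂ) =
        (g 0 0)⁻¹ • !![1, -(g 0 1); 0, g 0 0] := by
      rw [Matrix.coe_units_inv, Matrix.inv_def, Matrix.adjugate_fin_two, hd, h2, h3,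
        Ring.inverse_eq_inv']
      simp
    simp only [Set.mem_ofPred_eq, hv]
    simp [h1, hne]

/-- The orientation preserving isometry `z ↦ u z + v`. -/
def euclideanMk (u : Circle) (v : ℂ) : euclideanIsometries :=
  ⟨⟨!![(u : ℂ), v; 0, 1], !![((u⁻¹ : Circle) : ℂ), -((u⁻¹ : Circle) : ℂ) * v; 0, 1],
    by ext i j; fin_cases i <;> fin_cases j <;> simp [Matrix.mul_apply, Fin.sum_univ_two],
    by ext i j; fin_cases i <;> fin_cases j <;> simp [Matrix.mul_apply, Fin.sum_univ_two]⟩,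
    by exact ⟨Circle.norm_coe u, rfl, rfl⟩⟩

/-- The rotation by `θ` about the origin. -/
def euclideanRotation : C(ℝ, euclideanIsometries) where
  toFun θ := euclideanMk (Circle.exp θ) 0
  continuous_toFun := by
    refine Continuous.subtype_mk (Units.continuous_iff.2 ⟨?_, ?_⟩) _
    · refine continuous_matrix fun i j => ?_
      fin_cases i <;> fin_cases j <;> simp <;> fun_prop
    · refine continuous_matrix fun i j => ?_
      have h : Continuous fun θ : ℝ => (((Circle.exp θ)⁻¹ : Circle) : ℂ) :=
        continuous_subtype_val.comp Circle.exp.continuous.inv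
      fin_cases i <;> fin_cases j
      · exact h
      · simpa using continuous_const
      · exact continuous_const
      · exact continuous_const

theorem euclideanRotation_zero : euclideanRotation 0 = 1 := by
  apply Subtype.ext
  apply Units.ext
  change !![((Circle.exp 0 : Circle) : ℂ), 0; 0, 1] = (1 : Matrix (Fin 2) (Fin 2) ℂ)
  ext i j
  fin_cases i <;> fin_cases j <;> simp

/-- The continuous rotation by `2π / n` about `0`. -/
def euclideanA (n : ℕ) : basedPaths euclideanIsometries :=
  rotationPath euclideanRotation euclideanRotation_zero 1 n

/-- The continuous rotation by `2π / n` about `1`. -/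
def euclideanB (n : ℕ) : basedPaths euclideanIsometries :=
  rotationPath euclideanRotation euclideanRotation_zero (euclideanMk 1 1) n

/-! ### The orientation preserving isometries of the hyperbolic plane -/

/-- The group `PSL(2, ℝ)` of orientation preserving isometries of the hyperbolic plane, acting on
the upper half plane by Möbius transformations. -/
abbrev PSL2R : Type := Matrix.ProjectiveSpecialLinearGroup (Fin 2) ℝ

/-- The hyperbolic rotation by `θ` about the point `i` of the upper half plane. -/
def hyperbolicRotation : C(ℝ, PSL2R) where
  toFun θ := QuotientGroup.mk (⟨!![Real.cos (θ / 2), Real.sin (θ / 2);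
      -Real.sin (θ / 2), Real.cos (θ / 2)], by
    have h := Real.sin_sq_add_cos_sq (θ / 2)
    rw [Matrix.det_fin_two_of]
    linarith⟩ : Matrix.SpecialLinearGroup (Fin 2) ℝ)
  continuous_toFun := by
    refine QuotientGroup.continuous_mk.comp (Continuous.subtype_mk ?_ _)
    refine continuous_matrix fun i j => ?_
    fin_cases i <;> fin_cases j <;> simp <;> fun_prop

/-- The hyperbolic translation `z ↦ exp c * z`; it moves the point `i` by the distance `|c|`. -/
def hyperbolicShift (c : ℝ) : PSL2R :=
  QuotientGroup.mk (⟨!![Real.exp (c / 2), 0; 0, Real.exp (-(c / 2))], by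
    rw [Matrix.det_fin_two_of, ← Real.exp_add]
    simp⟩ : Matrix.SpecialLinearGroup (Fin 2) ℝ)

theorem hyperbolicRotation_zero : hyperbolicRotation 0 = 1 := by
  refine congrArg (QuotientGroup.mk (s := Subgroup.center (Matrix.SpecialLinearGroup (Fin 2) ℝ)))
    (?_ : _ = (1 : Matrix.SpecialLinearGroup (Fin 2) ℝ))
  ext i j
  fin_cases i <;> fin_cases j <;> simp

/-- The continuous rotation by `2π / n` about a first vertex of the hyperbolic equilateral triangle
with angles `2π / n`. -/
def hyperbolicA (n : ℕ) : basedPaths PSL2R :=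
  rotationPath hyperbolicRotation hyperbolicRotation_zero 1 n

/-- The continuous rotation by `2π / n` about a second vertex of the hyperbolic equilateral triangle
with angles `2π / n`. -/
def hyperbolicB (n : ℕ) : basedPaths PSL2R :=
  rotationPath hyperbolicRotation hyperbolicRotation_zero
    (hyperbolicShift (Real.arcosh (sideCos n))) n

end VonDyckCover

end

/-!
Write `α`, `β` for the classes of the continuous rotations by `2π / n` about two vertices of the
triangle, `π` for the projection, `p` for the universal covering, and `z = a ^ n`.

*The central extension.* The braid relation makes the half twist `a b a` interchange `a` and `b`,
and turns the second relation into `(a b a) ^ 2 = b ^ n`. Hence `z = b ^ n = (a b a) ^ 2` commutes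
with `a` and `b`. Since `z = (a b) ^ 3` also, and `a b a` times `a b` is `a⁻¹` up to `z`, the map
`x ↦ a b a`, `y ↦ a b` inverts the projection modulo the powers of `z` (`ker_projection`).

*The homomorphism to the universal covering group.* A loop commutes with all paths up to homotopy,
so loops are central (`mem_center_of_coveringMap_eq_one`), and `α ^ n`, `β ^ n` are both the class
`ω` of the full rotation about the base point, whatever the centres of rotation
(`rotationPath_pow`). It remains to see that `α β α = β α β` and that the square of this half twist
is `ω` (`exists_hom`). Such relations are decided by the end points of lifted paths
(`DevelopsPaths`): in `SO(3)`, of lifts to the group of unit quaternions, which covers it and is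
simply connected (`isCoveringMap_toSO3`, `sphere_homotopicRel`); in the Euclidean group and in
`PSL(2, ℝ)`, which are the product of a circle and a vector space (by the Iwasawa decomposition in
the second case), of lifts to the product of a line and the vector space
(`developsPaths_of_circle`). In the curved cases, the relations between the end points amount to the
law of cosines. In the hyperbolic case the half twist is moreover a continuous rotation by `π` about
the midpoint of the side (`exists_hom_hyperbolic`).

*The pull-back.* So there is a homomorphism `Φ` with `Φ z = ω`, and the lifts of `1` are the powers
of `ω`. If `z` and `ω` have the same order, then `Φ` maps the kernel of `π` isomorphically onto the
kernel of `p`, which makes the extension the pull-back of `p` (`isRestriction_of_hom`). For `n ≥ 6`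
the order of `ω` is infinite, hence so is that of `z`. For `n ≤ 5` the order of `ω` is two, and
`z ^ 2 = 1` since some element of the group conjugates `z` to `z⁻¹` (`DBar.a_pow_sq_three`,
`DBar.a_pow_sq_four`, `DBar.a_pow_sq_five`).

*The binary polyhedral groups.* Unit quaternions over the rotations about two adjacent vertices
satisfy the relations. The relations reduce every word to one of a few representatives of the double
cosets of the powers of `b` (`DBar.exists_double_coset`); these correspond to the orbits of the
stabilizer of a vertex on the vertices, so only the powers of `b` fix the vertex, and the
homomorphism is injective; transitivity makes it surjective
(`nonempty_mulEquiv_binarySymmetryGroup`).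

*Infinite Von Dyck groups.* If `D(2, 3, n)` were finite, then the transfer to the centre would be a
power map, and `z` would have finite order for `n > 6` (`infinite_vonDyck`). For `n = 6` the product
`a b⁻¹` acts as a translation (`infinite_vonDyck_six`).
-/

namespace VonDyckCover

/-! ### The group `⟨a, b | a b a = b a b, a b² a = b ^ (n - 2)⟩` -/

section Braid

variable {H : Type*} [Group H] {a b : H}

/-- Given the braid relation, `a b² a = b ^ (n - 2)` says that the square of the half twist `a b a`
is `b ^ n`. -/
theorem braid_sq_eq_pow_iff (h : a * b * a = b * a * b) {n : ℕ} (hn : 2 ≤ n) :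
    (a * b * a) ^ 2 = b ^ n ↔ a * b ^ 2 * a = b ^ (n - 2) := by
  obtain ⟨m, rfl⟩ := Nat.exists_eq_add_of_le' hn
  have h2 : (a * b * a) ^ 2 = b * (a * b ^ 2 * a) * b := by
    rw [h]; simp only [pow_two, mul_assoc]
  rw [h2, Nat.add_sub_cancel, pow_succ b (m + 1), pow_succ' b m, mul_left_inj, mul_right_inj]

/-- The half twist `a b a` interchanges `a` and `b`. -/
theorem braid_semiconj (h : a * b * a = b * a * b) : SemiconjBy (a * b * a) b a := by
  change a * b * a * b = a * (a * b * a)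
  conv_rhs => rw [h]
  simp only [mul_assoc]

theorem braid_semiconj' (h : a * b * a = b * a * b) : SemiconjBy (a * b * a) a b := by
  have := braid_semiconj h.symm
  rwa [← h] at this

theorem braid_pow_eq_pow (h : a * b * a = b * a * b) {n : ℕ} (h2 : (a * b * a) ^ 2 = b ^ n) :
    a ^ n = b ^ n := by
  have h3 := (braid_semiconj h).pow_right n
  have h4 : Commute (a * b * a) (b ^ n) := h2 ▸ (Commute.refl _).pow_right 2
  exact mul_right_cancel (h3.eq.symm.trans h4.eq)

end Braid

namespace DBar

variable {n : ℕ}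

theorem relations (hn : 2 ≤ n) : (a * b * a : DBar n) = b * a * b ∧
    (a * b * a : DBar n) ^ 2 = b ^ n := by
  have h1 : (a * b * a : DBar n) = b * a * b := by
    have h := PresentedGroup.one_of_mem (rels := dBarRels n) (Or.inl rfl)
    rw [map_mul, map_inv, mul_inv_eq_one] at h
    exact h
  have h2 : (a * b ^ 2 * a : DBar n) = b ^ (n - 2) := by
    have h := PresentedGroup.one_of_mem (rels := dBarRels n) (Or.inr rfl)
    rw [map_mul, map_inv, mul_inv_eq_one] at h
    exact h
  exact ⟨h1, (braid_sq_eq_pow_iff h1 hn).2 h2⟩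

theorem a_pow_eq_b_pow (hn : 2 ≤ n) : (a : DBar n) ^ n = b ^ n :=
  braid_pow_eq_pow (relations hn).1 (relations hn).2

theorem closure_eq_top : Subgroup.closure {a, b} = (⊤ : Subgroup (DBar n)) := by
  rw [← PresentedGroup.closure_range_of (dBarRels n)]
  congr 1
  ext g
  simp only [Set.mem_insert_iff, Set.mem_singleton_iff, Set.mem_range, Fin.exists_fin_two]
  exact or_congr eq_comm eq_comm

theorem mem_center_iff {g : DBar n} : g ∈ Subgroup.center (DBar n) ↔ Commute g a ∧ Commute g b := by
  rw [Subgroup.mem_center_iff]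
  refine ⟨fun h => ⟨(h a).symm, (h b).symm⟩, fun h w => ?_⟩
  have : Subgroup.closure {a, b} ≤ Subgroup.centralizer {g} := by
    rw [Subgroup.closure_le]
    rintro x (rfl | rfl)
    · exact Subgroup.mem_centralizer_singleton_iff.2 h.1.symm.eq
    · exact Subgroup.mem_centralizer_singleton_iff.2 h.2.symm.eq
  rw [closure_eq_top] at this
  exact Subgroup.mem_centralizer_singleton_iff.1 (this (Subgroup.mem_top w))

theorem a_pow_mem_center (hn : 2 ≤ n) : (a : DBar n) ^ n ∈ Subgroup.center (DBar n) := by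
  rw [mem_center_iff]
  refine ⟨(Commute.refl a).pow_left n, ?_⟩
  rw [a_pow_eq_b_pow hn]
  exact (Commute.refl b).pow_left n

/-- The homomorphism given by a pair of elements that satisfy the braid relation, such that the
square of the half twist is an `n`-th power. -/
def lift {H : Type*} [Group H] (hn : 2 ≤ n) (A B : H) (h1 : A * B * A = B * A * B)
    (h2 : (A * B * A) ^ 2 = B ^ n) : DBar n →* H :=
  PresentedGroup.toGroup (f := ![A, B]) (by
    rintro r (rfl | rfl)
    · rw [map_mul, map_inv, mul_inv_eq_one]
      simpa using h1
    · rw [map_mul, map_inv, mul_inv_eq_one]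
      simpa using (braid_sq_eq_pow_iff h1 hn).1 h2)

section

variable {H : Type*} [Group H] (hn : 2 ≤ n) (A B : H) (h1 : A * B * A = B * A * B)
    (h2 : (A * B * A) ^ 2 = B ^ n)

@[simp] theorem lift_a : lift hn A B h1 h2 a = A := by simp [lift, a]

@[simp] theorem lift_b : lift hn A B h1 h2 b = B := by simp [lift, b]

end

@[ext high] theorem hom_ext {H : Type*} [Group H] {f g : DBar n →* H} (ha : f a = g a)
    (hb : f b = g b) : f = g := by
  refine PresentedGroup.ext fun i => ?_
  fin_cases i
  · exact ha
  · exact hb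

end DBar

namespace VonDyck

theorem relations {l m n : ℕ} : (x : VonDyck l m n) ^ l = 1 ∧ (y : VonDyck l m n) ^ m = 1 ∧
    (x * y : VonDyck l m n) ^ n = 1 :=
  ⟨PresentedGroup.one_of_mem (rels := vonDyckRels l m n) (Or.inl rfl),
    PresentedGroup.one_of_mem (rels := vonDyckRels l m n) (Or.inr (Or.inl rfl)),
    PresentedGroup.one_of_mem (rels := vonDyckRels l m n) (Or.inr (Or.inr rfl))⟩

theorem x_mul_x {m n : ℕ} : (x : VonDyck 2 m n) * x = 1 := by rw [← pow_two, relations.1]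

theorem y_sq {l n : ℕ} : (y : VonDyck l 3 n) ^ 2 = y⁻¹ := by
  rw [eq_inv_iff_mul_eq_one, ← pow_succ, relations.2.1]

theorem half_twist {n : ℕ} : (y ^ 2 * x * (x * y ^ 2) * (y ^ 2 * x) : VonDyck 2 3 n) = x := by
  calc _ = y ^ 2 * (x * x) * y ^ 2 * (y ^ 2 * x) := by simp only [mul_assoc]
    _ = y ^ 3 * y ^ 3 * x := by rw [x_mul_x, mul_one, ← mul_assoc, ← pow_add, ← pow_add, ← pow_add]
    _ = x := by rw [relations.2.1, one_mul, one_mul]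

theorem half_twist' {n : ℕ} : (x * y ^ 2 * (y ^ 2 * x) * (x * y ^ 2) : VonDyck 2 3 n) = x := by
  calc _ = x * (y ^ 2 * y ^ 2) * (x * x) * y ^ 2 := by simp only [mul_assoc]
    _ = x * (y ^ 3 * y ^ 3) := by rw [x_mul_x, mul_one, mul_assoc, ← pow_add, ← pow_add, ← pow_add]
    _ = x := by rw [relations.2.1, one_mul, mul_one]

end VonDyck

section Projection

variable {n : ℕ}

/-- The homomorphism `a ↦ y² x`, `b ↦ x y²`. It takes `a b a` to `x` and `a b` to `y`. -/
def projection (hn : 2 ≤ n) : DBar n →* VonDyck 2 3 n :=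
  DBar.lift hn (VonDyck.y ^ 2 * VonDyck.x) (VonDyck.x * VonDyck.y ^ 2)
    (VonDyck.half_twist.trans VonDyck.half_twist'.symm) (by
      have h3 : (VonDyck.x * VonDyck.y ^ 2 : VonDyck 2 3 n) =
          VonDyck.x * (VonDyck.x * VonDyck.y)⁻¹ * VonDyck.x⁻¹ := by
        rw [VonDyck.y_sq, mul_inv_rev, mul_assoc, mul_assoc, ← mul_inv_rev,
          VonDyck.x_mul_x, inv_one, mul_one]
      rw [VonDyck.half_twist, VonDyck.relations.1, h3, conj_pow, inv_pow, VonDyck.relations.2.2,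
        inv_one, mul_one, mul_inv_cancel])

theorem projection_a (hn : 2 ≤ n) : projection hn DBar.a = VonDyck.y ^ 2 * VonDyck.x :=
  DBar.lift_a _ _ _ _ _

theorem projection_b (hn : 2 ≤ n) : projection hn DBar.b = VonDyck.x * VonDyck.y ^ 2 :=
  DBar.lift_b _ _ _ _ _

theorem projection_surjective (hn : 2 ≤ n) : Function.Surjective (projection hn) := by
  have h1 : projection hn (DBar.a * DBar.b) = VonDyck.y := by
    rw [map_mul, projection_a, projection_b, mul_assoc, ← mul_assoc VonDyck.x, VonDyck.x_mul_x,
      one_mul, VonDyck.y_sq, ← mul_inv_rev, ← pow_two, VonDyck.y_sq, inv_inv]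
  have h2 : projection hn (DBar.a * DBar.b * DBar.a) = VonDyck.x := by
    rw [map_mul, map_mul, projection_a, projection_b, VonDyck.half_twist]
  rw [← MonoidHom.range_eq_top, eq_top_iff, ← PresentedGroup.closure_range_of,
    Subgroup.closure_le]
  rintro _ ⟨i, rfl⟩
  fin_cases i
  · exact ⟨_, h2⟩
  · exact ⟨_, h1⟩

/-- Modulo the powers of `a ^ n`, the elements `a b a` and `a b` satisfy the relations of `x` and
`y`, which inverts the projection. -/
theorem ker_projection (hn : 2 ≤ n) :
    (projection hn).ker = Subgroup.zpowers (DBar.a ^ n) := by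
  obtain ⟨h1, h2⟩ := DBar.relations hn
  have hab := DBar.a_pow_eq_b_pow hn
  have hc : Subgroup.zpowers ((DBar.a : DBar n) ^ n) ≤ Subgroup.center _ := by
    rw [Subgroup.zpowers_le]
    exact DBar.a_pow_mem_center hn
  have hN : (Subgroup.zpowers ((DBar.a : DBar n) ^ n)).Normal := ⟨fun g hg w => by
    rwa [Subgroup.mem_center_iff.1 (hc hg) w, mul_inv_cancel_right]⟩
  set N := Subgroup.zpowers ((DBar.a : DBar n) ^ n) with hNdef
  have hz : (QuotientGroup.mk (DBar.a ^ n) : DBar n ⧸ N) = 1 :=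
    (QuotientGroup.eq_one_iff _).2 (Subgroup.mem_zpowers _)
  have h3 : (DBar.a * DBar.b : DBar n) ^ 3 = DBar.a ^ n := by
    rw [hab, ← h2]
    calc (DBar.a * DBar.b : DBar n) ^ 3
        = (DBar.a * DBar.b * DBar.a) * (DBar.b * DBar.a * DBar.b) := by
          simp only [pow_succ, pow_zero, one_mul, mul_assoc]
      _ = _ := by rw [← h1, pow_two]
  -- the inverse of `x y` corresponds to `a`
  have h4 : (DBar.a * DBar.b * DBar.a * (DBar.a * DBar.b) : DBar n) = DBar.a ^ n * DBar.a⁻¹ := by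
    rw [hab, ← h2, pow_two]; group
  let ψ : VonDyck 2 3 n →* DBar n ⧸ N := PresentedGroup.toGroup
    (f := ![QuotientGroup.mk (DBar.a * DBar.b * DBar.a), QuotientGroup.mk (DBar.a * DBar.b)]) (by
      rintro r (rfl | rfl | rfl)
      · rw [map_pow, FreeGroup.lift_apply_of, Matrix.cons_val_zero, ← QuotientGroup.mk_pow, h2,
          ← hab, hz]
      · rw [map_pow, FreeGroup.lift_apply_of, Matrix.cons_val_one, Matrix.cons_val_fin_one,
          ← QuotientGroup.mk_pow, h3, hz]
      · rw [map_pow, map_mul, FreeGroup.lift_apply_of, FreeGroup.lift_apply_of,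
          Matrix.cons_val_zero, Matrix.cons_val_one, Matrix.cons_val_fin_one,
          ← QuotientGroup.mk_mul, h4, QuotientGroup.mk_mul, hz, one_mul, QuotientGroup.mk_inv,
          inv_pow, ← QuotientGroup.mk_pow, hz, inv_one])
  have hψx : ψ VonDyck.x = QuotientGroup.mk (DBar.a * DBar.b * DBar.a) := by
    simp [ψ, VonDyck.x]
  have hψy : ψ VonDyck.y = QuotientGroup.mk (DBar.a * DBar.b) := by
    simp [ψ, VonDyck.y]
  have hψ : ψ.comp (projection hn) = QuotientGroup.mk' N := by
    apply DBar.hom_ext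
    · rw [MonoidHom.comp_apply, projection_a, map_mul, map_pow, hψx, hψy, ← QuotientGroup.mk_pow,
        ← QuotientGroup.mk_mul]
      have : ((DBar.a * DBar.b) ^ 2 * (DBar.a * DBar.b * DBar.a) : DBar n) =
          DBar.a ^ n * DBar.a := by
        rw [← h3]; simp only [pow_succ, pow_zero, one_mul, mul_assoc]
      rw [this, QuotientGroup.mk_mul, hz, one_mul]
      rfl
    · rw [MonoidHom.comp_apply, projection_b, map_mul, map_pow, hψx, hψy, ← QuotientGroup.mk_pow,
        ← QuotientGroup.mk_mul]
      have : (DBar.a * DBar.b * DBar.a * (DBar.a * DBar.b) ^ 2 : DBar n) =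
          DBar.b * DBar.a ^ n := by
        rw [← h3, h1]; simp only [pow_succ, pow_zero, one_mul, mul_assoc]
      rw [this, QuotientGroup.mk_mul, hz, mul_one]
      rfl
  apply le_antisymm
  · intro w hw
    have := DFunLike.congr_fun hψ w
    rw [MonoidHom.comp_apply, MonoidHom.mem_ker.1 hw, map_one] at this
    exact (QuotientGroup.eq_one_iff w).1 this.symm
  · rw [hNdef, Subgroup.zpowers_le, MonoidHom.mem_ker, hab, ← h2]
    rw [map_pow, map_mul, map_mul, projection_a, projection_b, VonDyck.half_twist,
      VonDyck.relations.1]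

theorem ker_projection_le_center (hn : 2 ≤ n) :
    (projection hn).ker ≤ Subgroup.center (DBar n) := by
  rw [ker_projection, Subgroup.zpowers_le]
  exact DBar.a_pow_mem_center hn

end Projection

/-! ### The order of the central element in the spherical cases, and double cosets -/

section Spherical

variable {H : Type*} [Group H] {a b g p q : H}

/-- Let `z = p ^ m = q ^ m`. If `g` conjugates `p` to `q⁻¹`, then it conjugates `z` to `z⁻¹`; if it
commutes with `z` also, then `z ^ 2 = 1`. -/
theorem pow_eq_inv_of_semiconj {m : ℕ} (h : SemiconjBy g p q⁻¹) (h1 : p ^ m = q ^ m)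
    (h2 : Commute g (q ^ m)) : (q ^ m) ^ 2 = 1 := by
  have h3 := (h.pow_right m).eq
  rw [inv_pow, h1, h2.eq] at h3
  rw [pow_two, ← eq_inv_iff_mul_eq_one]
  exact mul_right_cancel h3

theorem braid_mul_inv (h : a * b * a = b * a * b) : b * a * b⁻¹ = a⁻¹ * b * a := by
  rw [mul_inv_eq_iff_eq_mul, mul_assoc, mul_assoc, ← mul_assoc b, eq_inv_mul_iff_mul_eq,
    ← mul_assoc, h, mul_assoc]

end Spherical

namespace DBar

theorem a_sq_mul {n : ℕ} (hn : 2 ≤ n) : (a * b ^ 2 * a : DBar n) = b ^ (n - 2) :=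
  (braid_sq_eq_pow_iff (relations hn).1 hn).1 (relations hn).2

theorem b_sq_mul {n : ℕ} (hn : 2 ≤ n) : (b * a ^ 2 * b : DBar n) = a ^ (n - 2) := by
  refine (braid_sq_eq_pow_iff (relations hn).1.symm hn).1 ?_
  rw [a_pow_eq_b_pow hn, ← (relations hn).1, (relations hn).2]

theorem commute_b_pow {n : ℕ} (hn : 2 ≤ n) (w : DBar n) : Commute w (b ^ n) := by
  rw [← a_pow_eq_b_pow hn]
  exact Subgroup.mem_center_iff.1 (a_pow_mem_center hn) w

/-- The half twist inverts `a b⁻¹`, whose square is the inverse of `b ^ 3`. -/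
theorem a_pow_sq_three : ((a : DBar 3) ^ 3) ^ 2 = 1 := by
  have hn : 2 ≤ 3 := by norm_num
  have h2 : (a * b ^ 2 * a : DBar 3) = b ^ 1 := a_sq_mul hn
  have h3 : (a * b⁻¹ : DBar 3) ^ 2 = (b ^ 3)⁻¹ := by
    rw [eq_inv_iff_mul_eq_one]
    calc (a * b⁻¹ : DBar 3) ^ 2 * b ^ 3 = a * b⁻¹ * a * b ^ 2 := by simp [pow_succ, mul_assoc]
      _ = a * b⁻¹ * (b ^ 3 * (b ^ 3)⁻¹) * a * b ^ 2 := by simp [pow_succ, mul_assoc]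
      _ = a * b ^ 2 * ((b ^ 3)⁻¹ * a) * b ^ 2 := by simp [pow_succ, mul_assoc]
      _ = (a * b ^ 2 * a) * b⁻¹ := by
        rw [((commute_b_pow hn a).inv_right).symm.eq]; simp [pow_succ, mul_assoc]
      _ = 1 := by rw [h2]; simp [pow_succ]
  have h4 : SemiconjBy (a * b * a : DBar 3) (a * b⁻¹) (a * b⁻¹)⁻¹ := by
    rw [mul_inv_rev, inv_inv]
    exact (braid_semiconj' (relations hn).1).mul_right
      (braid_semiconj (relations hn).1).inv_right
  have h5 := pow_eq_inv_of_semiconj h4 (m := 2) rfl (by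
    rw [h3]; exact (commute_b_pow hn _).inv_right)
  rw [h3, inv_pow, inv_eq_one] at h5
  rw [a_pow_eq_b_pow hn, h5]

/-- Conjugation by `b²` inverts `a`. -/
theorem a_pow_sq_four : ((a : DBar 4) ^ 4) ^ 2 = 1 := by
  have hn : 2 ≤ 4 := by norm_num
  have h2 : (a * b ^ 2 * a : DBar 4) = b ^ 2 := a_sq_mul hn
  have h4 : SemiconjBy (b ^ 2 : DBar 4) a a⁻¹ := by
    change b ^ 2 * a = a⁻¹ * b ^ 2
    rw [eq_inv_mul_iff_mul_eq, ← mul_assoc, h2]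
  exact pow_eq_inv_of_semiconj h4 rfl (Subgroup.mem_center_iff.1 (a_pow_mem_center hn) _)

section Five

theorem a_bInv_a_five : (a * b⁻¹ * a : DBar 5) = b⁻¹ * a ^ 2 * b⁻¹ := by
  have hn : 2 ≤ 5 := by norm_num
  have h3 : (b * a ^ 2 * b : DBar 5) = a ^ 3 := b_sq_mul hn
  calc (a * b⁻¹ * a : DBar 5) = b⁻¹ * (b * a * b⁻¹) * a := by simp [mul_assoc]
    _ = b⁻¹ * a⁻¹ * (b * a ^ 2 * b) * b⁻¹ := by
      rw [braid_mul_inv (relations hn).1]; simp [pow_succ, mul_assoc]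
    _ = b⁻¹ * a ^ 2 * b⁻¹ := by rw [h3]; simp [pow_succ, mul_assoc]

theorem a_bCubed_a_five : (a * b ^ 3 * a : DBar 5) = b ^ 4 * a * b⁻¹ := by
  have hn : 2 ≤ 5 := by norm_num
  have h1 := (relations hn).1
  have h2 : (a * b ^ 2 * a : DBar 5) = b ^ 3 := a_sq_mul hn
  symm
  calc (b ^ 4 * a * b⁻¹ : DBar 5) = b * b ^ 3 * a * b⁻¹ := by simp [pow_succ, mul_assoc]
    _ = (b * a * b) * b * a ^ 2 * b⁻¹ := by rw [← h2]; simp [pow_succ, mul_assoc]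
    _ = a * b * (a * b * a) * a * b⁻¹ := by rw [← h1]; simp [pow_succ, mul_assoc]
    _ = a * b ^ 2 * (a * b * a) * b⁻¹ := by nth_rw 1 [h1]; simp [pow_succ, mul_assoc]
    _ = a * b ^ 3 * a := by rw [h1]; simp [pow_succ, mul_assoc]

theorem a_mul_bCubed_aSq_five : (a * (b ^ 3 * a ^ 2) : DBar 5) = b ^ 3 * a ^ 2 * b⁻¹ := by
  calc (a * (b ^ 3 * a ^ 2) : DBar 5) = (a * b ^ 3 * a) * a := by simp [pow_succ, mul_assoc]
    _ = b ^ 4 * (a * b⁻¹ * a) := by rw [a_bCubed_a_five]; simp [pow_succ, mul_assoc]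
    _ = b ^ 3 * a ^ 2 * b⁻¹ := by rw [a_bInv_a_five]; simp [pow_succ, mul_assoc]

/-- `b³ a²` conjugates `b⁻¹` to `a`. -/
theorem a_pow_sq_five : ((a : DBar 5) ^ 5) ^ 2 = 1 := by
  have hn : 2 ≤ 5 := by norm_num
  have h4 : SemiconjBy (b ^ 3 * a ^ 2 : DBar 5)⁻¹ a b⁻¹ := by
    have : SemiconjBy (b ^ 3 * a ^ 2 : DBar 5) b⁻¹ a := a_mul_bCubed_aSq_five.symm
    exact this.inv_symm_left
  rw [a_pow_eq_b_pow hn]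
  exact pow_eq_inv_of_semiconj h4 (a_pow_eq_b_pow hn) (commute_b_pow hn _)

theorem b_mul_a_bInv_aSq_five : (b * (a * b⁻¹ * a ^ 2) : DBar 5) = a⁻¹ * b ^ 2 * a ^ 2 * b := by
  have hn : 2 ≤ 5 := by norm_num
  have h3 : (b * a ^ 2 * b : DBar 5) = a ^ 3 := b_sq_mul hn
  calc (b * (a * b⁻¹ * a ^ 2) : DBar 5) = (b * a * b⁻¹) * a ^ 2 := by simp [pow_succ, mul_assoc]
    _ = a⁻¹ * b * a ^ 3 := by rw [braid_mul_inv (relations hn).1]; simp [pow_succ, mul_assoc]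
    _ = a⁻¹ * b ^ 2 * a ^ 2 * b := by rw [← h3]; simp [pow_succ, mul_assoc]

theorem b_mul_a_bInv_aSq_five' :
    (b * (a * b⁻¹ * a ^ 2) : DBar 5) = a * b⁻¹ * a ^ 2 * b⁻¹ := by
  have hn : 2 ≤ 5 := by norm_num
  have h1 := (relations hn).1
  have h2 : (a * b ^ 2 * a : DBar 5) = b ^ 3 := a_sq_mul hn
  have h6 : (a⁻¹ * b⁻¹ * a : DBar 5) = b * a⁻¹ * b⁻¹ := by
    calc (a⁻¹ * b⁻¹ * a : DBar 5) = a⁻¹ * b⁻¹ * (a * b * a) * a⁻¹ * b⁻¹ := by simp [mul_assoc]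
      _ = _ := by rw [h1]; simp [mul_assoc]
  rw [b_mul_a_bInv_aSq_five]
  calc (a⁻¹ * b ^ 2 * a ^ 2 * b : DBar 5) = a⁻¹ * a⁻¹ * (a * b ^ 2 * a) * a * b := by
        simp [pow_succ, mul_assoc]
    _ = a⁻¹ * a⁻¹ * b ^ 3 * a * b := by rw [h2]
    _ = a⁻¹ * a⁻¹ * b * a⁻¹ * (a * b ^ 2 * a) * b := by simp [pow_succ, mul_assoc]
    _ = a⁻¹ * a⁻¹ * (b * a⁻¹ * b⁻¹) * b ^ 5 := by rw [h2]; simp [pow_succ, mul_assoc]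
    _ = a⁻¹ * a⁻¹ * (a⁻¹ * b⁻¹ * a) * a ^ 5 := by rw [h6, a_pow_eq_b_pow hn]
    _ = a⁻¹ * a⁻¹ * (a ^ 5 * (a⁻¹ * b⁻¹ * a)) := by
      rw [mul_assoc, Subgroup.mem_center_iff.1 (a_pow_mem_center hn) (a⁻¹ * b⁻¹ * a)]
    _ = a * (a * b⁻¹ * a) := by simp [pow_succ, mul_assoc]
    _ = a * b⁻¹ * a ^ 2 * b⁻¹ := by rw [a_bInv_a_five]; simp [pow_succ, mul_assoc]

end Five

/-- A set of words that contains `1` and whose double cosets with respect to the powers of `b` are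
permuted by `a` represents all elements. -/
theorem exists_double_coset {n : ℕ} (hn : 2 ≤ n) (R : Set (DBar n)) (h1 : 1 ∈ R)
    (hR : ∀ r ∈ R, ∀ i < n, ∃ s ∈ R, ∃ k l : ℤ, a * (b ^ i * r) = b ^ k * s * b ^ l)
    (w : DBar n) : ∃ r ∈ R, ∃ k l : ℤ, w = b ^ k * r * b ^ l := by
  have hn0 : (n : ℤ) ≠ 0 := by positivity
  have ha : ∀ w, (∃ r ∈ R, ∃ k l : ℤ, w = b ^ k * r * b ^ l) →
      ∃ r ∈ R, ∃ k l : ℤ, a * w = b ^ k * r * b ^ l := by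
    rintro _ ⟨r, hr, k, l, rfl⟩
    obtain ⟨i, hi⟩ := Int.eq_ofNat_of_zero_le (Int.emod_nonneg k hn0)
    have hin : i < n := by
      have := Int.emod_lt_of_pos k (b := n) (by positivity)
      omega
    obtain ⟨s, hs, k', l', h⟩ := hR r hr i hin
    refine ⟨s, hs, k', l' + n * (k / n) + l, ?_⟩
    have hk : (b : DBar n) ^ k = b ^ i * (b ^ n) ^ (k / n) := by
      rw [← zpow_natCast b n, ← zpow_mul, ← zpow_natCast b i, ← zpow_add, ← hi,
        Int.emod_add_mul_ediv]
    have hc := (commute_b_pow hn r).zpow_right (k / n)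
    calc a * (b ^ k * r * b ^ l) = a * (b ^ i * ((b ^ n) ^ (k / n) * r)) * b ^ l := by
          rw [hk]; simp only [mul_assoc]
      _ = a * (b ^ i * r) * ((b ^ n) ^ (k / n) * b ^ l) := by
          rw [← hc.eq]; simp only [mul_assoc]
      _ = b ^ k' * s * b ^ (l' + n * (k / n) + l) := by
          rw [h, zpow_add, zpow_add, zpow_mul, zpow_natCast]; simp only [mul_assoc]
  have hai : ∀ (m : ℕ) (w), (∃ r ∈ R, ∃ k l : ℤ, w = b ^ k * r * b ^ l) →
      ∃ r ∈ R, ∃ k l : ℤ, a ^ m * w = b ^ k * r * b ^ l := by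
    intro m
    induction m with
    | zero => simp
    | succ m ih =>
      intro w hw
      rw [pow_succ', mul_assoc]
      exact ha _ (ih w hw)
  have hw : w ∈ Subgroup.closure ({a, b} : Set (DBar n)) := closure_eq_top ▸ Subgroup.mem_top w
  induction hw using Subgroup.closure_induction_left with
  | one => exact ⟨1, h1, 0, 0, by simp⟩
  | mul_left x hx y _ ih =>
    rcases hx with rfl | rfl
    · exact ha _ ih
    · obtain ⟨r, hr, k, l, h⟩ := ih
      exact ⟨r, hr, 1 + k, l, by rw [h, zpow_add, zpow_one]; simp only [mul_assoc]⟩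
  | inv_mul_cancel x hx y _ ih =>
    rcases hx with rfl | rfl
    · obtain ⟨r, hr, k, l, h⟩ := hai (n - 1) _ ih
      refine ⟨r, hr, k, l - n, ?_⟩
      have hc := (commute_b_pow hn (a⁻¹ * y)).eq
      have : (a : DBar n) ^ (n - 1) = b ^ n * a⁻¹ := by
        rw [eq_mul_inv_iff_mul_eq, ← pow_succ, Nat.sub_add_cancel (by omega), a_pow_eq_b_pow hn]
      rw [this, mul_assoc, ← hc] at h
      rw [zpow_sub, zpow_natCast, ← mul_assoc, ← h, mul_inv_cancel_right]
    · obtain ⟨r, hr, k, l, h⟩ := ih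
      exact ⟨r, hr, -1 + k, l, by rw [h, zpow_add, zpow_neg_one]; simp only [mul_assoc]⟩

/-- Two double cosets: a vertex of the tetrahedron, and the three others. -/
theorem exists_double_coset_three (w : DBar 3) :
    ∃ r ∈ ({1, a} : Set (DBar 3)), ∃ k l : ℤ, w = b ^ k * r * b ^ l := by
  have hn : 2 ≤ 3 := by norm_num
  refine exists_double_coset hn _ (by simp) ?_ w
  rintro r (rfl | rfl) i hi
  · exact ⟨a, by simp, 0, i, by simp⟩
  · interval_cases i
    · refine ⟨a, by simp, -1, -1, ?_⟩
      have h : (b * a ^ 2 * b : DBar 3) = a ^ 1 := b_sq_mul hn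
      calc (a * (b ^ 0 * a) : DBar 3) = b⁻¹ * (b * a ^ 2 * b) * b⁻¹ := by simp [pow_succ, mul_assoc]
        _ = _ := by rw [h]; simp [pow_succ, mul_assoc, zpow_ofNat]
    · refine ⟨a, by simp, 1, 1, ?_⟩
      rw [pow_one, ← mul_assoc, (relations hn).1, zpow_one]
    · refine ⟨1, by simp, 1, 0, ?_⟩
      rw [← mul_assoc, a_sq_mul hn]; simp

/-- Three double cosets: a vertex of the octahedron, its four neighbours, and its antipode. -/
theorem exists_double_coset_four (w : DBar 4) :
    ∃ r ∈ ({1, a, a ^ 2} : Set (DBar 4)), ∃ k l : ℤ, w = b ^ k * r * b ^ l := by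
  have hn : 2 ≤ 4 := by norm_num
  have h : (b * a ^ 2 * b : DBar 4) = a ^ 2 := b_sq_mul hn
  have h' : (a * b ^ 2 * a : DBar 4) = b ^ 2 := a_sq_mul hn
  refine exists_double_coset hn _ (by simp) ?_ w
  rintro r (rfl | rfl | rfl) i hi
  · exact ⟨a, by simp, 0, i, by simp⟩
  · interval_cases i
    · exact ⟨a ^ 2, by simp, 0, 0, by simp [pow_two]⟩
    · refine ⟨a, by simp, 1, 1, ?_⟩
      rw [pow_one, ← mul_assoc, (relations hn).1, zpow_one]
    · refine ⟨1, by simp, 2, 0, ?_⟩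
      rw [← mul_assoc, h']; simp [zpow_ofNat]
    · refine ⟨a, by simp, -1, 3, ?_⟩
      calc (a * (b ^ 3 * a) : DBar 4) = b⁻¹ * (b * a * b⁻¹) * (b ^ 4 * a) := by
            simp [pow_succ, mul_assoc]
        _ = b⁻¹ * a⁻¹ * (b * a ^ 2 * b) * b ^ 3 := by
          rw [braid_mul_inv (relations hn).1, ← (commute_b_pow hn a).eq]; simp [pow_succ, mul_assoc]
        _ = _ := by rw [h]; simp [pow_succ, mul_assoc, zpow_ofNat]
  · refine ⟨a, by simp, 2, 2 - i, ?_⟩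
    have h3 : SemiconjBy (a ^ 2 : DBar 4) b⁻¹ b := by
      change a ^ 2 * b⁻¹ = b * a ^ 2
      nth_rw 1 [← h]
      simp [pow_succ, mul_assoc]
    rw [← (h3.pow_right i).eq]
    calc (a * (a ^ 2 * b⁻¹ ^ i) : DBar 4) = a⁻¹ * a ^ 4 * b ^ (-i : ℤ) := by
          rw [inv_pow, zpow_neg, zpow_natCast]; simp [pow_succ, mul_assoc]
      _ = b ^ 4 * a⁻¹ * b ^ (-i : ℤ) := by
          rw [a_pow_eq_b_pow hn, (commute_b_pow hn a⁻¹).eq]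
      _ = b ^ 2 * (a * b ^ 2 * a) * a⁻¹ * b ^ (-i : ℤ) := by rw [h']; simp [pow_succ, mul_assoc]
      _ = _ := by simp [pow_succ, mul_assoc, zpow_ofNat, zpow_sub]

/-- Four double cosets: a vertex of the icosahedron, its five neighbours, their antipodes, and the
antipode of the vertex. The representative `a b⁻¹ a²` of the last conjugates `b⁻¹` to `b`. -/
theorem exists_double_coset_five (w : DBar 5) :
    ∃ r ∈ ({1, a, a ^ 2, a * b⁻¹ * a ^ 2} : Set (DBar 5)), ∃ k l : ℤ,
      w = b ^ k * r * b ^ l := by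
  have hn : 2 ≤ 5 := by norm_num
  have h1 := (relations hn).1
  have h : (b * a ^ 2 * b : DBar 5) = a ^ 3 := b_sq_mul hn
  have h' : (a * b ^ 2 * a : DBar 5) = b ^ 3 := a_sq_mul hn
  refine exists_double_coset hn _ (by simp) ?_ w
  rintro r (rfl | rfl | rfl | rfl) i hi
  · exact ⟨a, by simp, 0, i, by simp⟩
  · interval_cases i
    · exact ⟨a ^ 2, by simp, 0, 0, by simp [pow_two]⟩
    · refine ⟨a, by simp, 1, 1, ?_⟩
      rw [pow_one, ← mul_assoc, h1, zpow_one]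
    · refine ⟨1, by simp, 3, 0, ?_⟩
      rw [← mul_assoc, h']; simp [zpow_ofNat]
    · refine ⟨a, by simp, 4, -1, ?_⟩
      rw [← mul_assoc, a_bCubed_a_five]; simp [zpow_ofNat]
    · refine ⟨a ^ 2, by simp, -1, 4, ?_⟩
      calc (a * (b ^ 4 * a) : DBar 5) = a * b⁻¹ * (b ^ 5 * a) := by simp [pow_succ, mul_assoc]
        _ = a * b⁻¹ * a * b ^ 5 := by rw [← (commute_b_pow hn a).eq]; simp [pow_succ, mul_assoc]
        _ = _ := by rw [a_bInv_a_five]; simp [pow_succ, mul_assoc, zpow_ofNat]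
  · interval_cases i
    · refine ⟨a ^ 2, by simp, 1, 1, ?_⟩
      rw [zpow_one, h]; simp [pow_succ, mul_assoc]
    · refine ⟨a, by simp, 2, 1, ?_⟩
      calc (a * (b ^ 1 * a ^ 2) : DBar 5) = (a * b * a) * a := by simp [pow_succ, mul_assoc]
        _ = b * (a * b * a) := by
          rw [h1]; simp only [mul_assoc]; rw [← mul_assoc a, h1]; simp [mul_assoc]
        _ = _ := by rw [h1]; simp [pow_succ, mul_assoc, zpow_ofNat]
    · refine ⟨a, by simp, 3, 0, ?_⟩
      calc (a * (b ^ 2 * a ^ 2) : DBar 5) = (a * b ^ 2 * a) * a := by simp [pow_succ, mul_assoc]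
        _ = _ := by rw [h']; simp [pow_succ, mul_assoc, zpow_ofNat]
    · refine ⟨a ^ 2, by simp, 3, -1, ?_⟩
      rw [a_mul_bCubed_aSq_five]; simp [pow_succ, mul_assoc, zpow_ofNat]
    · refine ⟨a * b⁻¹ * a ^ 2, by simp, 0, 5, ?_⟩
      calc (a * (b ^ 4 * a ^ 2) : DBar 5) = a * b⁻¹ * (b ^ 5 * a ^ 2) := by
            simp [pow_succ, mul_assoc]
        _ = _ := by rw [← (commute_b_pow hn (a ^ 2)).eq]; simp [pow_succ, mul_assoc, zpow_ofNat]
  · refine ⟨a ^ 2, by simp, 2, 2 - i, ?_⟩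
    have h3 : SemiconjBy (a * b⁻¹ * a ^ 2 : DBar 5) b⁻¹ b := b_mul_a_bInv_aSq_five'.symm
    rw [← (h3.pow_right i).eq]
    have h4 : (a * b⁻¹ * a ^ 2 : DBar 5) = a⁻¹ * b ^ 2 * a ^ 2 * b ^ 2 := by
      have := b_mul_a_bInv_aSq_five.symm.trans b_mul_a_bInv_aSq_five'
      rw [eq_mul_inv_iff_mul_eq] at this
      rw [← this]; simp [pow_succ, mul_assoc]
    rw [h4, inv_pow]
    simp [pow_succ, mul_assoc, zpow_ofNat, zpow_sub]

end DBar

/-! ### The universal covering group as a central extension -/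

section Rotation

variable {G : Type*} [Group G] [TopologicalSpace G] {r : C(ℝ, G)}

theorem rotation_nsmul (hr : r 0 = 1) (hadd : ∀ s t, r (s + t) = r s * r t) (m : ℕ) (s : ℝ) :
    r (m * s) = r s ^ m := by
  induction m with
  | zero => simp [hr]
  | succ m ih => rw [pow_succ, ← ih, ← hadd]; push_cast; ring_nf

theorem rotation_zsmul (hr : r 0 = 1) (hadd : ∀ s t, r (s + t) = r s * r t) (m : ℤ) (s : ℝ) :
    r (m * s) = r s ^ m := by
  obtain ⟨k, rfl | rfl⟩ := m.eq_nat_or_neg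
  · simpa using rotation_nsmul hr hadd k s
  · rw [zpow_neg, zpow_natCast, ← rotation_nsmul hr hadd, eq_inv_iff_mul_eq_one, ← hadd]
    push_cast
    rw [← hr]
    ring_nf

end Rotation

section UniversalCovering

variable {G : Type*} [Group G] [TopologicalSpace G] [IsTopologicalGroup G]

theorem coveringMap_coe (γ : basedPaths G) :
    coveringMap G (γ : UniversalCoveringGroup G) = (γ : C(I, G)) 1 := rfl

theorem coe_eq_coe_iff {γ δ : basedPaths G} :
    (γ : UniversalCoveringGroup G) = δ ↔ (γ : C(I, G)).HomotopicRel (δ : C(I, G)) {0, 1} :=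
  Con.eq _

/-- The element `τ 1` acts on paths by conjugation in the same way as the class of `τ` acts on
homotopy classes: the homotopy retraces `τ` from `τ (max t s)`. -/
theorem conj_coe_eq (τ γ δ : basedPaths G)
    (h : ∀ s, (δ : C(I, G)) s = (τ : C(I, G)) 1 * (γ : C(I, G)) s * ((τ : C(I, G)) 1)⁻¹) :
    (δ : UniversalCoveringGroup G) = τ * γ * (τ : UniversalCoveringGroup G)⁻¹ := by
  symm
  change ((τ * γ * τ⁻¹ : basedPaths G) : UniversalCoveringGroup G) = δ
  rw [coe_eq_coe_iff]
  have hγ : (γ : C(I, G)) 0 = 1 := γ.2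
  have hδ : (δ : C(I, G)) 0 = 1 := δ.2
  refine ⟨⟨⟨⟨fun p => (τ : C(I, G)) (max p.1 p.2) * (γ : C(I, G)) p.2 *
    ((τ : C(I, G)) (max p.1 p.2))⁻¹, by fun_prop⟩, ?_, ?_⟩, ?_⟩⟩
  · intro s
    simp
  · intro s
    have : max 1 s = 1 := max_eq_left s.2.2
    simp [this, h]
  · rintro t s (rfl | rfl)
    · simp [hγ]
    · have : max t 1 = 1 := max_eq_right t.2.2
      simp [this]

/-- Loops represent central elements: conjugating a loop `γ` by a path `τ` can be undone by
shrinking `τ` towards its origin. -/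
theorem mem_center_of_coveringMap_eq_one {g : UniversalCoveringGroup G}
    (hg : coveringMap G g = 1) : g ∈ Subgroup.center (UniversalCoveringGroup G) := by
  obtain ⟨γ, rfl⟩ := Con.mk'_surjective g
  have hγ : (γ : C(I, G)) 0 = 1 := γ.2
  have hγ1 : (γ : C(I, G)) 1 = 1 := hg
  rw [Subgroup.mem_center_iff]
  intro w
  obtain ⟨τ, rfl⟩ := Con.mk'_surjective w
  rw [← mul_inv_eq_iff_eq_mul]
  change ((τ * γ * τ⁻¹ : basedPaths G) : UniversalCoveringGroup G) = γ
  rw [coe_eq_coe_iff]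
  have hτ : (τ : C(I, G)) 0 = 1 := τ.2
  refine ⟨⟨⟨⟨fun p => (τ : C(I, G)) (σ p.1 * p.2) * (γ : C(I, G)) p.2 *
    ((τ : C(I, G)) (σ p.1 * p.2))⁻¹, by fun_prop⟩, ?_, ?_⟩, ?_⟩⟩
  · intro s
    simp
  · intro s
    simp [hτ]
  · rintro t s (rfl | rfl)
    · simp [hγ]
    · simp [hγ1]

/-- The full rotation about the base point, the class of the loop `s ↦ r (2π s)`. -/
noncomputable def fullRotation (r : C(ℝ, G)) (hr : r 0 = 1) : UniversalCoveringGroup G :=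
  (rotationPath r hr 1 1 : basedPaths G)

section Rotation

variable {r : C(ℝ, G)} {hr : r 0 = 1}

theorem coveringMap_fullRotation (h2π : r (2 * Real.pi) = 1) :
    coveringMap G (fullRotation r hr) = 1 := by
  change (1 : G) * r (((1 : I) : ℝ) * (2 * Real.pi / (1 : ℕ))) * 1⁻¹ = 1
  simp [h2π]

/-- The `k`-th power of the full rotation is the class of the loop `s ↦ r (2π k s)`. -/
theorem fullRotation_zpow (hadd : ∀ s t, r (s + t) = r s * r t) (k : ℤ) (δ : basedPaths G)
    (h : ∀ s : I, (δ : C(I, G)) s = r (k * (2 * Real.pi) * s)) :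
    fullRotation r hr ^ k = δ := by
  change ((rotationPath r hr 1 1 ^ k : basedPaths G) : UniversalCoveringGroup G) = δ
  congr 1
  apply Subtype.ext
  ext s
  rw [h, mul_assoc, rotation_zsmul hr hadd]
  simp [rotationPath, mul_comm]

/-- The `n`-th power of the rotation by `2π / n` about any point is the full rotation. -/
theorem rotationPath_pow (hadd : ∀ s t, r (s + t) = r s * r t) (h2π : r (2 * Real.pi) = 1)
    (τ : basedPaths G) {n : ℕ} (hn : n ≠ 0) :
    (rotationPath r hr ((τ : C(I, G)) 1) n : UniversalCoveringGroup G) ^ n =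
      fullRotation r hr := by
  have hn' : (n : ℝ) ≠ 0 := by exact_mod_cast hn
  have h1 : ((rotationPath r hr ((τ : C(I, G)) 1) n ^ n : basedPaths G) :
      UniversalCoveringGroup G) = τ * fullRotation r hr * (τ : UniversalCoveringGroup G)⁻¹ := by
    refine conj_coe_eq τ (rotationPath r hr 1 1) _ fun s => ?_
    simp only [rotationPath, SubgroupClass.coe_pow, ContinuousMap.pow_apply,
      ContinuousMap.coe_mk, conj_pow, ← rotation_nsmul hr hadd]
    simp only [one_mul, inv_one, mul_one, Nat.cast_one, div_one]
    congr 3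
    field_simp
  have h2 := Subgroup.mem_center_iff.1
    (mem_center_of_coveringMap_eq_one (coveringMap_fullRotation (hr := hr) h2π)) τ
  rw [h2, mul_inv_cancel_right] at h1
  exact h1

theorem rotationPath_one_pow (hadd : ∀ s t, r (s + t) = r s * r t) (h2π : r (2 * Real.pi) = 1)
    {n : ℕ} (hn : n ≠ 0) :
    (rotationPath r hr 1 n : UniversalCoveringGroup G) ^ n = fullRotation r hr :=
  rotationPath_pow hadd h2π 1 hn

/-- Rotations about two points that satisfy the braid relation, such that the square of the half
twist is the full rotation, define a homomorphism to the universal covering group. -/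
theorem exists_hom (hadd : ∀ s t, r (s + t) = r s * r t) (h2π : r (2 * Real.pi) = 1)
    (τ : basedPaths G) {t : G} (hτ : (τ : C(I, G)) 1 = t) {n : ℕ} (hn : 2 ≤ n)
    {A B : UniversalCoveringGroup G} (hA : A = (rotationPath r hr 1 n : basedPaths G))
    (hB : B = (rotationPath r hr t n : basedPaths G))
    (h1 : A * B * A = B * A * B) (h2 : (A * B * A) ^ 2 = fullRotation r hr) :
    ∃ Φ : DBar n →* UniversalCoveringGroup G, Φ DBar.a = A ∧ Φ DBar.b = B ∧
      Φ (DBar.a ^ n) = fullRotation r hr := by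
  subst hτ
  have hBn : B ^ n = fullRotation r hr := by rw [hB, rotationPath_pow hadd h2π τ (by omega)]
  have hAn : A ^ n = fullRotation r hr := by rw [hA, rotationPath_one_pow hadd h2π (by omega)]
  exact ⟨DBar.lift hn A B h1 (h2.trans hBn.symm), by simp, by simp, by simp [hAn]⟩

/-- If the loops are the powers of the full rotation, and `a ^ n` has the same order as the full
rotation, then the central extensions correspond under a homomorphism. -/
theorem isRestriction_of_hom {n : ℕ} (hn : 2 ≤ n) (h2π : r (2 * Real.pi) = 1)
    (hker : ∀ g, coveringMap G g = 1 → g ∈ Subgroup.zpowers (fullRotation r hr))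
    {α β : basedPaths G} (Φ : DBar n →* UniversalCoveringGroup G) (ha : Φ DBar.a = α)
    (hb : Φ DBar.b = β) (hΦ : Φ (DBar.a ^ n) = fullRotation r hr)
    (hinj : ∀ k : ℤ, fullRotation r hr ^ k = 1 → (DBar.a ^ n : DBar n) ^ k = 1) :
    IsRestrictionOfUniversalCovering (projection hn) α β := by
  have hle : (projection hn).ker ≤ ((coveringMap G).comp Φ).ker := by
    rw [ker_projection, Subgroup.zpowers_le, MonoidHom.mem_ker, MonoidHom.comp_apply, hΦ,
      coveringMap_fullRotation h2π]
  have hsurj := projection_surjective hn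
  let ρ : VonDyck 2 3 n →* G := (projection hn).liftOfSurjective hsurj ⟨_, hle⟩
  have hρ : ∀ w, coveringMap G (Φ w) = ρ (projection hn w) := fun w =>
    ((projection hn).liftOfRightInverse_comp_apply _ _ ⟨_, hle⟩ w).symm
  refine ⟨ρ, Φ, ha, hb, hρ, fun d g hg => ?_⟩
  obtain ⟨w, rfl⟩ := hsurj d
  obtain ⟨k, hk⟩ := hker (g * (Φ w)⁻¹) (by rw [map_mul, map_inv, hg, hρ, mul_inv_cancel])
  have hk : fullRotation r hr ^ k = g * (Φ w)⁻¹ := hk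
  refine ⟨(DBar.a ^ n) ^ k * w, ⟨?_, ?_⟩, ?_⟩
  · have : DBar.a ^ n ∈ (projection hn).ker := by
      rw [ker_projection]; exact Subgroup.mem_zpowers _
    rw [map_mul, map_zpow, MonoidHom.mem_ker.1 this, one_zpow, one_mul]
  · rw [map_mul, map_zpow, hΦ, hk, inv_mul_cancel_right]
  · rintro v ⟨hv1, hv2⟩
    have hv : v * w⁻¹ ∈ (projection hn).ker := by
      rw [MonoidHom.mem_ker, map_mul, map_inv, hv1, mul_inv_cancel]
    rw [ker_projection] at hv
    obtain ⟨l, hl⟩ := hv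
    have hl : (DBar.a ^ n) ^ l = v * w⁻¹ := hl
    have h1 : fullRotation r hr ^ (l - k) = 1 := by
      rw [zpow_sub, hk, ← hΦ, ← map_zpow, hl, map_mul, map_inv, hv2, mul_inv_cancel]
    have h2 := hinj _ h1
    rw [zpow_sub, mul_inv_eq_one] at h2
    rw [← h2, hl, inv_mul_cancel_right]

end Rotation

/-- A continuous map `M : X → G` that serves as a simply connected covering of `G` as far as paths
from the identity are concerned: each of them is the development of a path in `X` from `x₀`, and
its homotopy class is determined by the end point of that path. -/
structure DevelopsPaths {X : Type*} [TopologicalSpace X] (M : C(X, G)) (x₀ : X) : Prop where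
  map_base : M x₀ = 1
  exists_lift : ∀ γ : basedPaths G, ∃ c : C(I, X), c 0 = x₀ ∧ M.comp c = γ
  homotopicRel_iff : ∀ c c' : C(I, X), c 0 = x₀ → c' 0 = x₀ →
    ((M.comp c).HomotopicRel (M.comp c') {0, 1} ↔ c 1 = c' 1)

namespace DevelopsPaths

variable {X : Type*} [TopologicalSpace X] {M : C(X, G)} {x₀ : X}

theorem coe_eq_coe_iff (h : DevelopsPaths M x₀) {γ δ : basedPaths G} (c d : C(I, X))
    (hc : c 0 = x₀) (hd : d 0 = x₀) (hγ : ∀ s, (γ : C(I, G)) s = M (c s))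
    (hδ : ∀ s, (δ : C(I, G)) s = M (d s)) :
    (γ : UniversalCoveringGroup G) = δ ↔ c 1 = d 1 := by
  have h1 : (γ : C(I, G)) = M.comp c := ContinuousMap.ext hγ
  have h2 : (δ : C(I, G)) = M.comp d := ContinuousMap.ext hδ
  rw [VonDyckCover.coe_eq_coe_iff, h1, h2, h.homotopicRel_iff c d hc hd]

end DevelopsPaths

/-- A covering group all of whose paths with the same end points are homotopic develops paths. -/
theorem developsPaths_of_isCoveringMap {X : Type*} [TopologicalSpace X] {M : C(X, G)} {x₀ : X}
    (hM : IsCoveringMap M) (h0 : M x₀ = 1)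
    (hX : ∀ c c' : C(I, X), c 0 = c' 0 → c 1 = c' 1 → c.HomotopicRel c' {0, 1}) :
    DevelopsPaths M x₀ where
  map_base := h0
  exists_lift γ := by
    obtain ⟨c, h1, h2⟩ := hM.exists_path_lifts (γ : C(I, G)) x₀ (γ.2.trans h0.symm)
    exact ⟨c, h2, ContinuousMap.ext fun s => congrFun h1 s⟩
  homotopicRel_iff c c' hc hc' := by
    have h2 := hM.homotopicRel_iff_comp (f₀ := c) (f₁ := c') (S := {0, 1})
      ⟨0, Or.inl rfl, hc.trans hc'.symm⟩
    refine Iff.trans (Iff.trans (by rfl) h2.symm) ⟨fun h => h.fst_eq_snd (by simp),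
      fun h => hX c c' (hc.trans hc'.symm) h⟩

/-- Suppose that `(κ, ν)` is a homeomorphism from `G` to the product of a circle and a vector
space. Its inverse, with an angle in place of the point of the circle, develops paths. -/
theorem developsPaths_of_circle {E : Type*} [AddCommGroup E] [Module ℝ E] [TopologicalSpace E]
    [IsTopologicalAddGroup E] [ContinuousSMul ℝ E] {M : C(ℝ × E, G)} (κ : C(G, Circle))
    (ν : C(G, E)) (hκ : ∀ p, κ (M p) = Circle.exp p.1) (hν : ∀ p, ν (M p) = p.2)
    (hM : ∀ g θ, Circle.exp θ = κ g → M (θ, ν g) = g) (h0 : M 0 = 1) :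
    DevelopsPaths M 0 where
  map_base := h0
  exists_lift γ := by
    have hκ1 : κ 1 = Circle.exp 0 := by rw [← h0, hκ]; rfl
    have hν1 : ν 1 = 0 := by rw [← h0, hν]; rfl
    have hγ : (γ : C(I, G)) 0 = 1 := γ.2
    obtain ⟨θ, h1, h2⟩ := Circle.isCoveringMap_exp.exists_path_lifts
      (κ.comp (γ : C(I, G))) 0 (by rw [ContinuousMap.comp_apply, hγ, hκ1])
    refine ⟨θ.prodMk (ν.comp (γ : C(I, G))), ?_, ContinuousMap.ext fun s => ?_⟩
    · change (θ 0, ν ((γ : C(I, G)) 0)) = 0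
      rw [h2, hγ, hν1]; rfl
    · exact hM _ _ (congrFun h1 s)
  homotopicRel_iff c c' hc hc' := by
    constructor
    · intro h
      have h1 : M (c 1) = M (c' 1) := h.fst_eq_snd (by simp)
      have h2 := h.comp_continuousMap κ
      have h3 : (((ContinuousMap.fst.comp c : C(I, ℝ)))).HomotopicRel
          (ContinuousMap.fst.comp c' : C(I, ℝ)) {0, 1} := by
        refine (Circle.isCoveringMap_exp.homotopicRel_iff_comp (f₀ := ContinuousMap.fst.comp c)
          (f₁ := ContinuousMap.fst.comp c') (S := {0, 1}) ⟨0, Or.inl rfl, ?_⟩).2 ?_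
        · simp [hc, hc']
        · convert h2 using 1
          · ext s; simp [hκ]
          · ext s; simp [hκ]
      refine Prod.ext (h3.fst_eq_snd (by simp)) ?_
      rw [← hν, h1, hν]
    · intro h
      refine ContinuousMap.HomotopicRel.comp_continuousMap ?_ M
      refine ⟨⟨⟨⟨fun p => c p.2 + (p.1 : ℝ) • (c' p.2 - c p.2), by fun_prop⟩, ?_, ?_⟩, ?_⟩⟩
      · intro s; simp
      · intro s; simp
      · rintro t s (rfl | rfl)
        · simp [hc, hc']
        · simp [h]

/-- The rotations are developed by the lines parallel to the axis of angles. Hence the loops are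
the powers of the full rotation, which are distinct. -/
theorem loops_of_circle {E : Type*} [AddCommGroup E] [Module ℝ E] [TopologicalSpace E]
    [IsTopologicalAddGroup E] [ContinuousSMul ℝ E] {M : C(ℝ × E, G)} (κ : C(G, Circle))
    (ν : C(G, E)) (hκ : ∀ p, κ (M p) = Circle.exp p.1) (hν : ∀ p, ν (M p) = p.2)
    (hM : ∀ g θ, Circle.exp θ = κ g → M (θ, ν g) = g) (h0 : M 0 = 1) {r : C(ℝ, G)} {hr : r 0 = 1}
    (hadd : ∀ s t, r (s + t) = r s * r t) (hrM : ∀ θ, r θ = M (θ, 0)) :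
    (∀ g, coveringMap G g = 1 → g ∈ Subgroup.zpowers (fullRotation r hr)) ∧
    ∀ k : ℤ, fullRotation r hr ^ k = 1 → k = 0 := by
  have hD := developsPaths_of_circle κ ν hκ hν hM h0
  have hκ1 : κ 1 = 1 := by rw [← h0, hκ]; exact Circle.exp_zero
  have hν1 : ν 1 = 0 := by rw [← h0, hν]; rfl
  let d : ℤ → basedPaths G := fun k => ⟨⟨fun s => r (k * (2 * Real.pi) * s), by fun_prop⟩, by
    change r (k * (2 * Real.pi) * ((0 : I) : ℝ)) = 1
    simp [hr]⟩
  constructor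
  · intro g hg
    obtain ⟨γ, rfl⟩ := Con.mk'_surjective g
    obtain ⟨c, hc0, hc⟩ := hD.exists_lift γ
    have hc' : ∀ s, (γ : C(I, G)) s = M (c s) := fun s => by rw [← hc]; rfl
    have hg : (γ : C(I, G)) 1 = 1 := hg
    rw [hc'] at hg
    have h1 : Circle.exp (c 1).1 = 1 := by rw [← hκ, hg, hκ1]
    have h2 : (c 1).2 = 0 := by rw [← hν, hg, hν1]
    obtain ⟨k, hk⟩ := Circle.exp_eq_one.1 h1
    refine ⟨k, ?_⟩
    change fullRotation _ _ ^ k = (γ : UniversalCoveringGroup G)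
    rw [fullRotation_zpow hadd k (d k) fun _ => rfl]
    refine (hD.coe_eq_coe_iff
      ⟨fun s => (k * (2 * Real.pi) * s, 0), by fun_prop⟩ c ?_ hc0 (fun s => hrM _) hc').2 ?_
    · simp
    · simp [Prod.ext_iff, hk, h2]
  · intro k hk
    rw [fullRotation_zpow hadd k (d k) fun _ => rfl] at hk
    have := (hD.coe_eq_coe_iff (δ := 1)
      ⟨fun s => (k * (2 * Real.pi) * s, 0), by fun_prop⟩ (ContinuousMap.const I 0)
      (by simp) rfl (fun s => hrM _) (fun s => hD.map_base.symm)).1 hk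
    simpa [Prod.ext_iff, Real.pi_ne_zero] using this

end UniversalCovering

/-! ### The Euclidean plane -/

section Euclidean

theorem euclideanMk_mul (u u' : Circle) (v v' : ℂ) :
    euclideanMk u v * euclideanMk u' v' = euclideanMk (u * u') (v + u * v') := by
  apply Subtype.ext
  apply Units.ext
  change !![(u : ℂ), v; 0, 1] * !![(u' : ℂ), v'; 0, 1] = !![((u * u' : Circle) : ℂ), _; 0, 1]
  ext i j
  fin_cases i <;> fin_cases j <;> simp [Matrix.mul_apply, Fin.sum_univ_two, add_comm]

theorem euclideanMk_one : euclideanMk 1 0 = 1 := by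
  have := euclideanRotation_zero
  rwa [show euclideanRotation 0 = euclideanMk (Circle.exp 0) 0 from rfl, Circle.exp_zero] at this

theorem continuous_euclideanMk : Continuous fun p : Circle × ℂ => euclideanMk p.1 p.2 := by
  refine Continuous.subtype_mk (Units.continuous_iff.2 ⟨?_, ?_⟩) _
  · refine continuous_matrix fun i j => ?_
    fin_cases i <;> fin_cases j <;> simp <;> fun_prop
  · have h : Continuous fun p : Circle × ℂ => ((p.1⁻¹ : Circle) : ℂ) :=
      continuous_subtype_val.comp ((continuous_inv (G := Circle)).comp continuous_fst)
    refine continuous_matrix fun i j => ?_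
    fin_cases i <;> fin_cases j
    · exact h
    · exact h.neg.mul continuous_snd
    · exact continuous_const
    · exact continuous_const

/-- The linear part of an orientation preserving isometry. -/
noncomputable def euclideanAngle : C(euclideanIsometries, Circle) where
  toFun g := ⟨(g : GL (Fin 2) ℂ) 0 0, mem_sphere_zero_iff_norm.2 g.2.1⟩
  continuous_toFun := Continuous.subtype_mk
    ((Units.continuous_val.comp continuous_subtype_val).matrix_elem 0 0) _

/-- The image of the origin under an orientation preserving isometry. -/
noncomputable def euclideanOrigin : C(euclideanIsometries, ℂ) where
  toFun g := (g : GL (Fin 2) ℂ) 0 1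
  continuous_toFun := (Units.continuous_val.comp continuous_subtype_val).matrix_elem 0 1

theorem euclideanMk_angle_origin (g : euclideanIsometries) :
    euclideanMk (euclideanAngle g) (euclideanOrigin g) = g := by
  apply Subtype.ext
  apply Units.ext
  ext i j
  fin_cases i <;> fin_cases j
  · rfl
  · rfl
  · exact g.2.2.1.symm
  · exact g.2.2.2.symm

/-- The isometry `z ↦ exp (i θ) z + v`. -/
noncomputable def euclideanDevelop : C(ℝ × ℂ, euclideanIsometries) where
  toFun p := euclideanMk (Circle.exp p.1) p.2
  continuous_toFun := continuous_euclideanMk.comp (by fun_prop : Continuous fun p : ℝ × ℂ =>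
    ((Circle.exp p.1 : Circle), p.2))

theorem euclideanDevelop_angle_origin (g : euclideanIsometries) (θ : ℝ)
    (h : Circle.exp θ = euclideanAngle g) : euclideanDevelop (θ, euclideanOrigin g) = g := by
  change euclideanMk (Circle.exp θ) _ = g
  rw [h, euclideanMk_angle_origin]

theorem euclideanDevelop_zero : euclideanDevelop 0 = 1 := by
  change euclideanMk (Circle.exp 0) 0 = 1
  rw [Circle.exp_zero, euclideanMk_one]

theorem developsPaths_euclidean : DevelopsPaths euclideanDevelop 0 :=
  developsPaths_of_circle euclideanAngle euclideanOrigin (fun _ => rfl) (fun _ => rfl)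
    euclideanDevelop_angle_origin euclideanDevelop_zero

theorem euclideanRotation_add (s t : ℝ) :
    euclideanRotation (s + t) = euclideanRotation s * euclideanRotation t := by
  change euclideanMk _ _ = euclideanMk _ _ * euclideanMk _ _
  rw [euclideanMk_mul, Circle.exp_add]
  simp

theorem euclideanRotation_two_pi : euclideanRotation (2 * Real.pi) = 1 := by
  change euclideanMk _ _ = 1
  rw [Circle.exp_two_pi, euclideanMk_one]

theorem euclideanDevelop_apply (p : ℝ × ℂ) :
    euclideanDevelop p = euclideanMk (Circle.exp p.1) p.2 := rfl

theorem euclidean_loops :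
    (∀ g, coveringMap euclideanIsometries g = 1 →
      g ∈ Subgroup.zpowers (fullRotation euclideanRotation euclideanRotation_zero)) ∧
    ∀ k : ℤ, fullRotation euclideanRotation euclideanRotation_zero ^ k = 1 → k = 0 :=
  loops_of_circle euclideanAngle euclideanOrigin (fun _ => rfl) (fun _ => rfl)
    euclideanDevelop_angle_origin euclideanDevelop_zero euclideanRotation_add fun _ => rfl

/-- All products of `m` of the two rotations turn by `m` times their angle, so a relation holds as
soon as both sides have the same length and the same value. -/
theorem exists_hom_euclidean :
    ∃ Φ : DBar 6 →* UniversalCoveringGroup euclideanIsometries,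
      Φ DBar.a = euclideanA 6 ∧ Φ DBar.b = euclideanB 6 ∧
      Φ (DBar.a ^ 6) = fullRotation euclideanRotation euclideanRotation_zero := by
  let τ : basedPaths euclideanIsometries :=
    ⟨⟨fun s => euclideanMk 1 (s : ℝ), continuous_euclideanMk.comp (by fun_prop :
      Continuous fun s : I => ((1 : Circle), (((s : ℝ)) : ℂ)))⟩, by
      change euclideanMk 1 (((0 : I) : ℝ) : ℂ) = 1
      simpa using euclideanMk_one⟩
  let e : I → Circle := fun s => Circle.exp (s * (2 * Real.pi / (6 : ℕ)))
  have he : ∀ s, e s = Circle.exp (s * (2 * Real.pi / (6 : ℕ))) := fun _ => rfl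
  have hec : Continuous e := by fun_prop
  have he1 : ((e 1 : Circle) : ℂ) ^ 2 - e 1 + 1 = 0 := by
    have h : ((1 : I) : ℝ) * (2 * Real.pi / (6 : ℕ)) = Real.pi / 3 := by
      push_cast; ring
    rw [he, h, Circle.coe_exp, Complex.exp_mul_I, ← Complex.ofReal_cos, ← Complex.ofReal_sin,
      Real.cos_pi_div_three, Real.sin_pi_div_three]
    have h3 : ((√3 : ℝ) : ℂ) ^ 2 = 3 := by
      rw [← Complex.ofReal_pow, Real.sq_sqrt (by norm_num)]; norm_num
    push_cast
    linear_combination (1 / 4 * Complex.I ^ 2) * h3 + 3 / 4 * Complex.I_sq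
  have hA : ∀ s, (euclideanA 6 : C(I, euclideanIsometries)) s = euclideanMk (e s) 0 := by
    intro s
    change 1 * euclideanRotation _ * 1⁻¹ = _
    rw [one_mul, inv_one, mul_one]
    rfl
  have hB : ∀ s, (euclideanB 6 : C(I, euclideanIsometries)) s =
      euclideanMk (e s) (1 - e s) := by
    intro s
    change euclideanMk 1 1 * euclideanRotation _ * (euclideanMk 1 1)⁻¹ = _
    rw [mul_inv_eq_iff_eq_mul, euclideanMk_mul]
    change euclideanMk 1 1 * euclideanMk (e s) 0 = _
    rw [euclideanMk_mul]
    simp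
  have he3 : ∀ s : I, Circle.exp (3 * (s * (2 * Real.pi / (6 : ℕ)))) = e s * e s * e s := by
    intro s
    rw [he, ← Circle.exp_add, ← Circle.exp_add]; ring_nf
  refine exists_hom (r := euclideanRotation) (hr := euclideanRotation_zero) euclideanRotation_add
    euclideanRotation_two_pi τ
    (t := euclideanMk 1 1) (by simp [τ]) (by norm_num) rfl rfl ?_ ?_
  · change ((euclideanA 6 * euclideanB 6 * euclideanA 6 : basedPaths euclideanIsometries) :
        UniversalCoveringGroup euclideanIsometries) =
      (euclideanB 6 * euclideanA 6 * euclideanB 6 : basedPaths euclideanIsometries)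
    refine (developsPaths_euclidean.coe_eq_coe_iff
      ⟨fun s => (3 * (s * (2 * Real.pi / (6 : ℕ))), e s * (1 - e s)), by fun_prop⟩
      ⟨fun s => (3 * (s * (2 * Real.pi / (6 : ℕ))), (1 - e s) * (1 + e s * e s)), by fun_prop⟩
      ?_ ?_ ?_ ?_).2 ?_
    · simp [he]
    · simp [he]
    · intro s
      simp only [Subgroup.coe_mul, ContinuousMap.mul_apply, hA, hB, euclideanMk_mul,
        ContinuousMap.coe_mk, euclideanDevelop_apply, he3]
      refine congrArg₂ euclideanMk (by simp only [mul_assoc]) ?_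
      push_cast
      ring
    · intro s
      simp only [Subgroup.coe_mul, ContinuousMap.mul_apply, hA, hB, euclideanMk_mul,
        ContinuousMap.coe_mk, euclideanDevelop_apply, he3]
      refine congrArg₂ euclideanMk (by simp only [mul_assoc]) ?_
      push_cast
      ring
    · simp only [ContinuousMap.coe_mk]
      congr 1
      linear_combination ((e 1 : ℂ) - 1) * he1
  · change (((euclideanA 6 * euclideanB 6 * euclideanA 6) ^ 2 : basedPaths euclideanIsometries) :
        UniversalCoveringGroup euclideanIsometries) =
      (rotationPath euclideanRotation euclideanRotation_zero 1 1 :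
        basedPaths euclideanIsometries)
    refine (developsPaths_euclidean.coe_eq_coe_iff
      ⟨fun s => (6 * (s * (2 * Real.pi / (6 : ℕ))),
        e s * (1 - e s) * (1 + e s * e s * e s)), by fun_prop⟩
      ⟨fun s => (s * (2 * Real.pi), 0), by fun_prop⟩
      ?_ ?_ ?_ ?_).2 ?_
    · simp [he]
    · simp
    · intro s
      have he6 : Circle.exp (6 * (s * (2 * Real.pi / (6 : ℕ)))) =
          e s * e s * e s * (e s * e s * e s) := by
        rw [← he3, ← Circle.exp_add]; ring_nf
      simp only [pow_two, Subgroup.coe_mul, ContinuousMap.mul_apply, hA, hB, euclideanMk_mul,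
        ContinuousMap.coe_mk, euclideanDevelop_apply, he6]
      refine congrArg₂ euclideanMk (by simp only [mul_assoc]) ?_
      push_cast
      ring
    · intro s
      change 1 * euclideanRotation _ * 1⁻¹ = euclideanMk _ _
      rw [one_mul, inv_one, mul_one, Nat.cast_one, div_one]
      rfl
    · simp only [ContinuousMap.coe_mk]
      refine Prod.ext ?_ ?_
      · simp only [Set.Icc.coe_one]
        push_cast
        ring
      · linear_combination ((e 1 : ℂ) * (1 - e 1) * (1 + e 1)) * he1

end Euclidean

/-! ### The hyperbolic plane -/

section Hyperbolic

/-- The Möbius transformation given by a matrix. -/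
def toPSL : Matrix.SpecialLinearGroup (Fin 2) ℝ →* PSL2R :=
  QuotientGroup.mk' (Subgroup.center (Matrix.SpecialLinearGroup (Fin 2) ℝ))

theorem continuous_toPSL : Continuous toPSL := QuotientGroup.continuous_mk

theorem eq_or_eq_neg_of_inv_mul_mem_center {g h : Matrix.SpecialLinearGroup (Fin 2) ℝ}
    (e : g⁻¹ * h ∈ Subgroup.center (Matrix.SpecialLinearGroup (Fin 2) ℝ)) : h = g ∨ h = -g := by
  obtain ⟨r, hr, hs⟩ := Matrix.SpecialLinearGroup.mem_center_iff.1 e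
  have hs' : (h : Matrix (Fin 2) (Fin 2) ℝ) =
      (g : Matrix (Fin 2) (Fin 2) ℝ) * Matrix.scalar (Fin 2) r := by
    rw [hs, ← Matrix.SpecialLinearGroup.coe_mul, mul_inv_cancel_left]
  rw [Fintype.card_fin, sq_eq_one_iff] at hr
  refine hr.imp ?_ ?_ <;> rintro rfl <;> apply Subtype.ext <;> rw [hs'] <;>
    simp [← Matrix.smul_one_eq_diagonal]

theorem toPSL_neg (g : Matrix.SpecialLinearGroup (Fin 2) ℝ) : toPSL (-g) = toPSL g := by
  refine (QuotientGroup.eq.2 (Matrix.SpecialLinearGroup.mem_center_iff.2 ⟨-1, by simp, ?_⟩)).symm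
  simp [← Matrix.smul_one_eq_diagonal]

/-- The first column of a matrix, as a complex number. -/
def firstColumn (g : Matrix.SpecialLinearGroup (Fin 2) ℝ) : ℂ := ⟨g 0 0, g 1 0⟩

theorem continuous_firstColumn : Continuous firstColumn := by
  have : Continuous fun g : Matrix.SpecialLinearGroup (Fin 2) ℝ =>
      Complex.equivRealProdCLM.symm (g 0 0, g 1 0) :=
    Complex.equivRealProdCLM.symm.continuous.comp (by fun_prop)
  exact this

theorem firstColumn_ne_zero (g : Matrix.SpecialLinearGroup (Fin 2) ℝ) : firstColumn g ≠ 0 := by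
  intro h
  have h0 : g 0 0 = 0 := congrArg Complex.re h
  have h1 : g 1 0 = 0 := congrArg Complex.im h
  have := g.det_coe
  rw [Matrix.det_fin_two, h0, h1] at this
  simp at this

theorem firstColumn_neg (g : Matrix.SpecialLinearGroup (Fin 2) ℝ) :
    firstColumn (-g) = -firstColumn g := by
  apply Complex.ext <;> simp [firstColumn]

/-- The angle coordinate of the Iwasawa decomposition. It is twice the angle of the rotation matrix,
as for `hyperbolicRotation`, and therefore well defined on Möbius transformations. -/
noncomputable def hyperbolicAngle : C(PSL2R, Circle) where
  toFun := Quotient.lift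
    (fun g => Circle.ofConjDivSelf (firstColumn g) (firstColumn_ne_zero g)) (by
      intro g h e
      apply Circle.ext
      rcases eq_or_eq_neg_of_inv_mul_mem_center (QuotientGroup.leftRel_apply.1 e) with rfl | rfl
      · rfl
      · simp [Circle.ofConjDivSelf, firstColumn_neg])
  continuous_toFun := by
    refine Continuous.quotient_lift (Continuous.subtype_mk ?_ _) _
    exact (Complex.continuous_conj.comp continuous_firstColumn).div₀ continuous_firstColumn
      firstColumn_ne_zero

/-- The coordinates of the upper triangular factor of the Iwasawa decomposition: the logarithm of
the first entry, and the entry above the diagonal. -/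
noncomputable def hyperbolicTriangular : C(PSL2R, ℝ × ℝ) where
  toFun := Quotient.lift
    (fun g => (Real.log ‖firstColumn g‖, (g 0 0 * g 0 1 + g 1 0 * g 1 1) / ‖firstColumn g‖)) (by
      intro g h e
      rcases eq_or_eq_neg_of_inv_mul_mem_center (QuotientGroup.leftRel_apply.1 e) with rfl | rfl
      · rfl
      · simp [firstColumn_neg])
  continuous_toFun := by
    refine Continuous.quotient_lift ?_ _
    have h := continuous_firstColumn.norm
    have h0 := fun g => norm_ne_zero_iff.2 (firstColumn_ne_zero g)
    exact (h.log h0).prodMk (Continuous.div₀ (by fun_prop) h h0)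

/-- The matrix with the given Iwasawa coordinates. -/
noncomputable def iwasawa (p : ℝ × (ℝ × ℝ)) : Matrix.SpecialLinearGroup (Fin 2) ℝ :=
  ⟨!![Real.cos (p.1 / 2) * Real.exp p.2.1,
      Real.cos (p.1 / 2) * p.2.2 + Real.sin (p.1 / 2) * Real.exp (-p.2.1);
      -Real.sin (p.1 / 2) * Real.exp p.2.1,
      -Real.sin (p.1 / 2) * p.2.2 + Real.cos (p.1 / 2) * Real.exp (-p.2.1)], by
    have h := Real.sin_sq_add_cos_sq (p.1 / 2)
    have h2 : Real.exp p.2.1 * Real.exp (-p.2.1) = 1 := by rw [← Real.exp_add]; simp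
    rw [Matrix.det_fin_two_of]
    linear_combination Real.exp p.2.1 * Real.exp (-p.2.1) * h + h2⟩

/-- The Möbius transformation with the given Iwasawa coordinates. -/
noncomputable def hyperbolicDevelop : C(ℝ × (ℝ × ℝ), PSL2R) where
  toFun p := toPSL (iwasawa p)
  continuous_toFun := by
    refine continuous_toPSL.comp (Continuous.subtype_mk ?_ _)
    refine continuous_matrix fun i j => ?_
    fin_cases i <;> fin_cases j <;> simp <;> fun_prop

theorem firstColumn_iwasawa (p : ℝ × (ℝ × ℝ)) :
    firstColumn (iwasawa p) = Real.exp p.2.1 * Complex.exp (-(p.1 / 2 : ℝ) * Complex.I) := by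
  rw [← Complex.ofReal_neg, Complex.exp_mul_I, ← Complex.ofReal_cos, ← Complex.ofReal_sin,
    Real.cos_neg, Real.sin_neg]
  apply Complex.ext
  · simp only [firstColumn, iwasawa, Complex.re_ofReal_mul, Complex.add_re, Complex.ofReal_re,
      Complex.re_ofReal_mul, Complex.I_re]
    simp [mul_comm]
  · simp only [firstColumn, iwasawa, Complex.im_ofReal_mul, Complex.add_im, Complex.ofReal_im,
      Complex.im_ofReal_mul, Complex.I_im]
    simp [mul_comm]

theorem norm_firstColumn_iwasawa (p : ℝ × (ℝ × ℝ)) :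
    ‖firstColumn (iwasawa p)‖ = Real.exp p.2.1 := by
  rw [firstColumn_iwasawa, norm_mul, ← Complex.ofReal_neg, Complex.norm_exp_ofReal_mul_I,
    mul_one, Complex.norm_real, Real.norm_eq_abs, Real.abs_exp]

theorem hyperbolicAngle_develop (p : ℝ × (ℝ × ℝ)) :
    hyperbolicAngle (hyperbolicDevelop p) = Circle.exp p.1 := by
  apply Circle.ext
  change (starRingEnd ℂ) (firstColumn (iwasawa p)) / firstColumn (iwasawa p) = _
  rw [firstColumn_iwasawa, map_mul, Complex.conj_ofReal, mul_div_mul_left _ _ (by simp),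
    ← Complex.exp_conj, ← Complex.exp_sub, Circle.coe_exp]
  congr 1
  rw [map_mul, map_neg, Complex.conj_ofReal, Complex.conj_I]
  push_cast
  ring

theorem hyperbolicTriangular_develop (p : ℝ × (ℝ × ℝ)) :
    hyperbolicTriangular (hyperbolicDevelop p) = p.2 := by
  have h := Real.sin_sq_add_cos_sq (p.1 / 2)
  change (Real.log ‖firstColumn (iwasawa p)‖, _ / ‖firstColumn (iwasawa p)‖) = _
  rw [norm_firstColumn_iwasawa, Real.log_exp]
  refine Prod.ext rfl ?_
  change _ / _ = p.2.2
  rw [div_eq_iff (Real.exp_ne_zero _)]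
  simp only [iwasawa, Matrix.SpecialLinearGroup.coe_mk, Matrix.of_apply, Matrix.cons_val',
    Matrix.cons_val_zero, Matrix.cons_val_one, Matrix.cons_val_fin_one]
  linear_combination Real.exp p.2.1 * p.2.2 * h

theorem iwasawa_of_firstColumn (g : Matrix.SpecialLinearGroup (Fin 2) ℝ) (θ : ℝ)
    (h : firstColumn g = ‖firstColumn g‖ * Complex.exp (-(θ / 2 : ℝ) * Complex.I)) :
    iwasawa (θ, hyperbolicTriangular (toPSL g)) = g := by
  have hN : 0 < ‖firstColumn g‖ := norm_pos_iff.2 (firstColumn_ne_zero g)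
  change iwasawa (θ, Real.log ‖firstColumn g‖,
    (g 0 0 * g 0 1 + g 1 0 * g 1 1) / ‖firstColumn g‖) = g
  set N := ‖firstColumn g‖
  rw [← Complex.ofReal_neg, Complex.exp_mul_I, ← Complex.ofReal_cos, ← Complex.ofReal_sin,
    Real.cos_neg, Real.sin_neg] at h
  have h0 : g 0 0 = N * Real.cos (θ / 2) := by
    have := congrArg Complex.re h
    rw [Complex.re_ofReal_mul, Complex.add_re, Complex.ofReal_re, Complex.re_ofReal_mul,
      Complex.I_re, mul_zero, add_zero] at this
    exact this
  have h1 : g 1 0 = -(N * Real.sin (θ / 2)) := by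
    have := congrArg Complex.im h
    rw [Complex.im_ofReal_mul, Complex.add_im, Complex.ofReal_im, Complex.im_ofReal_mul,
      Complex.I_im, mul_one, zero_add, mul_neg] at this
    exact this
  have hd := g.det_coe
  rw [Matrix.det_fin_two, h0, h1] at hd
  have hc := Real.sin_sq_add_cos_sq (θ / 2)
  have hNi : N⁻¹ = Real.cos (θ / 2) * g 1 1 + Real.sin (θ / 2) * g 0 1 := by
    refine inv_eq_of_mul_eq_one_right ?_
    linear_combination hd
  have hx : (g 0 0 * g 0 1 + g 1 0 * g 1 1) / N =
      Real.cos (θ / 2) * g 0 1 - Real.sin (θ / 2) * g 1 1 := by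
    rw [div_eq_iff hN.ne', h0, h1]; ring
  rw [hx]
  ext i j
  fin_cases i <;> fin_cases j
  · simp [iwasawa, Real.exp_log hN, h0, mul_comm]
  · simp [iwasawa, Real.exp_neg, Real.exp_log hN, hNi]
    linear_combination g 0 1 * hc
  · simp [iwasawa, Real.exp_log hN, h1, mul_comm]
  · simp [iwasawa, Real.exp_neg, Real.exp_log hN, hNi]
    linear_combination g 1 1 * hc

theorem hyperbolicDevelop_angle_triangular (g : PSL2R) (θ : ℝ)
    (h : Circle.exp θ = hyperbolicAngle g) : hyperbolicDevelop (θ, hyperbolicTriangular g) = g := by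
  obtain ⟨g, rfl⟩ := QuotientGroup.mk_surjective g
  have hz0 : firstColumn g ≠ 0 := firstColumn_ne_zero g
  have h1 : Complex.exp (θ * Complex.I) =
      (starRingEnd ℂ) (firstColumn g) / firstColumn g := congrArg Subtype.val h
  have h2 : (Complex.exp ((θ / 2 : ℝ) * Complex.I) * firstColumn g) ^ 2 =
      (‖firstColumn g‖ : ℂ) ^ 2 := by
    rw [eq_div_iff hz0] at h1
    rw [mul_pow, ← Complex.exp_nat_mul, ← Complex.conj_mul', ← h1, pow_two, ← mul_assoc]
    congr 3
    push_cast
    ring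
  have h3 : Complex.exp (-(θ / 2 : ℝ) * Complex.I) * Complex.exp ((θ / 2 : ℝ) * Complex.I) = 1 := by
    rw [← Complex.exp_add]; simp
  rcases sq_eq_sq_iff_eq_or_eq_neg.1 h2 with h4 | h4
  · refine congrArg toPSL (iwasawa_of_firstColumn g θ ?_)
    rw [← h4]
    linear_combination -(firstColumn g) * h3
  · change toPSL (iwasawa (θ, hyperbolicTriangular (toPSL g))) = toPSL g
    rw [← toPSL_neg g]
    refine congrArg toPSL (iwasawa_of_firstColumn (-g) θ ?_)
    rw [firstColumn_neg, norm_neg, ← neg_eq_iff_eq_neg.2 h4]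
    linear_combination (firstColumn g) * h3

theorem hyperbolicDevelop_zero : hyperbolicDevelop 0 = 1 := by
  change toPSL (iwasawa 0) = 1
  rw [← map_one toPSL]
  congr 1
  ext i j
  fin_cases i <;> fin_cases j <;> simp [iwasawa]

theorem developsPaths_hyperbolic : DevelopsPaths hyperbolicDevelop 0 :=
  developsPaths_of_circle hyperbolicAngle hyperbolicTriangular hyperbolicAngle_develop
    hyperbolicTriangular_develop hyperbolicDevelop_angle_triangular hyperbolicDevelop_zero

/-- The rotation by `2 ψ` about the point `exp c * i` of the upper half plane, as a matrix. -/
noncomputable def ellipticMatrix (c ψ : ℝ) : Matrix.SpecialLinearGroup (Fin 2) ℝ :=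
  ⟨!![Real.cos ψ, Real.exp c * Real.sin ψ; -(Real.exp (-c) * Real.sin ψ), Real.cos ψ], by
    have h := Real.sin_sq_add_cos_sq ψ
    have h2 : Real.exp c * Real.exp (-c) = 1 := by rw [← Real.exp_add]; simp
    rw [Matrix.det_fin_two_of]
    linear_combination Real.sin ψ ^ 2 * h2 + h⟩

theorem coe_ellipticMatrix (c ψ : ℝ) :
    (ellipticMatrix c ψ : Matrix (Fin 2) (Fin 2) ℝ) =
      !![Real.cos ψ, Real.exp c * Real.sin ψ; -(Real.exp (-c) * Real.sin ψ), Real.cos ψ] := rfl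

theorem continuous_ellipticMatrix (c : ℝ) : Continuous (ellipticMatrix c) := by
  refine Continuous.subtype_mk (continuous_matrix fun i j => ?_) _
  fin_cases i <;> fin_cases j <;> simp <;> fun_prop

theorem hyperbolicRotation_eq (θ : ℝ) :
    hyperbolicRotation θ = toPSL (ellipticMatrix 0 (θ / 2)) := by
  refine congrArg toPSL (Subtype.ext ?_)
  rw [coe_ellipticMatrix]
  simp

theorem hyperbolicRotation_add (s t : ℝ) :
    hyperbolicRotation (s + t) = hyperbolicRotation s * hyperbolicRotation t := by
  rw [hyperbolicRotation_eq, hyperbolicRotation_eq, hyperbolicRotation_eq, ← map_mul]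
  refine congrArg toPSL (Subtype.ext ?_)
  rw [Matrix.SpecialLinearGroup.coe_mul, coe_ellipticMatrix, coe_ellipticMatrix,
    coe_ellipticMatrix]
  ext i j
  fin_cases i <;> fin_cases j <;> simp [add_div, Real.cos_add, Real.sin_add] <;> ring

theorem hyperbolicRotation_two_pi : hyperbolicRotation (2 * Real.pi) = 1 := by
  rw [hyperbolicRotation_eq, ← map_one toPSL, ← toPSL_neg]
  refine congrArg toPSL (Subtype.ext ?_)
  rw [Matrix.SpecialLinearGroup.coe_neg, coe_ellipticMatrix]
  ext i j
  fin_cases i <;> fin_cases j <;> simp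

theorem hyperbolicShift_conj (c θ : ℝ) :
    hyperbolicShift c * hyperbolicRotation θ * (hyperbolicShift c)⁻¹ =
      toPSL (ellipticMatrix c (θ / 2)) := by
  rw [mul_inv_eq_iff_eq_mul]
  refine Eq.trans (map_mul toPSL _ _).symm (Eq.trans (congrArg toPSL ?_) (map_mul toPSL _ _))
  apply Subtype.ext
  have h1 : Real.exp c = Real.exp (c / 2) * Real.exp (c / 2) := by rw [← Real.exp_add]; ring_nf
  have h2 : Real.exp (-c) = Real.exp (-(c / 2)) * Real.exp (-(c / 2)) := by
    rw [← Real.exp_add]; ring_nf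
  have h3 : Real.exp (c / 2) * Real.exp (-(c / 2)) = 1 := by rw [← Real.exp_add]; simp
  change !![Real.exp (c / 2), 0; 0, Real.exp (-(c / 2))] *
      !![Real.cos (θ / 2), Real.sin (θ / 2); -Real.sin (θ / 2), Real.cos (θ / 2)] =
    !![Real.cos (θ / 2), Real.exp c * Real.sin (θ / 2);
      -(Real.exp (-c) * Real.sin (θ / 2)), Real.cos (θ / 2)] *
      !![Real.exp (c / 2), 0; 0, Real.exp (-(c / 2))]
  rw [h1, h2]
  ext i j
  fin_cases i <;> fin_cases j
  · simp; ring
  · simp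
    linear_combination -Real.exp (c / 2) * Real.sin (θ / 2) * h3
  · simp
    linear_combination -Real.exp (-(c / 2)) * Real.sin (θ / 2) * h3
  · simp; ring

theorem hyperbolic_loops :
    (∀ g, coveringMap PSL2R g = 1 →
      g ∈ Subgroup.zpowers (fullRotation hyperbolicRotation hyperbolicRotation_zero)) ∧
    ∀ k : ℤ, fullRotation hyperbolicRotation hyperbolicRotation_zero ^ k = 1 → k = 0 := by
  refine loops_of_circle hyperbolicAngle hyperbolicTriangular hyperbolicAngle_develop
    hyperbolicTriangular_develop hyperbolicDevelop_angle_triangular hyperbolicDevelop_zero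
    hyperbolicRotation_add fun θ => ?_
  rw [hyperbolicRotation_eq]
  refine congrArg toPSL (Subtype.ext ?_)
  rw [coe_ellipticMatrix]
  ext i j
  fin_cases i <;> fin_cases j <;> simp [iwasawa]

/-- Two paths of matrices with the same end point give homotopic paths of Möbius transformations,
if the first column of the matrix does not make a turn. -/
theorem coe_eq_coe_of_slitPlane {γ δ : basedPaths PSL2R}
    (g h : C(I, Matrix.SpecialLinearGroup (Fin 2) ℝ)) (hg0 : g 0 = 1) (hh0 : h 0 = 1)
    (hg : ∀ s, firstColumn (g s) ∈ Complex.slitPlane)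
    (hh : ∀ s, firstColumn (h s) ∈ Complex.slitPlane)
    (hγ : ∀ s, (γ : C(I, PSL2R)) s = toPSL (g s)) (hδ : ∀ s, (δ : C(I, PSL2R)) s = toPSL (h s))
    (h1 : g 1 = h 1) : (γ : UniversalCoveringGroup PSL2R) = δ := by
  have hcont : ∀ k : C(I, Matrix.SpecialLinearGroup (Fin 2) ℝ),
      (∀ s, firstColumn (k s) ∈ Complex.slitPlane) → Continuous fun s =>
        (-(2 * (firstColumn (k s)).arg), hyperbolicTriangular (toPSL (k s))) := by
    intro k hk
    refine Continuous.prodMk (Continuous.neg (continuous_const.mul ?_))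
      (hyperbolicTriangular.continuous.comp (continuous_toPSL.comp k.continuous))
    exact continuous_iff_continuousAt.2 fun s =>
      ContinuousAt.comp (f := fun s => firstColumn (k s)) (Complex.continuousAt_arg (hk s))
        (continuous_firstColumn.comp k.continuous).continuousAt
  have hone : ((-(2 * (firstColumn 1).arg), hyperbolicTriangular (toPSL 1)) :
      ℝ × (ℝ × ℝ)) = 0 := by
    have h2 : firstColumn 1 = 1 := by apply Complex.ext <;> simp [firstColumn]
    rw [map_one, ← hyperbolicDevelop_zero, hyperbolicTriangular_develop, h2]
    simp [Prod.ext_iff]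
  have hdev : ∀ k : Matrix.SpecialLinearGroup (Fin 2) ℝ,
      hyperbolicDevelop (-(2 * (firstColumn k).arg), hyperbolicTriangular (toPSL k)) =
        toPSL k := by
    intro k
    refine congrArg toPSL (iwasawa_of_firstColumn k _ ?_)
    conv_lhs => rw [← Complex.norm_mul_exp_arg_mul_I (firstColumn k)]
    congr 3
    push_cast
    ring
  refine (developsPaths_hyperbolic.coe_eq_coe_iff ⟨_, hcont g hg⟩ ⟨_, hcont h hh⟩ ?_ ?_ ?_ ?_).2 ?_
  · simpa [hg0] using hone
  · simpa [hh0] using hone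
  · intro s
    rw [hγ]
    exact (hdev _).symm
  · intro s
    rw [hδ]
    exact (hdev _).symm
  · simp [h1]

/-- The half twist of two rotations. The diagonal vanishes if the law of cosines holds for the angle
`2 ψ` of the triangle and the side `c`. -/
theorem coe_elliptic_braid (c ψ : ℝ) :
    ((ellipticMatrix 0 ψ * ellipticMatrix c ψ * ellipticMatrix 0 ψ :
      Matrix.SpecialLinearGroup (Fin 2) ℝ) : Matrix (Fin 2) (Fin 2) ℝ) =
    !![Real.cos ψ * (Real.cos ψ ^ 2 - Real.sin ψ ^ 2 * (1 + Real.exp c + Real.exp (-c))),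
      Real.sin ψ * ((Real.exp c + 2) * Real.cos ψ ^ 2 - Real.exp (-c) * Real.sin ψ ^ 2);
      -(Real.sin ψ * ((Real.exp (-c) + 2) * Real.cos ψ ^ 2 - Real.exp c * Real.sin ψ ^ 2)),
      Real.cos ψ * (Real.cos ψ ^ 2 - Real.sin ψ ^ 2 * (1 + Real.exp c + Real.exp (-c)))] := by
  rw [Matrix.SpecialLinearGroup.coe_mul, Matrix.SpecialLinearGroup.coe_mul, coe_ellipticMatrix,
    coe_ellipticMatrix]
  ext i j
  fin_cases i <;> fin_cases j <;> simp <;> ring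

/-- The half twist of two rotations in the other order; it has the same diagonal. -/
theorem coe_elliptic_braid' (c ψ : ℝ) :
    ((ellipticMatrix c ψ * ellipticMatrix 0 ψ * ellipticMatrix c ψ :
      Matrix.SpecialLinearGroup (Fin 2) ℝ) : Matrix (Fin 2) (Fin 2) ℝ) =
    !![Real.cos ψ * (Real.cos ψ ^ 2 - Real.sin ψ ^ 2 * (1 + Real.exp c + Real.exp (-c))),
      Real.sin ψ * ((2 * Real.exp c + 1) * Real.cos ψ ^ 2 - (Real.exp c * Real.sin ψ) ^ 2);
      -(Real.sin ψ * ((2 * Real.exp (-c) + 1) * Real.cos ψ ^ 2 -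
        (Real.exp (-c) * Real.sin ψ) ^ 2)),
      Real.cos ψ * (Real.cos ψ ^ 2 - Real.sin ψ ^ 2 * (1 + Real.exp c + Real.exp (-c)))] := by
  have h : Real.exp c * Real.exp (-c) = 1 := by rw [← Real.exp_add]; simp
  rw [Matrix.SpecialLinearGroup.coe_mul, Matrix.SpecialLinearGroup.coe_mul, coe_ellipticMatrix,
    coe_ellipticMatrix]
  ext i j
  fin_cases i <;> fin_cases j
  · simp
    linear_combination -(Real.cos ψ * Real.sin ψ ^ 2) * h
  · simp; ring
  · simp; ring
  · simp
    linear_combination -(Real.cos ψ * Real.sin ψ ^ 2) * h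

/-- The law of cosines for the angles of the equilateral triangle, with `2 cosh c` written in
exponentials of the side `c`. -/
theorem cos_sq_eq_of_sideCos {n : ℕ} (hn : 7 ≤ n) :
    Real.cos (Real.pi / n) ^ 2 = Real.sin (Real.pi / n) ^ 2 *
      (1 + Real.exp (Real.arcosh (sideCos n)) + Real.exp (-Real.arcosh (sideCos n))) := by
  have hn' : (7 : ℝ) ≤ n := by exact_mod_cast hn
  have hpi := Real.pi_pos
  have h2 : 2 * Real.pi / n = 2 * (Real.pi / n) := by ring
  have h3 : Real.pi / n ≤ Real.pi / 6 := by gcongr; linarith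
  have h0 : 0 < Real.pi / n := by positivity
  have h4 : 1 / 2 ≤ Real.cos (2 * (Real.pi / n)) := by
    rw [← Real.cos_pi_div_three]
    apply Real.cos_le_cos_of_nonneg_of_le_pi <;> linarith
  have hs : 0 < Real.sin (Real.pi / n) := Real.sin_pos_of_pos_of_lt_pi h0 (by linarith)
  have h5 : 1 - Real.cos (2 * (Real.pi / n)) = 2 * Real.sin (Real.pi / n) ^ 2 := by
    rw [Real.cos_two_mul, Real.cos_sq']; ring
  have h6 : 1 ≤ sideCos n := by
    rw [sideCos, h2, h5, le_div_iff₀ (by positivity)]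
    linarith
  have h7 := Real.cosh_arcosh h6
  have h8 : 2 * Real.sin (Real.pi / n) ^ 2 * sideCos n = Real.cos (2 * (Real.pi / n)) := by
    rw [sideCos, h2, h5]; field_simp
  rw [Real.cosh_eq] at h7
  have h9 := Real.cos_two_mul' (Real.pi / n)
  linear_combination -2 * Real.sin (Real.pi / n) ^ 2 * h7 - h8 - h9

end Hyperbolic

section Hyperbolic

/-- The paths of matrices over the half twists `α β α` and `β α β`, and over the rotation by `π`
about the midpoint of the side, keep the first column in the fourth quadrant, so that their classes
are determined by their end points. These agree: hence the braid relation, and `α β α` is a half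
rotation, whose square is the full rotation. -/
theorem exists_hom_hyperbolic {n : ℕ} (hn : 7 ≤ n) :
    ∃ Φ : DBar n →* UniversalCoveringGroup PSL2R,
      Φ DBar.a = hyperbolicA n ∧ Φ DBar.b = hyperbolicB n ∧
      Φ (DBar.a ^ n) = fullRotation hyperbolicRotation hyperbolicRotation_zero := by
  set c := Real.arcosh (sideCos n) with hc
  have hn' : (7 : ℝ) ≤ n := by exact_mod_cast hn
  have hpi := Real.pi_pos
  have hφ0 : 0 < Real.pi / n := by positivity
  have hφ1 : Real.pi / n < Real.pi / 2 := by gcongr; linarith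
  have key := cos_sq_eq_of_sideCos hn
  rw [← hc] at key
  have hS := Real.sin_pos_of_pos_of_lt_pi hφ0 (by linarith)
  have hC := Real.cos_pos_of_mem_Ioo ⟨by linarith, hφ1⟩
  have hSC := Real.sin_sq_add_cos_sq (Real.pi / n)
  have hP := Real.exp_pos c
  have hQ := Real.exp_pos (-c)
  have hPQ : Real.exp c * Real.exp (-c) = 1 := by rw [← Real.exp_add]; simp
  -- the rotation through the angle `ψ s`, half of the angle of the Möbius transformation
  let ψ : I → ℝ := fun s => s * (2 * Real.pi / n) / 2
  have hψ : ∀ s, ψ s = s * (Real.pi / n) := fun s => by simp only [ψ]; ring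
  have hψc : Continuous ψ := by fun_prop
  have hψ0 : ψ 0 = 0 := by simp [ψ]
  have hψ1 : ψ 1 = Real.pi / n := by rw [hψ]; simp
  have hψnonneg : ∀ s, 0 ≤ ψ s := fun s => by rw [hψ]; exact mul_nonneg s.2.1 hφ0.le
  have hψle : ∀ s, ψ s ≤ Real.pi / n := fun s => by
    rw [hψ]; exact mul_le_of_le_one_left hφ0.le s.2.2
  have hcos : ∀ s, 0 < Real.cos (ψ s) := fun s =>
    Real.cos_pos_of_mem_Ioo ⟨by linarith [hψnonneg s], by linarith [hψle s]⟩
  have hsin : ∀ s, 0 ≤ Real.sin (ψ s) := fun s =>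
    Real.sin_nonneg_of_nonneg_of_le_pi (hψnonneg s) (by linarith [hψle s])
  have hle : ∀ s, Real.sin (ψ s) ^ 2 * (1 + Real.exp c + Real.exp (-c)) ≤ Real.cos (ψ s) ^ 2 := by
    intro s
    have h1 : Real.sin (ψ s) ≤ Real.sin (Real.pi / n) := by
      apply Real.sin_le_sin_of_le_of_le_pi_div_two <;> linarith [hψnonneg s, hψle s]
    have h2 : Real.cos (Real.pi / n) ≤ Real.cos (ψ s) := by
      apply Real.cos_le_cos_of_nonneg_of_le_pi <;> linarith [hψnonneg s, hψle s]
    calc _ ≤ Real.sin (Real.pi / n) ^ 2 * (1 + Real.exp c + Real.exp (-c)) := by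
          gcongr
          exact hsin s
      _ = Real.cos (Real.pi / n) ^ 2 := key.symm
      _ ≤ _ := by gcongr
  have hone : ∀ d, ellipticMatrix d 0 = 1 := by
    intro d
    apply Subtype.ext
    rw [coe_ellipticMatrix]
    ext i j
    fin_cases i <;> fin_cases j <;> simp
  -- half twists do not turn the first column: they stay in the fourth quadrant
  have hslit : ∀ g : Matrix.SpecialLinearGroup (Fin 2) ℝ, 0 ≤ g 0 0 → g 1 0 ≤ 0 →
      firstColumn g ∈ Complex.slitPlane := by
    intro g h1 h2
    rw [Complex.mem_slitPlane_iff]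
    by_contra! h
    refine firstColumn_ne_zero g (Complex.ext (le_antisymm h.1 h1) h.2)
  have hA : ∀ s, (hyperbolicA n : C(I, PSL2R)) s = toPSL (ellipticMatrix 0 (ψ s)) := by
    intro s
    change 1 * hyperbolicRotation _ * 1⁻¹ = _
    rw [one_mul, inv_one, mul_one, hyperbolicRotation_eq]
  have hB : ∀ s, (hyperbolicB n : C(I, PSL2R)) s = toPSL (ellipticMatrix c (ψ s)) :=
    fun s => hyperbolicShift_conj _ _
  let g : C(I, Matrix.SpecialLinearGroup (Fin 2) ℝ) :=
    ⟨fun s => ellipticMatrix 0 (ψ s) * ellipticMatrix c (ψ s) * ellipticMatrix 0 (ψ s),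
      (((continuous_ellipticMatrix 0).comp hψc).mul ((continuous_ellipticMatrix c).comp hψc)).mul
        ((continuous_ellipticMatrix 0).comp hψc)⟩
  let h : C(I, Matrix.SpecialLinearGroup (Fin 2) ℝ) :=
    ⟨fun s => ellipticMatrix c (ψ s) * ellipticMatrix 0 (ψ s) * ellipticMatrix c (ψ s),
      (((continuous_ellipticMatrix c).comp hψc).mul ((continuous_ellipticMatrix 0).comp hψc)).mul
        ((continuous_ellipticMatrix c).comp hψc)⟩
  let m : C(I, Matrix.SpecialLinearGroup (Fin 2) ℝ) :=
    ⟨fun s => ellipticMatrix (c / 2) (s * (2 * Real.pi / (2 : ℕ)) / 2),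
      (continuous_ellipticMatrix (c / 2)).comp (by fun_prop)⟩
  have hg0 : g 0 = 1 := by simp [g, hψ0, hone]
  have hh0 : h 0 = 1 := by simp [h, hψ0, hone]
  have hm0 : m 0 = 1 := by simp [m, hone]
  have hgslit : ∀ s, firstColumn (g s) ∈ Complex.slitPlane := by
    intro s
    have e := coe_elliptic_braid c (ψ s)
    apply hslit
    · change ((ellipticMatrix 0 (ψ s) * ellipticMatrix c (ψ s) * ellipticMatrix 0 (ψ s) :
        Matrix.SpecialLinearGroup (Fin 2) ℝ) : Matrix (Fin 2) (Fin 2) ℝ) 0 0 ≥ 0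
      rw [e]
      exact mul_nonneg (hcos s).le (by linarith [hle s])
    · change ((ellipticMatrix 0 (ψ s) * ellipticMatrix c (ψ s) * ellipticMatrix 0 (ψ s) :
        Matrix.SpecialLinearGroup (Fin 2) ℝ) : Matrix (Fin 2) (Fin 2) ℝ) 1 0 ≤ 0
      rw [e]
      refine neg_nonpos.2 (mul_nonneg (hsin s) ?_)
      have h1 := hle s
      have h2 := mul_nonneg hQ.le (sq_nonneg (Real.cos (ψ s)))
      have h3 := mul_nonneg hQ.le (sq_nonneg (Real.sin (ψ s)))
      have h4 := mul_nonneg hP.le (sq_nonneg (Real.sin (ψ s)))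
      nlinarith [sq_nonneg (Real.sin (ψ s)), sq_nonneg (Real.cos (ψ s))]
  have hhslit : ∀ s, firstColumn (h s) ∈ Complex.slitPlane := by
    intro s
    have e := coe_elliptic_braid' c (ψ s)
    apply hslit
    · change ((ellipticMatrix c (ψ s) * ellipticMatrix 0 (ψ s) * ellipticMatrix c (ψ s) :
        Matrix.SpecialLinearGroup (Fin 2) ℝ) : Matrix (Fin 2) (Fin 2) ℝ) 0 0 ≥ 0
      rw [e]
      exact mul_nonneg (hcos s).le (by linarith [hle s])
    · change ((ellipticMatrix c (ψ s) * ellipticMatrix 0 (ψ s) * ellipticMatrix c (ψ s) :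
        Matrix.SpecialLinearGroup (Fin 2) ℝ) : Matrix (Fin 2) (Fin 2) ℝ) 1 0 ≤ 0
      rw [e]
      refine neg_nonpos.2 (mul_nonneg (hsin s) ?_)
      have h1 := mul_le_mul_of_nonneg_left (hle s) hQ.le
      have h2 := mul_nonneg hQ.le (sq_nonneg (Real.sin (ψ s)))
      have h3 := sq_nonneg (Real.sin (ψ s))
      have h4 : Real.exp (-c) * (Real.sin (ψ s) ^ 2 * (1 + Real.exp c + Real.exp (-c))) =
          Real.exp (-c) * Real.sin (ψ s) ^ 2 + Real.sin (ψ s) ^ 2 +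
            (Real.exp (-c) * Real.sin (ψ s)) ^ 2 := by
        linear_combination Real.sin (ψ s) ^ 2 * hPQ
      nlinarith [sq_nonneg (Real.cos (ψ s)), sq_nonneg (Real.exp (-c) * Real.sin (ψ s))]
  have hmslit : ∀ s, firstColumn (m s) ∈ Complex.slitPlane := by
    intro s
    have h0 : (s : ℝ) * (2 * Real.pi / (2 : ℕ)) / 2 = s * Real.pi / 2 := by push_cast; ring
    have h1 : (0 : ℝ) ≤ s * Real.pi := mul_nonneg s.2.1 hpi.le
    have h2 : s * Real.pi ≤ Real.pi := mul_le_of_le_one_left hpi.le s.2.2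
    apply hslit
    · exact Real.cos_nonneg_of_mem_Icc ⟨by linarith, by linarith⟩
    · refine neg_nonpos.2 (mul_nonneg (Real.exp_pos _).le ?_)
      exact Real.sin_nonneg_of_nonneg_of_le_pi (by linarith) (by linarith)
  have hzero : Real.cos (Real.pi / n) *
      (Real.cos (Real.pi / n) ^ 2 - Real.sin (Real.pi / n) ^ 2 *
        (1 + Real.exp c + Real.exp (-c))) = 0 := by rw [key]; ring
  have hgh : g 1 = h 1 := by
    apply Subtype.ext
    refine (coe_elliptic_braid c (ψ 1)).trans (Eq.trans ?_ (coe_elliptic_braid' c (ψ 1)).symm)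
    rw [hψ1, hzero]
    have e1 : (Real.exp c + 2) * Real.cos (Real.pi / n) ^ 2 -
        Real.exp (-c) * Real.sin (Real.pi / n) ^ 2 =
        (2 * Real.exp c + 1) * Real.cos (Real.pi / n) ^ 2 -
          (Real.exp c * Real.sin (Real.pi / n)) ^ 2 := by
      linear_combination (1 - Real.exp c) * key - Real.sin (Real.pi / n) ^ 2 * hPQ
    have e2 : (Real.exp (-c) + 2) * Real.cos (Real.pi / n) ^ 2 -
        Real.exp c * Real.sin (Real.pi / n) ^ 2 =
        (2 * Real.exp (-c) + 1) * Real.cos (Real.pi / n) ^ 2 -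
          (Real.exp (-c) * Real.sin (Real.pi / n)) ^ 2 := by
      linear_combination (1 - Real.exp (-c)) * key - Real.sin (Real.pi / n) ^ 2 * hPQ
    rw [e1, e2]
  have hgm : g 1 = m 1 := by
    apply Subtype.ext
    refine (coe_elliptic_braid c (ψ 1)).trans ?_
    have hp := Real.exp_pos (c / 2)
    have hq := Real.exp_pos (-(c / 2))
    have hp2 : Real.exp c = Real.exp (c / 2) ^ 2 := by rw [← Real.exp_nat_mul]; ring_nf
    have hq2 : Real.exp (-c) = Real.exp (-(c / 2)) ^ 2 := by rw [← Real.exp_nat_mul]; ring_nf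
    have hpq : Real.exp (c / 2) * Real.exp (-(c / 2)) = 1 := by rw [← Real.exp_add]; simp
    -- `sin (π / n)` is the inverse of `2 cosh (c / 2)`
    have h1 : Real.sin (Real.pi / n) * (Real.exp (c / 2) + Real.exp (-(c / 2))) = 1 := by
      rw [← sq_eq_sq₀ (by positivity) zero_le_one, ← hSC.trans (one_pow 2).symm, key, hp2, hq2]
      linear_combination 2 * Real.sin (Real.pi / n) ^ 2 * hpq
    have e1 : Real.sin (Real.pi / n) * ((Real.exp c + 2) * Real.cos (Real.pi / n) ^ 2 -
        Real.exp (-c) * Real.sin (Real.pi / n) ^ 2) = Real.exp (c / 2) := by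
      calc _ = Real.exp (c / 2) *
            (Real.sin (Real.pi / n) * (Real.exp (c / 2) + Real.exp (-(c / 2)))) ^ 3 := by
            rw [key, hp2, hq2]
            linear_combination -Real.sin (Real.pi / n) ^ 3 * (3 * Real.exp (c / 2) ^ 2 + 2 +
              2 * (Real.exp (c / 2) * Real.exp (-(c / 2))) + Real.exp (-(c / 2)) ^ 2) * hpq
        _ = _ := by rw [h1]; ring
    have e2 : Real.sin (Real.pi / n) * ((Real.exp (-c) + 2) * Real.cos (Real.pi / n) ^ 2 -
        Real.exp c * Real.sin (Real.pi / n) ^ 2) = Real.exp (-(c / 2)) := by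
      calc _ = Real.exp (-(c / 2)) *
            (Real.sin (Real.pi / n) * (Real.exp (c / 2) + Real.exp (-(c / 2)))) ^ 3 := by
            rw [key, hp2, hq2]
            linear_combination -Real.sin (Real.pi / n) ^ 3 * (3 * Real.exp (-(c / 2)) ^ 2 + 2 +
              2 * (Real.exp (-(c / 2)) * Real.exp (c / 2)) + Real.exp (c / 2) ^ 2) * hpq
        _ = _ := by rw [h1]; ring
    have hm1 : (((1 : I) : ℝ) * (2 * Real.pi / (2 : ℕ)) / 2) = Real.pi / 2 := by
      push_cast; ring
    change _ = (ellipticMatrix (c / 2) (((1 : I) : ℝ) * (2 * Real.pi / (2 : ℕ)) / 2) :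
      Matrix (Fin 2) (Fin 2) ℝ)
    rw [hψ1, hzero, e1, e2, hm1, coe_ellipticMatrix]
    simp
  have hshift : ∀ d, ∃ τ : basedPaths PSL2R, (τ : C(I, PSL2R)) 1 = hyperbolicShift d := by
    intro d
    have hd : Continuous fun s : I => hyperbolicShift (s * d) := by
      refine continuous_toPSL.comp (Continuous.subtype_mk (continuous_matrix fun i j => ?_) _)
      fin_cases i <;> fin_cases j <;> simp <;> fun_prop
    refine ⟨⟨⟨_, hd⟩, ?_⟩, by simp⟩
    change hyperbolicShift (((0 : I) : ℝ) * d) = 1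
    rw [← map_one toPSL]
    refine congrArg toPSL (Subtype.ext ?_)
    ext i j
    fin_cases i <;> fin_cases j <;> simp
  obtain ⟨τ, hτ⟩ := hshift c
  obtain ⟨μ, hμ⟩ := hshift (c / 2)
  have hhalf : ((hyperbolicA n * hyperbolicB n * hyperbolicA n : basedPaths PSL2R) :
      UniversalCoveringGroup PSL2R) =
      rotationPath hyperbolicRotation hyperbolicRotation_zero ((μ : C(I, PSL2R)) 1) 2 := by
    refine coe_eq_coe_of_slitPlane g m hg0 hm0 hgslit hmslit (fun s => ?_) (fun s => ?_) hgm
    · simp [g, hA, hB]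
    · rw [hμ]
      exact hyperbolicShift_conj _ _
  refine exists_hom (r := hyperbolicRotation) (hr := hyperbolicRotation_zero)
    hyperbolicRotation_add hyperbolicRotation_two_pi τ hτ (by omega) rfl rfl ?_ ?_
  · change ((hyperbolicA n * hyperbolicB n * hyperbolicA n : basedPaths PSL2R) :
        UniversalCoveringGroup PSL2R) =
      (hyperbolicB n * hyperbolicA n * hyperbolicB n : basedPaths PSL2R)
    refine coe_eq_coe_of_slitPlane g h hg0 hh0 hgslit hhslit (fun s => ?_) (fun s => ?_) hgh
    · simp [g, hA, hB]
    · simp [h, hA, hB]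
  · change ((hyperbolicA n * hyperbolicB n * hyperbolicA n : basedPaths PSL2R) :
        UniversalCoveringGroup PSL2R) ^ 2 = _
    rw [hhalf]
    exact rotationPath_pow hyperbolicRotation_add hyperbolicRotation_two_pi μ two_ne_zero

end Hyperbolic

/-! ### Spheres are simply connected -/

section Sphere

variable {E : Type*} [NormedAddCommGroup E] [InnerProductSpace ℝ E]

/-- A path in the unit sphere is approximated by a polygon with the same end points, which is
contained in a finite union of planes through the origin. -/
theorem exists_polygon (c : C(I, Metric.sphere (0 : E) 1)) :
    ∃ (P : C(I, E)) (W : Finset (Submodule ℝ E)), P 0 = c 0 ∧ P 1 = c 1 ∧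
      (∀ s, ‖P s - c s‖ < 1) ∧ (∀ s, ∃ w ∈ W, P s ∈ w) ∧ ∀ w ∈ W, Module.finrank ℝ w ≤ 2 := by
  classical
  have huc := CompactSpace.uniformContinuous_of_continuous c.continuous
  obtain ⟨δ, hδ, hc⟩ := Metric.uniformContinuous_iff.1 huc 1 one_pos
  obtain ⟨N, hN⟩ := exists_nat_one_div_lt hδ
  set M : ℝ := N + 1 with hM
  have hM0 : 0 < M := by positivity
  let v : ℕ → E := fun k => c (Set.projIcc 0 1 zero_le_one (k / M))
  let P : I → E := fun s => ∑ k ∈ Finset.range (N + 3), max 0 (1 - |M * s - k|) • v k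
  have hPc : Continuous P := by fun_prop
  have hP : ∀ s : I, ∃ k ≤ N + 1, ∃ f : ℝ, 0 ≤ f ∧ f < 1 ∧ M * s = k + f ∧
      P s = (1 - f) • v k + f • v (k + 1) := by
    intro s
    have hs : 0 ≤ M * s := mul_nonneg hM0.le s.2.1
    have hs1 : M * s ≤ M := mul_le_of_le_one_right hM0.le s.2.2
    set k := ⌊M * s⌋₊ with hk
    have h1 := Nat.floor_le hs
    have h2 := Nat.lt_floor_add_one (M * s)
    rw [← hk] at h1 h2
    have hkN : k ≤ N + 1 := by
      have : (k : ℝ) ≤ N + 1 := h1.trans hs1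
      exact_mod_cast this
    refine ⟨k, hkN, M * s - k, by linarith, by linarith, by ring, ?_⟩
    have e1 : max 0 (1 - |M * s - k|) = 1 - (M * s - k) := by
      rw [abs_of_nonneg (by linarith), max_eq_right (by linarith)]
    have e2 : max 0 (1 - |M * s - (k + 1 : ℕ)|) = M * s - k := by
      push_cast
      rw [abs_of_nonpos (by linarith), max_eq_right (by linarith)]
      ring
    suffices e3 : P s = max 0 (1 - |M * s - k|) • v k +
        max 0 (1 - |M * s - (k + 1 : ℕ)|) • v (k + 1) by
      rw [e3, e1, e2]
    change ∑ k ∈ Finset.range (N + 3), max 0 (1 - |M * s - k|) • v k = _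
    refine Finset.sum_eq_add_of_mem (M := E) (s := Finset.range (N + 3))
      (f := fun j : ℕ => max 0 (1 - |M * s - j|) • v j) k (k + 1) ?_ ?_ k.lt_succ_self.ne ?_
    iterate 2 exact Finset.mem_range.2 (by omega)
    rintro j - ⟨hj1, hj2⟩
    rw [max_eq_left, zero_smul]
    rw [sub_nonpos]
    rcases Nat.lt_or_ge j k with h | h
    · have : (j : ℝ) + 1 ≤ k := by exact_mod_cast h
      rw [abs_of_nonneg] <;> linarith
    · have : (k : ℝ) + 2 ≤ j := by exact_mod_cast (by omega : k + 2 ≤ j)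
      rw [abs_of_nonpos] <;> linarith
  have hv : ∀ (s : I) (j : ℕ), |M * s - j| ≤ 1 → v j ∈ Metric.ball (c s : E) 1 := by
    intro s j hj
    refine hc ?_
    rw [Subtype.dist_eq, Real.dist_eq]
    have h3 : |j / M - s| ≤ 1 / M := by
      have h5 : j / M - s = -((M * s - j) / M) := by field_simp; ring
      rw [h5, abs_neg, abs_div, abs_of_pos hM0]
      exact div_le_div_of_nonneg_right hj hM0.le
    have h4 : |(Set.projIcc (0 : ℝ) 1 zero_le_one (j / M) : ℝ) -
        Set.projIcc (0 : ℝ) 1 zero_le_one s| ≤ |j / M - s| := Set.abs_projIcc_sub_projIcc _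
    rw [Set.projIcc_val] at h4
    exact (h4.trans h3).trans_lt hN
  refine ⟨⟨P, hPc⟩, (Finset.range (N + 2)).image fun k => Submodule.span ℝ {v k, v (k + 1)},
    ?_, ?_, ?_, ?_, ?_⟩
  · obtain ⟨k, -, f, hf0, -, hk, h⟩ := hP 0
    have hk0 : (k : ℝ) = 0 := by
      have := Nat.cast_nonneg (α := ℝ) k
      simp at hk; linarith
    have hf : f = 0 := by simp [hk0] at hk; linarith
    have hk0' : k = 0 := by exact_mod_cast hk0
    change P 0 = _
    rw [h, hf, hk0']
    simp [v]
  · obtain ⟨k, hkN, f, hf0, hf1, hk, h⟩ := hP 1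
    have hkN' : (k : ℝ) ≤ M := by rw [hM]; exact_mod_cast hkN
    change P 1 = _
    rw [Set.Icc.coe_one, mul_one] at hk
    have hk1 : k = N + 1 := by
      have h6 : (N + 1 : ℝ) < k + 1 := by linarith
      have h7 : N + 1 < k + 1 := by exact_mod_cast h6
      omega
    have hkM : (k : ℝ) = M := by rw [hk1, hM]; push_cast; ring
    have hf : f = 0 := by linarith
    rw [h, hf]
    simp [v, hkM, hM0.ne']
  · intro s
    obtain ⟨k, -, f, hf0, hf1, hk, h⟩ := hP s
    rw [← dist_eq_norm]
    change P s ∈ Metric.ball (c s : E) 1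
    rw [h]
    refine convex_ball _ _ (hv s k ?_) (hv s (k + 1) ?_) (by linarith) hf0 (by ring)
    · rw [hk, add_sub_cancel_left, abs_of_nonneg hf0]; exact hf1.le
    · rw [hk]; push_cast
      rw [abs_le]; constructor <;> linarith
  · intro s
    obtain ⟨k, hkN, f, -, -, -, h⟩ := hP s
    refine ⟨_, Finset.mem_image_of_mem _ (Finset.mem_range.2 (Nat.lt_succ_of_le hkN)), ?_⟩
    change P s ∈ _
    rw [h]
    exact Submodule.add_mem _ (Submodule.smul_mem _ _ (Submodule.subset_span (by simp)))
      (Submodule.smul_mem _ _ (Submodule.subset_span (by simp)))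
  · intro w hw
    obtain ⟨k, -, rfl⟩ := Finset.mem_image.1 hw
    have := finrank_span_finset_le_card (R := ℝ) ({v k, v (k + 1)} : Finset E)
    rw [Finset.coe_pair] at this
    exact this.trans Finset.card_le_two

/-- A path in the unit sphere is homotopic to the radial projection of a polygon. -/
theorem exists_homotopicRel_polygon (c : C(I, Metric.sphere (0 : E) 1)) :
    ∃ (Q : C(I, Metric.sphere (0 : E) 1)) (W : Finset (Submodule ℝ E)), c.HomotopicRel Q {0, 1} ∧
      (∀ s, ∃ w ∈ W, (Q s : E) ∈ w) ∧ ∀ w ∈ W, Module.finrank ℝ w ≤ 2 := by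
  obtain ⟨P, W, hP0, hP1, hP, hW, hW2⟩ := exists_polygon c
  have hne : ∀ p : I × I, (1 - (p.1 : ℝ)) • (c p.2 : E) + (p.1 : ℝ) • P p.2 ≠ 0 := by
    intro p h0
    have h1 : (c p.2 : E) = -((p.1 : ℝ) • (P p.2 - c p.2)) := by
      calc (c p.2 : E) = ((1 - (p.1 : ℝ)) • (c p.2 : E) + (p.1 : ℝ) • P p.2) -
            (p.1 : ℝ) • (P p.2 - c p.2) := by module
        _ = _ := by rw [h0, zero_sub]
    have h2 : ‖(c p.2 : E)‖ = 1 := mem_sphere_zero_iff_norm.1 (c p.2).2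
    rw [h1, norm_neg, norm_smul, Real.norm_of_nonneg p.1.2.1] at h2
    have h3 := mul_le_of_le_one_left (norm_nonneg (P p.2 - c p.2)) p.1.2.2
    linarith [hP p.2]
  let K : C(I × I, E) := ⟨fun p => (1 - (p.1 : ℝ)) • (c p.2 : E) + (p.1 : ℝ) • P p.2, by fun_prop⟩
  have hK : ∀ p, K p ≠ 0 := hne
  have hKs : ∀ p, ‖K p‖⁻¹ • K p ∈ Metric.sphere (0 : E) 1 := fun p => by
    rw [mem_sphere_zero_iff_norm, norm_smul, norm_inv, norm_norm,
      inv_mul_cancel₀ (norm_ne_zero_iff.2 (hK p))]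
  let F : C(I × I, Metric.sphere (0 : E) 1) := ⟨fun p => ⟨‖K p‖⁻¹ • K p, hKs p⟩,
    Continuous.subtype_mk ((K.continuous.norm.inv₀ fun p => norm_ne_zero_iff.2 (hK p)).smul
      K.continuous) hKs⟩
  have hF : ∀ p, (F p : E) = ‖K p‖⁻¹ • K p := fun p => rfl
  have hFc : ∀ p, K p = c p.2 → F p = c p.2 := by
    intro p hp
    apply Subtype.ext
    rw [hF, hp, mem_sphere_zero_iff_norm.1 (c p.2).2, inv_one, one_smul]
  refine ⟨F.comp ⟨fun s => (1, s), by fun_prop⟩, W, ⟨⟨⟨F, ?_, fun s => rfl⟩, ?_⟩⟩, ?_, hW2⟩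
  · intro s
    exact hFc (0, s) (by simp [K])
  · rintro t s hs
    refine hFc (t, s) ?_
    have h1 : P s = c s := by rcases hs with rfl | rfl <;> assumption
    simp only [K, ContinuousMap.coe_mk, h1]
    module
  · intro s
    obtain ⟨w, hw, h⟩ := hW s
    refine ⟨w, hw, w.smul_mem _ ?_⟩
    simpa [K] using h

/-- Two paths with the same end points in a unit sphere are homotopic if both avoid the same
point. -/
theorem homotopicRel_of_avoid {v : E} (hv : ‖v‖ = 1) (c c' : C(I, Metric.sphere (0 : E) 1))
    (hc : ∀ s, (c s : E) ≠ v) (hc' : ∀ s, (c' s : E) ≠ v) (h0 : c 0 = c' 0) (h1 : c 1 = c' 1) :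
    c.HomotopicRel c' {0, 1} := by
  set S := stereographic hv with hS
  have hsrc : ∀ {x : Metric.sphere (0 : E) 1}, (x : E) ≠ v → x ∈ S.source := by
    intro x hx
    rw [hS, stereographic_source]
    intro h
    exact hx (congrArg Subtype.val h)
  have hcont : ∀ d : C(I, Metric.sphere (0 : E) 1), (∀ s, (d s : E) ≠ v) →
      Continuous fun s => S (d s) := fun d hd =>
    S.continuousOn.comp_continuous d.continuous fun s => hsrc (hd s)
  have hsymm : Continuous S.symm := by
    have h := S.continuousOn_symm
    rw [hS, stereographic_target] at h
    exact continuousOn_univ.1 h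
  have hfst : Continuous fun p : I × I => (p.1 : ℝ) := by fun_prop
  have e1 := hcont c hc
  have e2 := hcont c' hc'
  refine ⟨⟨⟨⟨fun p => S.symm ((1 - (p.1 : ℝ)) • S (c p.2) + (p.1 : ℝ) • S (c' p.2)),
    hsymm.comp (((continuous_const.sub hfst).smul (e1.comp continuous_snd)).add
      (hfst.smul (e2.comp continuous_snd)))⟩, ?_, ?_⟩, ?_⟩⟩
  · intro s
    simpa using S.left_inv (hsrc (hc s))
  · intro s
    simpa using S.left_inv (hsrc (hc' s))
  · intro t s hs
    have h : c s = c' s := by rcases hs with rfl | rfl <;> assumption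
    change S.symm ((1 - (t : ℝ)) • S (c s) + (t : ℝ) • S (c' s)) = c s
    rw [← h, ← add_smul, sub_add_cancel, one_smul]
    exact S.left_inv (hsrc (hc s))

/-- The unit sphere is simply connected in dimension at least two: two polygons do not fill it, so
that there is a point which both avoid. -/
theorem sphere_homotopicRel (hE : 2 < Module.finrank ℝ E) (c c' : C(I, Metric.sphere (0 : E) 1))
    (h0 : c 0 = c' 0) (h1 : c 1 = c' 1) : c.HomotopicRel c' {0, 1} := by
  classical
  obtain ⟨Q, W, hQ, hW, hW2⟩ := exists_homotopicRel_polygon c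
  obtain ⟨Q', W', hQ', hW', hW2'⟩ := exists_homotopicRel_polygon c'
  have hend : ∀ s ∈ ({0, 1} : Set I), c s = c' s := by rintro s (rfl | rfl) <;> assumption
  have hu : ∃ u : E, ∀ w ∈ W ∪ W', u ∉ w := by
    by_contra! h
    refine Subspace.biUnion_ne_univ_of_top_notMem (k := ℝ) (s := W ∪ W') ?_ ?_
    · intro htop
      have h2 : Module.finrank ℝ (⊤ : Submodule ℝ E) ≤ 2 :=
        (Finset.mem_union.1 htop).elim (hW2 _) (hW2' _)
      rw [finrank_top] at h2
      omega
    · refine Set.eq_univ_of_forall fun u => ?_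
      simpa using h u
  obtain ⟨u, hu⟩ := hu
  obtain ⟨w₀, hw₀, -⟩ := hW 0
  have hu0 : u ≠ 0 := fun h =>
    hu w₀ (Finset.mem_union_left _ hw₀) (h ▸ w₀.zero_mem)
  have hv : ‖(‖u‖⁻¹ • u : E)‖ = 1 := by
    rw [norm_smul, norm_inv, norm_norm, inv_mul_cancel₀ (norm_ne_zero_iff.2 hu0)]
  have hmem : ∀ w ∈ W ∪ W', ‖u‖⁻¹ • u ∉ w := fun w hw h =>
    hu w hw ((w.smul_mem_iff (inv_ne_zero (norm_ne_zero_iff.2 hu0))).1 h)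
  refine (hQ.trans (homotopicRel_of_avoid hv Q Q' ?_ ?_ ?_ ?_)).trans hQ'.symm
  · intro s hs
    obtain ⟨w, hw, h⟩ := hW s
    exact hmem w (Finset.mem_union_left _ hw) (hs ▸ h)
  · intro s hs
    obtain ⟨w, hw, h⟩ := hW' s
    exact hmem w (Finset.mem_union_right _ hw) (hs ▸ h)
  · rw [← hQ.fst_eq_snd (x := 0) (by simp), ← hQ'.fst_eq_snd (x := 0) (by simp), h0]
  · rw [← hQ.fst_eq_snd (x := 1) (by simp), ← hQ'.fst_eq_snd (x := 1) (by simp), h1]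

end Sphere

/-! ### The rotation group of the sphere and unit quaternions -/

section Spin

/-- The quaternion `t + x i + y j + z k`. -/
def quat (t x y z : ℝ) : ℍ[ℝ] := ⟨t, x, y, z⟩

@[simp] theorem quat_re (t x y z : ℝ) : (quat t x y z).re = t := rfl

@[simp] theorem quat_imI (t x y z : ℝ) : (quat t x y z).imI = x := rfl

@[simp] theorem quat_imJ (t x y z : ℝ) : (quat t x y z).imJ = y := rfl

@[simp] theorem quat_imK (t x y z : ℝ) : (quat t x y z).imK = z := rfl

theorem quat_mul (t x y z t' x' y' z' : ℝ) : quat t x y z * quat t' x' y' z' =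
    quat (t * t' - x * x' - y * y' - z * z') (t * x' + x * t' + y * z' - z * y')
      (t * y' - x * z' + y * t' + z * x') (t * z' + x * y' - y * x' + z * t') := by
  apply Quaternion.ext <;> simp

theorem star_quat (t x y z : ℝ) : star (quat t x y z) = quat t (-x) (-y) (-z) := by
  apply Quaternion.ext <;> simp

theorem quat_eq_one : quat 1 0 0 0 = 1 := rfl

theorem quat_eq_neg_one : quat (-1) 0 0 0 = -1 := by
  apply Quaternion.ext <;> simp

/-- The matrix of the linear map `v ↦ q v q*` on the space of pure quaternions. -/
def rotationMatrix (q : ℍ[ℝ]) : Matrix (Fin 3) (Fin 3) ℝ :=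
  !![q.re ^ 2 + q.imI ^ 2 - q.imJ ^ 2 - q.imK ^ 2, 2 * (q.imI * q.imJ - q.re * q.imK),
      2 * (q.imI * q.imK + q.re * q.imJ);
    2 * (q.imI * q.imJ + q.re * q.imK), q.re ^ 2 - q.imI ^ 2 + q.imJ ^ 2 - q.imK ^ 2,
      2 * (q.imJ * q.imK - q.re * q.imI);
    2 * (q.imI * q.imK - q.re * q.imJ), 2 * (q.imJ * q.imK + q.re * q.imI),
      q.re ^ 2 - q.imI ^ 2 - q.imJ ^ 2 + q.imK ^ 2]

theorem rotationMatrix_one : rotationMatrix 1 = 1 := by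
  ext i j
  fin_cases i <;> fin_cases j <;> simp [rotationMatrix]

theorem rotationMatrix_mul (p q : ℍ[ℝ]) :
    rotationMatrix (p * q) = rotationMatrix p * rotationMatrix q := by
  ext i j
  fin_cases i <;> fin_cases j <;>
    simp [rotationMatrix, Matrix.mul_apply, Fin.sum_univ_three] <;> ring

theorem sum_sq_of_mem_sphere (q : Metric.sphere (0 : ℍ[ℝ]) 1) :
    (q : ℍ[ℝ]).re ^ 2 + (q : ℍ[ℝ]).imI ^ 2 + (q : ℍ[ℝ]).imJ ^ 2 + (q : ℍ[ℝ]).imK ^ 2 = 1 := by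
  rw [← Quaternion.normSq_def', Quaternion.normSq_eq_norm_mul_self,
    mem_sphere_zero_iff_norm.1 q.2, one_mul]

theorem mem_sphere_of_sum_sq {q : ℍ[ℝ]}
    (h : q.re ^ 2 + q.imI ^ 2 + q.imJ ^ 2 + q.imK ^ 2 = 1) : q ∈ Metric.sphere (0 : ℍ[ℝ]) 1 := by
  rw [← Quaternion.normSq_def', Quaternion.normSq_eq_norm_mul_self] at h
  rw [mem_sphere_zero_iff_norm]
  nlinarith [norm_nonneg q]

theorem rotationMatrix_mem (q : Metric.sphere (0 : ℍ[ℝ]) 1) :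
    rotationMatrix q ∈ Matrix.specialOrthogonalGroup (Fin 3) ℝ := by
  have h := sum_sq_of_mem_sphere q
  generalize (q : ℍ[ℝ]) = q at h
  rw [Matrix.mem_specialOrthogonalGroup_iff, Matrix.mem_orthogonalGroup_iff]
  have h2 : (q.re ^ 2 + q.imI ^ 2 + q.imJ ^ 2 + q.imK ^ 2) ^ 2 = 1 := by rw [h, one_pow]
  have h3 : (q.re ^ 2 + q.imI ^ 2 + q.imJ ^ 2 + q.imK ^ 2) ^ 3 = 1 := by rw [h, one_pow]
  constructor
  · ext i j
    fin_cases i <;> fin_cases j <;>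
      simp [rotationMatrix, Matrix.mul_apply, Fin.sum_univ_three] <;>
      first | ring1 | linear_combination h2
  · simp [rotationMatrix, Matrix.det_fin_three]
    linear_combination h3

/-- The double covering of `SO(3)` by the group of unit quaternions. -/
def toSO3 : Metric.sphere (0 : ℍ[ℝ]) 1 →* SO3 where
  toFun q := ⟨rotationMatrix q, rotationMatrix_mem q⟩
  map_one' := Subtype.ext rotationMatrix_one
  map_mul' p q := Subtype.ext (rotationMatrix_mul p q)

theorem continuous_toSO3 : Continuous toSO3 := by
  refine Continuous.subtype_mk (continuous_matrix fun i j => ?_) _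
  have h1 : Continuous fun q : Metric.sphere (0 : ℍ[ℝ]) 1 => (q : ℍ[ℝ]).re :=
    Quaternion.continuous_re.comp continuous_subtype_val
  have h2 : Continuous fun q : Metric.sphere (0 : ℍ[ℝ]) 1 => (q : ℍ[ℝ]).imI :=
    Quaternion.continuous_imI.comp continuous_subtype_val
  have h3 : Continuous fun q : Metric.sphere (0 : ℍ[ℝ]) 1 => (q : ℍ[ℝ]).imJ :=
    Quaternion.continuous_imJ.comp continuous_subtype_val
  have h4 : Continuous fun q : Metric.sphere (0 : ℍ[ℝ]) 1 => (q : ℍ[ℝ]).imK :=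
    Quaternion.continuous_imK.comp continuous_subtype_val
  fin_cases i <;> fin_cases j <;> simp [rotationMatrix] <;> fun_prop

theorem toSO3_eq_one_iff {q : Metric.sphere (0 : ℍ[ℝ]) 1} : toSO3 q = 1 ↔ q = 1 ∨ q = -1 := by
  constructor
  · intro h
    have hM : rotationMatrix q = 1 := congrArg Subtype.val h
    have hq := sum_sq_of_mem_sphere q
    have h1 := congrFun (congrFun hM 0) 0
    have h2 := congrFun (congrFun hM 1) 1
    have h3 := congrFun (congrFun hM 2) 2
    simp [rotationMatrix] at h1 h2 h3
    have e1 : (q : ℍ[ℝ]).imI = 0 := by rw [← sq_eq_zero_iff]; linarith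
    have e2 : (q : ℍ[ℝ]).imJ = 0 := by rw [← sq_eq_zero_iff]; linarith
    have e3 : (q : ℍ[ℝ]).imK = 0 := by rw [← sq_eq_zero_iff]; linarith
    have e4 : (q : ℍ[ℝ]).re ^ 2 = 1 := by rw [e1, e2, e3] at hq; linarith
    refine (sq_eq_one_iff.1 e4).imp ?_ ?_ <;> intro e <;> apply Subtype.ext <;>
      apply Quaternion.ext <;> simp [e, e1, e2, e3]
  · rintro (rfl | rfl)
    · exact map_one _
    · apply Subtype.ext
      change rotationMatrix (-1) = 1
      ext i j
      fin_cases i <;> fin_cases j <;> simp [rotationMatrix]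

/-- The unit quaternion of a rotation is found by normalizing the one whose real part is
`1 + trace R` and whose imaginary part is the axial vector of `R - Rᵀ`. -/
theorem exists_rotationMatrix_eq_of_trace {R : Matrix (Fin 3) (Fin 3) ℝ}
    (hR : R ∈ Matrix.specialOrthogonalGroup (Fin 3) ℝ) (ht : 0 < 1 + R 0 0 + R 1 1 + R 2 2) :
    ∃ q : Metric.sphere (0 : ℍ[ℝ]) 1, rotationMatrix q = R := by
  obtain ⟨h1, h2⟩ := Matrix.mem_specialOrthogonalGroup_iff.1 hR
  have hrow : R * R.transpose = 1 := (Matrix.mem_orthogonalGroup_iff (Fin 3) ℝ).1 h1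
  have hcol : R.transpose * R = 1 := (Matrix.mem_orthogonalGroup_iff' (Fin 3) ℝ).1 h1
  -- a rotation is its own matrix of cofactors
  have hadj : R.adjugate = R.transpose := by
    have h3 : R.adjugate * R = 1 := by rw [Matrix.adjugate_mul, h2, one_smul]
    calc R.adjugate = R.adjugate * (R * R.transpose) := by rw [hrow, mul_one]
      _ = _ := by rw [← mul_assoc, h3, one_mul]
  have row : ∀ i j, R i 0 * R j 0 + R i 1 * R j 1 + R i 2 * R j 2 =
      (1 : Matrix (Fin 3) (Fin 3) ℝ) i j := fun i j => by
    rw [← hrow, Matrix.mul_apply, Fin.sum_univ_three]; rfl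
  have col : ∀ i j, R 0 i * R 0 j + R 1 i * R 1 j + R 2 i * R 2 j =
      (1 : Matrix (Fin 3) (Fin 3) ℝ) i j := fun i j => by
    rw [← hcol, Matrix.mul_apply, Fin.sum_univ_three]; rfl
  have cof : ∀ i j, R.adjugate j i = R i j := fun i j => by rw [hadj]; rfl
  have r11 := row 0 0
  have r22 := row 1 1
  have r33 := row 2 2
  have r12 := row 0 1
  have r13 := row 0 2
  have r23 := row 1 2
  have c11 := col 0 0
  have c22 := col 1 1
  have c33 := col 2 2
  have c12 := col 0 1
  have c13 := col 0 2
  have c23 := col 1 2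
  have k11 := cof 0 0
  have k22 := cof 1 1
  have k33 := cof 2 2
  have k12 := cof 0 1
  have k21 := cof 1 0
  have k13 := cof 0 2
  have k31 := cof 2 0
  have k23 := cof 1 2
  have k32 := cof 2 1
  simp at r11 r22 r33 r12 r13 r23 c11 c22 c33 c12 c13 c23
  simp [Matrix.adjugate_fin_three] at k11 k22 k33 k12 k21 k13 k31 k23 k32
  set t := 1 + R 0 0 + R 1 1 + R 2 2 with htdef
  have xx : (R 2 1 - R 1 2) ^ 2 = t * (1 + R 0 0 - R 1 1 - R 2 2) := by
    linear_combination r33 + r22 - c11 + 2 * k11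
  have yy : (R 0 2 - R 2 0) ^ 2 = t * (1 - R 0 0 + R 1 1 - R 2 2) := by
    linear_combination r11 + r33 - c22 + 2 * k22
  have zz : (R 1 0 - R 0 1) ^ 2 = t * (1 - R 0 0 - R 1 1 + R 2 2) := by
    linear_combination r11 + r22 - c33 + 2 * k33
  have xy : (R 2 1 - R 1 2) * (R 0 2 - R 2 0) = t * (R 0 1 + R 1 0) := by
    linear_combination k12 + k21 - c12 - r12
  have xz : (R 2 1 - R 1 2) * (R 1 0 - R 0 1) = t * (R 0 2 + R 2 0) := by
    linear_combination k13 + k31 - c13 - r13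
  have yz : (R 0 2 - R 2 0) * (R 1 0 - R 0 1) = t * (R 1 2 + R 2 1) := by
    linear_combination k23 + k32 - c23 - r23
  set D : ℝ := (2 * √t)⁻¹ with hD
  have hst : 0 < √t := Real.sqrt_pos.2 ht
  have hs2 : √t ^ 2 = t := Real.sq_sqrt ht.le
  have hwD : √t * D = 1 / 2 := by rw [hD]; field_simp
  have hDD : D ^ 2 * t = 1 / 4 := by rw [← hs2]; linear_combination (√t * D + 1 / 2) * hwD
  let q := quat (√t / 2) (D * (R 2 1 - R 1 2)) (D * (R 0 2 - R 2 0)) (D * (R 1 0 - R 0 1))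
  have hq : q.re ^ 2 + q.imI ^ 2 + q.imJ ^ 2 + q.imK ^ 2 = 1 := by
    simp only [q, quat_re, quat_imI, quat_imJ, quat_imK]
    linear_combination hs2 / 4 + D ^ 2 * xx + D ^ 2 * yy + D ^ 2 * zz +
      (3 - R 0 0 - R 1 1 - R 2 2) * hDD + htdef / 4
  refine ⟨⟨q, mem_sphere_of_sum_sq hq⟩, ?_⟩
  ext i j
  fin_cases i <;> fin_cases j <;> simp [rotationMatrix, q]
  · linear_combination hs2 / 4 + D ^ 2 * xx - D ^ 2 * yy - D ^ 2 * zz +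
      (-1 + 3 * R 0 0 - R 1 1 - R 2 2) * hDD + htdef / 4
  · linear_combination 2 * D ^ 2 * xy + 2 * (R 0 1 + R 1 0) * hDD - (R 1 0 - R 0 1) * hwD
  · linear_combination 2 * D ^ 2 * xz + 2 * (R 0 2 + R 2 0) * hDD + (R 0 2 - R 2 0) * hwD
  · linear_combination 2 * D ^ 2 * xy + 2 * (R 0 1 + R 1 0) * hDD + (R 1 0 - R 0 1) * hwD
  · linear_combination hs2 / 4 - D ^ 2 * xx + D ^ 2 * yy - D ^ 2 * zz +
      (-1 - R 0 0 + 3 * R 1 1 - R 2 2) * hDD + htdef / 4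
  · linear_combination 2 * D ^ 2 * yz + 2 * (R 1 2 + R 2 1) * hDD - (R 2 1 - R 1 2) * hwD
  · linear_combination 2 * D ^ 2 * xz + 2 * (R 0 2 + R 2 0) * hDD - (R 0 2 - R 2 0) * hwD
  · linear_combination 2 * D ^ 2 * yz + 2 * (R 1 2 + R 2 1) * hDD + (R 2 1 - R 1 2) * hwD
  · linear_combination hs2 / 4 - D ^ 2 * xx - D ^ 2 * yy + D ^ 2 * zz +
      (-1 - R 0 0 - R 1 1 + 3 * R 2 2) * hDD + htdef / 4

/-- The trace of a rotation `R` is greater than `-1` after multiplication by the unit or by one of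
the half turns about the coordinate axes, since the four traces add up to zero. -/
theorem toSO3_surjective : Function.Surjective toSO3 := by
  have key : ∀ (u : Metric.sphere (0 : ℍ[ℝ]) 1) (R : SO3),
      0 < 1 + (R * toSO3 u : SO3).1 0 0 + (R * toSO3 u : SO3).1 1 1 + (R * toSO3 u : SO3).1 2 2 →
      ∃ q, toSO3 q = R := by
    intro u R h
    obtain ⟨q, hq⟩ := exists_rotationMatrix_eq_of_trace (R * toSO3 u).2 h
    exact ⟨q * u⁻¹, by rw [map_mul, map_inv, mul_inv_eq_iff_eq_mul]; exact Subtype.ext hq⟩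
  intro R
  have e : ∀ (u : Metric.sphere (0 : ℍ[ℝ]) 1) (i j : Fin 3), (R * toSO3 u : SO3).1 i j =
      R.1 i 0 * rotationMatrix u 0 j + R.1 i 1 * rotationMatrix u 1 j +
        R.1 i 2 * rotationMatrix u 2 j := by
    intro u i j
    change (R.1 * rotationMatrix u) i j = _
    rw [Matrix.mul_apply, Fin.sum_univ_three]
  by_contra! hne
  have h1 := mt (key 1 R) (by simpa using hne)
  have h2 := mt (key ⟨quat 0 1 0 0, mem_sphere_of_sum_sq (by simp)⟩ R) (by simpa using hne)
  have h3 := mt (key ⟨quat 0 0 1 0, mem_sphere_of_sum_sq (by simp)⟩ R) (by simpa using hne)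
  have h4 := mt (key ⟨quat 0 0 0 1, mem_sphere_of_sum_sq (by simp)⟩ R) (by simpa using hne)
  simp only [e] at h1 h2 h3 h4
  simp [rotationMatrix] at h1 h2 h3 h4
  linarith

theorem isCoveringMap_toSO3 : IsCoveringMap toSO3 := by
  have hfin : (toSO3.ker : Set (Metric.sphere (0 : ℍ[ℝ]) 1)).Finite :=
    Set.Finite.subset (Set.toFinite {1, -1}) fun q hq => toSO3_eq_one_iff.1 hq
  exact (((continuous_toSO3.isClosedMap.isQuotientMap continuous_toSO3
    toSO3_surjective).isQuotientCoveringMap_of_isDiscrete_ker_monoidHom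
      hfin.isDiscrete)).isCoveringMap

theorem developsPaths_toSO3 : DevelopsPaths ⟨toSO3, continuous_toSO3⟩ 1 :=
  developsPaths_of_isCoveringMap isCoveringMap_toSO3 (map_one toSO3) <|
    sphere_homotopicRel (by rw [Quaternion.finrank_eq_four]; norm_num)

end Spin

section Spin

theorem sphereRotation_add (s t : ℝ) :
    sphereRotation (s + t) = sphereRotation s * sphereRotation t := by
  apply Subtype.ext
  change !![Real.cos (s + t), -Real.sin (s + t), 0; Real.sin (s + t), Real.cos (s + t), 0;
    0, 0, 1] = !![Real.cos s, -Real.sin s, 0; Real.sin s, Real.cos s, 0; 0, 0, 1] *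
      !![Real.cos t, -Real.sin t, 0; Real.sin t, Real.cos t, 0; 0, 0, 1]
  ext i j
  fin_cases i <;> fin_cases j <;>
    simp [Matrix.mul_apply, Fin.sum_univ_three, Real.cos_add, Real.sin_add] <;> ring

theorem sphereRotation_two_pi : sphereRotation (2 * Real.pi) = 1 := by
  rw [← sphereRotation_zero]
  apply Subtype.ext
  simp [sphereRotation]

/-- The unit quaternion of the rotation by `θ` about the third axis. -/
noncomputable def spinRotation (θ : ℝ) : Metric.sphere (0 : ℍ[ℝ]) 1 :=
  ⟨quat (Real.cos (θ / 2)) 0 0 (Real.sin (θ / 2)), mem_sphere_of_sum_sq (by simp)⟩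

/-- The unit quaternion of the rotation by `c` about the second axis. -/
noncomputable def spinShift (c : ℝ) : Metric.sphere (0 : ℍ[ℝ]) 1 :=
  ⟨quat (Real.cos (c / 2)) 0 (Real.sin (c / 2)) 0, mem_sphere_of_sum_sq (by simp)⟩

theorem toSO3_spinRotation (θ : ℝ) : toSO3 (spinRotation θ) = sphereRotation θ := by
  apply Subtype.ext
  have h1 := Real.cos_sq_add_sin_sq (θ / 2)
  have h2 := Real.cos_two_mul' (θ / 2)
  have h3 := Real.sin_two_mul (θ / 2)
  rw [mul_div_cancel₀ θ two_ne_zero] at h2 h3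
  change rotationMatrix _ = !![Real.cos θ, -Real.sin θ, 0; Real.sin θ, Real.cos θ, 0; 0, 0, 1]
  ext i j
  fin_cases i <;> fin_cases j <;> simp [rotationMatrix, spinRotation] <;> linarith

theorem toSO3_spinShift (c : ℝ) : toSO3 (spinShift c) = sphereShift c := by
  apply Subtype.ext
  have h1 := Real.cos_sq_add_sin_sq (c / 2)
  have h2 := Real.cos_two_mul' (c / 2)
  have h3 := Real.sin_two_mul (c / 2)
  rw [mul_div_cancel₀ c two_ne_zero] at h2 h3
  change rotationMatrix _ = !![Real.cos c, 0, Real.sin c; 0, 1, 0; -Real.sin c, 0, Real.cos c]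
  ext i j
  fin_cases i <;> fin_cases j <;> simp [rotationMatrix, spinShift] <;> linarith

theorem continuous_quaternion {Y : Type*} [TopologicalSpace Y] {F : Y → ℍ[ℝ]}
    (h1 : Continuous fun y => (F y).re) (h2 : Continuous fun y => (F y).imI)
    (h3 : Continuous fun y => (F y).imJ) (h4 : Continuous fun y => (F y).imK) : Continuous F := by
  let i := quat 0 1 0 0
  let j := quat 0 0 1 0
  let k := quat 0 0 0 1
  have e : F = fun y => (F y).re • (1 : ℍ[ℝ]) + (F y).imI • i + (F y).imJ • j + (F y).imK • k := by
    funext y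
    apply Quaternion.ext <;> simp [i, j, k]
  rw [e]
  fun_prop

theorem continuous_spinRotation : Continuous spinRotation := by
  refine Continuous.subtype_mk (continuous_quaternion ?_ ?_ ?_ ?_) _ <;> simp <;> fun_prop

theorem continuous_spinShift : Continuous spinShift := by
  refine Continuous.subtype_mk (continuous_quaternion ?_ ?_ ?_ ?_) _ <;> simp <;> fun_prop

theorem spinRotation_zero : spinRotation 0 = 1 := by
  apply Subtype.ext
  apply Quaternion.ext <;> simp [spinRotation]

theorem spinShift_zero : spinShift 0 = 1 := by
  apply Subtype.ext
  apply Quaternion.ext <;> simp [spinShift]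

theorem spinRotation_two_pi : spinRotation (2 * Real.pi) = -1 := by
  apply Subtype.ext
  apply Quaternion.ext <;> simp [spinRotation]

/-- The loops in `SO(3)` are homotopic to a point or to the full rotation, according to whether
they end at `1` or at `-1` after lifting to the unit quaternions. -/
theorem sphere_loops :
    (∀ g, coveringMap SO3 g = 1 →
      g ∈ Subgroup.zpowers (fullRotation sphereRotation sphereRotation_zero)) ∧
    ∀ k : ℤ, fullRotation sphereRotation sphereRotation_zero ^ k = 1 → Even k := by
  have hD := developsPaths_toSO3
  let d : ℤ → basedPaths SO3 :=
    fun k => ⟨⟨fun s => sphereRotation (k * (2 * Real.pi) * s), by fun_prop⟩, by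
      change sphereRotation (k * (2 * Real.pi) * ((0 : I) : ℝ)) = 1
      simp [sphereRotation_zero]⟩
  let e : ℤ → C(I, Metric.sphere (0 : ℍ[ℝ]) 1) :=
    fun k => ⟨fun s => spinRotation (k * (2 * Real.pi) * s),
      continuous_spinRotation.comp (by fun_prop)⟩
  have he0 : ∀ k, e k 0 = 1 := fun k => by simp [e, spinRotation_zero]
  have hde : ∀ k s, (d k : C(I, SO3)) s = toSO3 (e k s) := fun k s =>
    (toSO3_spinRotation _).symm
  constructor
  · intro g hg
    obtain ⟨γ, rfl⟩ := Con.mk'_surjective g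
    obtain ⟨c, hc0, hc⟩ := hD.exists_lift γ
    have hc' : ∀ s, (γ : C(I, SO3)) s = toSO3 (c s) := fun s => by rw [← hc]; rfl
    have hg : (γ : C(I, SO3)) 1 = 1 := hg
    rw [hc', toSO3_eq_one_iff] at hg
    have key : ∀ k : ℤ, c 1 = e k 1 →
        (γ : UniversalCoveringGroup SO3) ∈
          Subgroup.zpowers (fullRotation sphereRotation sphereRotation_zero) := fun k hk =>
      ⟨k, (fullRotation_zpow sphereRotation_add k (d k) fun _ => rfl).trans
        ((hD.coe_eq_coe_iff (e k) c (he0 k) hc0 (hde k) hc').2 hk.symm)⟩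
    rcases hg with h | h
    · exact key 0 (h.trans (by simp [e, spinRotation_zero]))
    · exact key 1 (h.trans (by simp [e, spinRotation_two_pi]))
  · intro k hk
    rw [fullRotation_zpow sphereRotation_add k (d k) fun _ => rfl] at hk
    have h1 := (hD.coe_eq_coe_iff (δ := 1) (e k) (ContinuousMap.const I 1)
      (he0 k) rfl (hde k) (fun s => hD.map_base.symm)).1 hk
    have h2 : Real.cos (k * (2 * Real.pi) * ((1 : I) : ℝ) / 2) = 1 :=
      congrArg (fun q : Metric.sphere (0 : ℍ[ℝ]) 1 => (q : ℍ[ℝ]).re) h1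
    have h3 : (k : ℝ) * (2 * Real.pi) * ((1 : I) : ℝ) / 2 = k * Real.pi := by simp; ring
    rw [h3, Real.cos_int_mul_pi] at h2
    by_contra hodd
    rw [Int.not_even_iff_odd] at hodd
    rw [hodd.neg_one_zpow] at h2
    norm_num at h2

/-- The law of cosines for the angles of the equilateral spherical triangle, with the side
`c = arccos (sideCos n)`. It needs `sideCos n` to lie between `-1` and `1`, hence the bounds on
`n`. -/
theorem cos_sq_eq_of_sideCos_of_le {n : ℕ} (hn : 3 ≤ n) (hn' : n ≤ 5) :
    Real.cos (Real.pi / n) ^ 2 = Real.sin (Real.pi / n) ^ 2 *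
      (1 + 2 * Real.cos (Real.arccos (sideCos n))) := by
  have h3 : (3 : ℝ) ≤ n := by exact_mod_cast hn
  have h5 : (n : ℝ) ≤ 5 := by exact_mod_cast hn'
  have hpi := Real.pi_pos
  have h2 : 2 * Real.pi / n = 2 * (Real.pi / n) := by ring
  have hle : Real.pi / n ≤ Real.pi / 3 := by gcongr
  have hge : Real.pi / 6 ≤ Real.pi / n := by gcongr; linarith
  have hc : Real.cos (2 * (Real.pi / n)) ≤ 1 / 2 := by
    rw [← Real.cos_pi_div_three]
    apply Real.cos_le_cos_of_nonneg_of_le_pi <;> linarith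
  have hs : 0 < Real.sin (Real.pi / n) := Real.sin_pos_of_pos_of_lt_pi (by linarith) (by linarith)
  have h6 : 1 - Real.cos (2 * (Real.pi / n)) = 2 * Real.sin (Real.pi / n) ^ 2 := by
    rw [Real.cos_two_mul, Real.cos_sq']; ring
  have h7 : -1 ≤ sideCos n := by
    rw [sideCos, h2, le_div_iff₀ (by rw [h6]; positivity)]
    linarith
  have h8 : sideCos n ≤ 1 := by
    rw [sideCos, h2, div_le_one (by rw [h6]; positivity)]
    linarith
  have h9 : 2 * Real.sin (Real.pi / n) ^ 2 * sideCos n = Real.cos (2 * (Real.pi / n)) := by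
    rw [sideCos, h2, h6]; field_simp
  rw [Real.cos_arccos h7 h8]
  linear_combination -h9 - Real.cos_two_mul' (Real.pi / n)

theorem spinShift_inv (c : ℝ) : (spinShift c)⁻¹ = spinShift (-c) := by
  rw [inv_eq_iff_mul_eq_one]
  have h := Real.cos_sq_add_sin_sq (c / 2)
  apply Subtype.ext
  apply Quaternion.ext <;> simp [spinShift, neg_div] <;> linarith

/-- The rotation by `2 θ` about the axis at distance `c` from the third axis. -/
theorem coe_spin_conj (c θ : ℝ) :
    ((spinShift c * spinRotation (2 * θ) * (spinShift c)⁻¹ : Metric.sphere (0 : ℍ[ℝ]) 1) : ℍ[ℝ]) =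
      quat (Real.cos θ) (Real.sin θ * Real.sin c) 0 (Real.sin θ * Real.cos c) := by
  have h1 := Real.cos_sq_add_sin_sq (c / 2)
  have h2 := Real.cos_two_mul' (c / 2)
  have h3 := Real.sin_two_mul (c / 2)
  rw [mul_div_cancel₀ c two_ne_zero] at h2 h3
  rw [spinShift_inv, h2, h3]
  apply Quaternion.ext <;> simp [spinShift, spinRotation, neg_div]
  · linear_combination Real.cos θ * h1
  · ring
  · ring
  · ring

/-- The braid relation, and the square of the half twist, for two unit quaternions with the same
angle and with the axes at distance `c`. -/
theorem spin_relations {C S c : ℝ} {A B : Metric.sphere (0 : ℍ[ℝ]) 1} (h : C ^ 2 + S ^ 2 = 1)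
    (hc : C ^ 2 = S ^ 2 * (1 + 2 * Real.cos c)) (hA : (A : ℍ[ℝ]) = quat C 0 0 S)
    (hB : (B : ℍ[ℝ]) = quat C (S * Real.sin c) 0 (S * Real.cos c)) :
    A * B * A = B * A * B ∧ (A * B * A) ^ 2 = -1 := by
  have h1 := Real.cos_sq_add_sin_sq c
  have e1 : (A : ℍ[ℝ]) * B * A = quat 0 (S * Real.sin c) 0 (S * (1 + Real.cos c)) := by
    rw [hA, hB, quat_mul, quat_mul]
    congr 1
    · linear_combination C * hc
    · linear_combination S * Real.sin c * h
    · ring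
    · linear_combination S * hc + S * (1 + Real.cos c) * h
  have e2 : (B : ℍ[ℝ]) * A * B = quat 0 (S * Real.sin c) 0 (S * (1 + Real.cos c)) := by
    rw [hA, hB, quat_mul, quat_mul]
    congr 1
    · linear_combination C * hc - C * S ^ 2 * h1
    · linear_combination S * Real.sin c * (hc + h)
    · ring
    · linear_combination S * Real.cos c * hc + S * (1 + Real.cos c) * h + S ^ 3 * h1
  constructor
  · exact Subtype.ext (e1.trans e2.symm)
  · apply Subtype.ext
    change ((A : ℍ[ℝ]) * B * A) ^ 2 = -1
    rw [e1, sq, quat_mul, ← quat_eq_neg_one]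
    congr 1
    · linear_combination hc - h - S ^ 2 * h1
    · ring
    · ring
    · ring

/-- The paths `α β α`, `β α β` and the full rotation lift to the group of unit quaternions, which is
simply connected, so the relations hold as soon as they hold for the end points of the lifts. -/
theorem exists_hom_sphere {n : ℕ} (hn : 3 ≤ n) (hn' : n ≤ 5) :
    ∃ Φ : DBar n →* UniversalCoveringGroup SO3,
      Φ DBar.a = sphereA n ∧ Φ DBar.b = sphereB n ∧
      Φ (DBar.a ^ n) = fullRotation sphereRotation sphereRotation_zero := by
  set c := Real.arccos (sideCos n) with hc
  have hD := developsPaths_toSO3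
  let A : C(I, Metric.sphere (0 : ℍ[ℝ]) 1) :=
    ⟨fun s => spinRotation (s * (2 * Real.pi / n)), continuous_spinRotation.comp (by fun_prop)⟩
  let B : C(I, Metric.sphere (0 : ℍ[ℝ]) 1) :=
    ⟨fun s => spinShift c * A s * (spinShift c)⁻¹,
      (continuous_const.mul A.continuous).mul continuous_const⟩
  let F : C(I, Metric.sphere (0 : ℍ[ℝ]) 1) :=
    ⟨fun s => spinRotation (s * (2 * Real.pi / (1 : ℕ))),
      continuous_spinRotation.comp (by fun_prop)⟩
  have hA0 : A 0 = 1 := by simp [A, spinRotation_zero]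
  have hB0 : B 0 = 1 := by simp [B, hA0]
  have hF0 : F 0 = 1 := by simp [F, spinRotation_zero]
  have hA : ∀ s, (sphereA n : C(I, SO3)) s = toSO3 (A s) := by
    intro s
    change 1 * sphereRotation _ * 1⁻¹ = toSO3 (spinRotation _)
    rw [one_mul, inv_one, mul_one, toSO3_spinRotation]
  have hB : ∀ s, (sphereB n : C(I, SO3)) s = toSO3 (B s) := by
    intro s
    change sphereShift c * sphereRotation _ * (sphereShift c)⁻¹ =
      toSO3 (spinShift c * spinRotation _ * (spinShift c)⁻¹)
    rw [map_mul toSO3, map_mul toSO3, map_inv toSO3, toSO3_spinRotation, toSO3_spinShift]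
  have hF : ∀ s, (rotationPath sphereRotation sphereRotation_zero 1 1 : C(I, SO3)) s =
      toSO3 (F s) := by
    intro s
    change 1 * sphereRotation _ * 1⁻¹ = toSO3 (spinRotation _)
    rw [one_mul, inv_one, mul_one, toSO3_spinRotation]
  have e : ((1 : I) : ℝ) * (2 * Real.pi / n) = 2 * (Real.pi / n) := by simp; ring
  have hA1 : (A 1 : ℍ[ℝ]) = quat (Real.cos (Real.pi / n)) 0 0 (Real.sin (Real.pi / n)) := by
    simp only [A, ContinuousMap.coe_mk, e, spinRotation, mul_div_cancel_left₀ _ (two_ne_zero' ℝ)]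
  have hB1 : (B 1 : ℍ[ℝ]) = quat (Real.cos (Real.pi / n)) (Real.sin (Real.pi / n) * Real.sin c) 0
      (Real.sin (Real.pi / n) * Real.cos c) := by
    rw [← coe_spin_conj, ← e]
    rfl
  have hF1 : F 1 = -1 := by
    rw [← spinRotation_two_pi]
    simp [F]
  obtain ⟨h1, h2⟩ := spin_relations (Real.cos_sq_add_sin_sq _)
    (cos_sq_eq_of_sideCos_of_le hn hn') hA1 hB1
  obtain ⟨τ, hτ⟩ : ∃ τ : basedPaths SO3, (τ : C(I, SO3)) 1 = sphereShift c := by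
    refine ⟨⟨⟨fun s => toSO3 (spinShift (s * c)),
      continuous_toSO3.comp (continuous_spinShift.comp (by fun_prop))⟩, ?_⟩, ?_⟩
    · change toSO3 (spinShift (((0 : I) : ℝ) * c)) = 1
      simp [spinShift_zero]
    · simp [toSO3_spinShift]
  refine exists_hom (r := sphereRotation) (hr := sphereRotation_zero)
    sphereRotation_add sphereRotation_two_pi τ hτ (by omega) rfl rfl ?_ ?_
  · change ((sphereA n * sphereB n * sphereA n : basedPaths SO3) : UniversalCoveringGroup SO3) =
      (sphereB n * sphereA n * sphereB n : basedPaths SO3)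
    refine (hD.coe_eq_coe_iff (A * B * A) (B * A * B) (by simp [hA0, hB0]) (by simp [hA0, hB0])
      (fun s => ?_) (fun s => ?_)).2 h1
    · simp [hA, hB]
    · simp [hA, hB]
  · change (((sphereA n * sphereB n * sphereA n) ^ 2 : basedPaths SO3) :
      UniversalCoveringGroup SO3) = _
    refine (hD.coe_eq_coe_iff ((A * B * A) ^ 2) F (by simp [hA0, hB0]) hF0
      (fun s => ?_) hF).2 (h2.trans hF1.symm)
    simp [hA, hB]

end Spin

/-! ### The binary polyhedral groups -/

section Binary

/-- The rotation `v ↦ q v q*` given by a unit quaternion. -/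
noncomputable def spin (q : unitary ℍ[ℝ]) (v : ℍ[ℝ]) : ℍ[ℝ] := q * v * star (q : ℍ[ℝ])

theorem spin_one (v : ℍ[ℝ]) : spin 1 v = v := by simp [spin]

theorem spin_mul (p q : unitary ℍ[ℝ]) (v : ℍ[ℝ]) : spin (p * q) v = spin p (spin q v) := by
  simp [spin, mul_assoc]

theorem spin_inv_spin (q : unitary ℍ[ℝ]) (v : ℍ[ℝ]) : spin q⁻¹ (spin q v) = v := by
  rw [← spin_mul, inv_mul_cancel, spin_one]

theorem spin_injective (q : unitary ℍ[ℝ]) : Function.Injective (spin q) :=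
  Function.LeftInverse.injective (spin_inv_spin q)

theorem spin_zpow_eq_self {q : unitary ℍ[ℝ]} {v : ℍ[ℝ]} (h : spin q v = v) (k : ℤ) :
    spin (q ^ k) v = v := by
  have h' : spin q⁻¹ v = v := by conv_lhs => rw [← h, spin_inv_spin]
  induction k with
  | zero => simp [spin_one]
  | succ k ih => rw [zpow_add_one, spin_mul, h, ih]
  | pred k ih => rw [zpow_sub_one, spin_mul, h', ih]

theorem commute_of_spin_eq_self {q : unitary ℍ[ℝ]} {v : ℍ[ℝ]} (h : spin q v = v) :
    (q : ℍ[ℝ]) * v = v * q := by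
  conv_rhs => rw [← h]
  rw [spin, mul_assoc, Unitary.coe_star_mul_self, mul_one]

/-- Rotations preserve inner products: the inner product of pure quaternions `v`, `w` is
`- re (v w)`. -/
theorem re_spin_mul_spin (q : unitary ℍ[ℝ]) (v w : ℍ[ℝ]) :
    (spin q v * spin q w).re = (v * w).re := by
  have h : spin q v * spin q w = q * (v * w) * star (q : ℍ[ℝ]) := by
    calc spin q v * spin q w = q * v * (star (q : ℍ[ℝ]) * q) * w * star (q : ℍ[ℝ]) := by
          simp only [spin, mul_assoc]
      _ = _ := by rw [Unitary.coe_star_mul_self, mul_one]; simp only [mul_assoc]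
  have hre : ∀ x y : ℍ[ℝ], (x * y).re = (y * x).re := fun x y => by
    rw [Quaternion.re_mul, Quaternion.re_mul]; ring
  rw [h, hre, ← mul_assoc, Unitary.coe_star_mul_self, one_mul]

theorem quat_mem_unitary {t x y z : ℝ} (h : t ^ 2 + x ^ 2 + y ^ 2 + z ^ 2 = 1) :
    quat t x y z ∈ unitary ℍ[ℝ] := by
  rw [Unitary.mem_iff, star_quat, quat_mul, quat_mul, ← quat_eq_one]
  constructor <;> congr 1 <;> linarith

theorem eq_one_or_eq_neg_one_of_im_eq_zero {q : unitary ℍ[ℝ]} (h1 : (q : ℍ[ℝ]).imI = 0)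
    (h2 : (q : ℍ[ℝ]).imJ = 0) (h3 : (q : ℍ[ℝ]).imK = 0) : q = 1 ∨ q = -1 := by
  have h4 : (q : ℍ[ℝ]) = quat (q : ℍ[ℝ]).re 0 0 0 := by
    apply Quaternion.ext <;> simp [h1, h2, h3]
  have h5 : star (q : ℍ[ℝ]) * q = 1 := Unitary.coe_star_mul_self q
  rw [h4, star_quat, quat_mul] at h5
  have h6 : (q : ℍ[ℝ]).re * (q : ℍ[ℝ]).re = 1 := by
    simpa using congrArg (fun x : ℍ[ℝ] => x.re) h5
  refine (mul_self_eq_one_iff.1 h6).imp ?_ ?_ <;> intro h7 <;> apply Subtype.ext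
  · rw [h4, h7]; rfl
  · rw [h4, h7, quat_eq_neg_one]; rfl

theorem mem_binarySymmetryGroup {V : Set ℍ[ℝ]} (hV : V.Finite) {q : unitary ℍ[ℝ]}
    (h : ∀ v ∈ V, spin q v ∈ V) : q ∈ binarySymmetryGroup V :=
  Set.eq_of_subset_of_ncard_le (Set.image_subset_iff.2 h)
    (Set.ncard_image_of_injective V (spin_injective q)).ge hV

theorem spin_mem_of_mem_binarySymmetryGroup {V : Set ℍ[ℝ]} {q : unitary ℍ[ℝ]}
    (hq : q ∈ binarySymmetryGroup V) {v : ℍ[ℝ]} (hv : v ∈ V) : spin q v ∈ V := by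
  have h : spin q '' V = V := hq
  rw [← h]
  exact Set.mem_image_of_mem _ hv

/-- Two unit quaternions `p`, `q` that satisfy the relations and rotate the vertices `V` of a
polyhedron generate the binary group of `V`, and this group is presented by the relations.

The homomorphism is injective since the elements that fix the vertex `B` are the powers of `b`, by
the double cosets of `b`. It is surjective since the group is transitive on the vertices and, for
the stabilizer of `B`, on the neighbours of `B`, while only `1` and `-1` fix both `B` and its
neighbour `A`. -/
theorem nonempty_mulEquiv_binarySymmetryGroup {n : ℕ} (hn : 2 ≤ n) {V : Set ℍ[ℝ]} (hV : V.Finite)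
    {A B : ℍ[ℝ]} (hA : A ∈ V) (hB : B ∈ V) {p q : unitary ℍ[ℝ]} (h1 : p * q * p = q * p * q)
    (h2 : (p * q * p) ^ 2 = q ^ n) (hqn : q ^ n = -1) (hp : ∀ v ∈ V, spin p v ∈ V)
    (hq : ∀ v ∈ V, spin q v ∈ V) (hqB : spin q B = B) (R : Set (DBar n))
    (hR : ∀ w, ∃ r ∈ R, ∃ k l : ℤ, w = DBar.b ^ k * r * DBar.b ^ l)
    (hRB : ∀ r ∈ R, spin (DBar.lift hn p q h1 h2 r) B = B → r = 1)
    (hord : orderOf q = 2 * n) (hb : ((DBar.a : DBar n) ^ n) ^ 2 = 1)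
    (htrans : ∀ O : Set ℍ[ℝ], B ∈ O → (∀ v ∈ O, spin p v ∈ O) → (∀ v ∈ O, spin q v ∈ O) → V ⊆ O)
    (hadj : ∀ v ∈ V, (v * B).re = (A * B).re → ∃ i : ℕ, spin (q ^ i) A = v)
    (hfix : ∀ g : ℍ[ℝ], g * A = A * g → g * B = B * g → g.imI = 0 ∧ g.imJ = 0 ∧ g.imK = 0) :
    Nonempty (DBar n ≃* binarySymmetryGroup V) := by
  set Ψ := DBar.lift hn p q h1 h2 with hΨ
  have hΨa : Ψ DBar.a = p := DBar.lift_a ..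
  have hΨb : Ψ DBar.b = q := DBar.lift_b ..
  have hrange : ∀ w, Ψ w ∈ binarySymmetryGroup V := by
    have h : (⊤ : Subgroup (DBar n)) ≤ (binarySymmetryGroup V).comap Ψ := by
      rw [← DBar.closure_eq_top, Subgroup.closure_le]
      rintro _ (rfl | rfl)
      · exact (congrArg (· ∈ binarySymmetryGroup V) hΨa).mpr (mem_binarySymmetryGroup hV hp)
      · exact (congrArg (· ∈ binarySymmetryGroup V) hΨb).mpr (mem_binarySymmetryGroup hV hq)
    exact fun w => h (Subgroup.mem_top w)
  have hinj : Function.Injective Ψ := by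
    rw [injective_iff_map_eq_one]
    intro w hw
    obtain ⟨r, hr, k, l, rfl⟩ := hR w
    have hr1 : r = 1 := by
      refine hRB r hr ?_
      have h3 : Ψ r = q ^ (-k) * q ^ (-l) := by
        rw [map_mul, map_mul, map_zpow, map_zpow, hΨb] at hw
        calc Ψ r = (q ^ k)⁻¹ * (q ^ k * Ψ r * q ^ l) * (q ^ l)⁻¹ := by simp [mul_assoc]
          _ = _ := by rw [hw, mul_one, zpow_neg, zpow_neg]
      rw [h3, spin_mul, spin_zpow_eq_self hqB, spin_zpow_eq_self hqB]
    subst hr1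
    rw [mul_one, ← zpow_add] at hw ⊢
    rw [map_zpow, hΨb] at hw
    rw [← orderOf_dvd_iff_zpow_eq_one, hord] at hw
    refine orderOf_dvd_iff_zpow_eq_one.1 (dvd_trans ?_ hw)
    rw [Int.natCast_dvd_natCast]
    refine orderOf_dvd_of_pow_eq_one ?_
    rw [mul_comm, pow_mul, ← DBar.a_pow_eq_b_pow hn, hb]
  refine ⟨MulEquiv.ofBijective (Ψ.codRestrict _ hrange) ⟨?_, ?_⟩⟩
  · exact (MonoidHom.injective_codRestrict ..).2 hinj
  rintro ⟨g, hg⟩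
  suffices h : ∃ w, Ψ w = g by
    obtain ⟨w, hw⟩ := h
    exact ⟨w, Subtype.ext hw⟩
  have hO : V ⊆ {v | ∃ w, spin (Ψ w) B = v} := by
    refine htrans _ ⟨1, by rw [map_one, spin_one]⟩ ?_ ?_
    · rintro _ ⟨w, rfl⟩
      exact ⟨DBar.a * w, by rw [map_mul, hΨa, spin_mul]⟩
    · rintro _ ⟨w, rfl⟩
      exact ⟨DBar.b * w, by rw [map_mul, hΨb, spin_mul]⟩
  obtain ⟨w, hw⟩ := hO (spin_mem_of_mem_binarySymmetryGroup hg hB)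
  -- `g₁` fixes `B`, and `g₂` fixes `A` also
  set g₁ := (Ψ w)⁻¹ * g with hg₁
  have hg₁V : g₁ ∈ binarySymmetryGroup V := mul_mem (inv_mem (hrange w)) hg
  have hg₁B : spin g₁ B = B := by rw [hg₁, spin_mul, ← hw, spin_inv_spin]
  obtain ⟨i, hi⟩ := hadj _ (spin_mem_of_mem_binarySymmetryGroup hg₁V hA) (by
    conv_lhs => rw [← hg₁B]
    exact re_spin_mul_spin g₁ A B)
  set g₂ := (q ^ i)⁻¹ * g₁ with hg₂
  have hg₂A : spin g₂ A = A := by rw [hg₂, spin_mul, ← hi, spin_inv_spin]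
  have hg₂B : spin g₂ B = B := by
    have h := spin_zpow_eq_self hqB (-i)
    rw [zpow_neg, zpow_natCast] at h
    rw [hg₂, spin_mul, hg₁B, h]
  obtain ⟨e1, e2, e3⟩ := hfix g₂ (commute_of_spin_eq_self hg₂A) (commute_of_spin_eq_self hg₂B)
  have h3 := eq_one_or_eq_neg_one_of_im_eq_zero e1 e2 e3
  have h4 : ∃ u, Ψ u = g₂ := by
    rcases h3 with h | h
    · exact ⟨1, by rw [h, map_one]⟩
    · exact ⟨DBar.b ^ n, by rw [h, map_pow, hΨb, hqn]⟩
  obtain ⟨u, hu⟩ := h4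
  refine ⟨w * DBar.b ^ i * u, ?_⟩
  rw [map_mul, map_mul, map_pow, hΨb, hu, hg₂, hg₁]
  simp [mul_assoc]

end Binary

section Binary

/-- The unit quaternion `t + x i + y j + z k`. -/
def unitQuat (t x y z : ℝ) (h : t ^ 2 + x ^ 2 + y ^ 2 + z ^ 2 = 1) : unitary ℍ[ℝ] :=
  ⟨quat t x y z, quat_mem_unitary h⟩

theorem spin_unitQuat {t x y z : ℝ} (h : t ^ 2 + x ^ 2 + y ^ 2 + z ^ 2 = 1) (u v w : ℝ) :
    spin (unitQuat t x y z h) (quat 0 u v w) = quat 0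
      ((t ^ 2 + x ^ 2 - y ^ 2 - z ^ 2) * u + 2 * (x * y - t * z) * v + 2 * (x * z + t * y) * w)
      (2 * (x * y + t * z) * u + (t ^ 2 - x ^ 2 + y ^ 2 - z ^ 2) * v + 2 * (y * z - t * x) * w)
      (2 * (x * z - t * y) * u + 2 * (y * z + t * x) * v +
        (t ^ 2 - x ^ 2 - y ^ 2 + z ^ 2) * w) := by
  change quat t x y z * quat 0 u v w * star (quat t x y z) = _
  rw [star_quat, quat_mul, quat_mul]
  congr 1 <;> ring

theorem quat_mul_comm_iff {t x y z u v w : ℝ} :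
    quat t x y z * quat 0 u v w = quat 0 u v w * quat t x y z ↔
      y * w = z * v ∧ z * u = x * w ∧ x * v = y * u := by
  rw [quat_mul, quat_mul, Quaternion.ext_iff]
  simp only [quat_re, quat_imI, quat_imJ, quat_imK]
  constructor
  · rintro ⟨-, h1, h2, h3⟩
    refine ⟨?_, ?_, ?_⟩ <;> linarith
  · rintro ⟨h1, h2, h3⟩
    refine ⟨?_, ?_, ?_, ?_⟩ <;> linarith

theorem neg_one_ne_one : (-1 : unitary ℍ[ℝ]) ≠ 1 := by
  intro h
  have h1 : (-1 : ℍ[ℝ]) = 1 := congrArg Subtype.val h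
  have h2 := congrArg (fun x : ℍ[ℝ] => x.re) h1
  norm_num at h2

theorem orderOf_of_pow_eq_neg_one {n : ℕ} {q : unitary ℍ[ℝ]} (h : q ^ n = -1)
    (hn : n.Prime ∧ n ≠ 2 ∧ q ^ 2 ≠ 1 ∨ ∃ k, n = 2 ^ k) : orderOf q = 2 * n := by
  have h1 : q ^ (2 * n) = 1 := by rw [mul_comm, pow_mul, h]; simp
  rcases hn with ⟨hp, hn2, h2⟩ | ⟨k, rfl⟩
  · refine orderOf_eq_of_pow_and_pow_div_prime (by have := hp.pos; omega) h1 fun p hp' hd => ?_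
    rcases (Nat.Prime.dvd_mul hp').1 hd with h3 | h3
    · rw [(Nat.prime_dvd_prime_iff_eq hp' Nat.prime_two).1 h3, Nat.mul_div_cancel_left _ two_pos, h]
      exact neg_one_ne_one
    · rw [(Nat.prime_dvd_prime_iff_eq hp' hp).1 h3, Nat.mul_div_cancel _ hp.pos]
      exact h2
  · rw [← pow_succ'] at h1 ⊢
    exact orderOf_eq_prime_pow (by rw [h]; exact neg_one_ne_one) h1

/-- The generators are the rotations by `2π / 3` about the vertices `(1, 1, 1)` and `(1, -1, -1)`.
-/
theorem nonempty_mulEquiv_binaryTetrahedral : Nonempty (DBar 3 ≃* BinaryTetrahedral) := by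
  let p := unitQuat (1 / 2) (1 / 2) (1 / 2) (1 / 2) (by norm_num)
  let q := unitQuat (1 / 2) (1 / 2) (-1 / 2) (-1 / 2) (by norm_num)
  have hp : ∀ x y z, spin p (quat 0 x y z) = quat 0 z x y := by
    intro x y z
    rw [spin_unitQuat]; congr 1 <;> ring
  have hq : ∀ x y z, spin q (quat 0 x y z) = quat 0 (-z) (-x) y := by
    intro x y z
    rw [spin_unitQuat]; congr 1 <;> ring
  have hqc : (q : ℍ[ℝ]) = quat (1 / 2) (1 / 2) (-1 / 2) (-1 / 2) := rfl
  have hq3 : q ^ 3 = -1 := by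
    apply Subtype.ext
    change (q : ℍ[ℝ]) ^ 3 = -1
    rw [hqc, pow_succ, sq, quat_mul, quat_mul, ← quat_eq_neg_one]
    norm_num
  have h1 : p * q * p = q * p * q := by
    apply Subtype.ext
    change quat _ _ _ _ * quat _ _ _ _ * quat _ _ _ _ = quat _ _ _ _ * quat _ _ _ _ * quat _ _ _ _
    rw [quat_mul, quat_mul, quat_mul, quat_mul]
    norm_num
  have h2 : (p * q * p) ^ 2 = q ^ 3 := by
    rw [hq3]
    apply Subtype.ext
    change (quat _ _ _ _ * quat _ _ _ _ * quat _ _ _ _) ^ 2 = -1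
    rw [quat_mul, quat_mul, sq, quat_mul, ← quat_eq_neg_one]
    norm_num
  have hV : tetrahedron = {quat 0 1 1 1, quat 0 1 (-1) (-1), quat 0 (-1) 1 (-1),
    quat 0 (-1) (-1) 1} := rfl
  refine nonempty_mulEquiv_binarySymmetryGroup (A := quat 0 1 1 1) (B := quat 0 1 (-1) (-1))
    (p := p) (q := q) (by norm_num) (by rw [hV]; exact Set.toFinite _) (by simp [hV])
    (by simp [hV]) h1 h2 hq3 ?_ ?_ (by simp [hq]) {1, DBar.a} DBar.exists_double_coset_three ?_
    (orderOf_of_pow_eq_neg_one hq3 (Or.inl ⟨by norm_num, by norm_num, ?_⟩))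
    DBar.a_pow_sq_three ?_ ?_ ?_
  · rw [hV]
    rintro v (rfl | rfl | rfl | rfl) <;> simp [hp]
  · rw [hV]
    rintro v (rfl | rfl | rfl | rfl) <;> simp [hq]
  · rintro r (rfl | rfl) h
    · rfl
    · rw [DBar.lift_a, hp] at h
      have := congrArg (fun x : ℍ[ℝ] => x.imI) h
      norm_num at this
  · intro h
    have h3 : q = -1 := by rw [← hq3, pow_succ, h, one_mul]
    have h4 : (q : ℍ[ℝ]).re = (-1 : ℍ[ℝ]).re := by rw [h3]; rfl
    rw [hqc] at h4
    norm_num at h4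
  · rw [hV]
    intro O hB hpO hqO
    have e1 := hpO _ hB
    have e2 := hpO _ e1
    have e3 := hqO _ e1
    simp only [hp, hq, neg_neg] at e1 e2 e3
    rintro v (rfl | rfl | rfl | rfl) <;> assumption
  · rw [hV]
    rintro v (rfl | rfl | rfl | rfl) h
    · exact ⟨0, by simp [spin_one]⟩
    · norm_num at h
    · exact ⟨2, by simp [sq, spin_mul, hq]⟩
    · exact ⟨1, by simp [hq]⟩
  · rintro ⟨t, x, y, z⟩ hA hB
    have hA := quat_mul_comm_iff.1 hA
    have hB := quat_mul_comm_iff.1 hB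
    refine ⟨?_, ?_, ?_⟩ <;> dsimp only <;> linarith

end Binary

section Binary

/-- The generators are the rotations by `π / 2` about the vertices `(0, 0, 1)` and `(1, 0, 0)`. -/
theorem nonempty_mulEquiv_binaryOctahedral : Nonempty (DBar 4 ≃* BinaryOctahedral) := by
  have hs : (√2 / 2) ^ 2 = (1 / 2 : ℝ) := by rw [div_pow, Real.sq_sqrt two_pos.le]; norm_num
  have hs' : (√2 / 2) * (√2 / 2) = (1 / 2 : ℝ) := by rw [← sq, hs]
  generalize √2 / 2 = s at hs hs'
  let p := unitQuat s 0 0 s (by rw [hs]; norm_num)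
  let q := unitQuat s s 0 0 (by rw [hs]; norm_num)
  have hp : ∀ x y z, spin p (quat 0 x y z) = quat 0 (-y) x z := by
    intro x y z
    rw [spin_unitQuat]; congr 1 <;> simp [hs, hs']
    ring
  have hq : ∀ x y z, spin q (quat 0 x y z) = quat 0 x (-z) y := by
    intro x y z
    rw [spin_unitQuat]; congr 1 <;> simp [hs, hs']
    ring
  have hqc : (q : ℍ[ℝ]) = quat s s 0 0 := rfl
  have hpc : (p : ℍ[ℝ]) = quat s 0 0 s := rfl
  have hq2 : (q : ℍ[ℝ]) ^ 2 = quat 0 1 0 0 := by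
    rw [hqc, sq, quat_mul]
    simp [hs']
    norm_num
  have hq4 : q ^ 4 = -1 := by
    apply Subtype.ext
    change (q : ℍ[ℝ]) ^ 4 = -1
    rw [show 4 = 2 * 2 from rfl, pow_mul, hq2, sq, quat_mul, ← quat_eq_neg_one]
    norm_num
  have e1 : (p * q * p : ℍ[ℝ]) = quat 0 s 0 s := by
    rw [hpc, hqc, quat_mul, quat_mul]
    congr 1 <;> first | ring1 | linear_combination 2 * s * hs'
  have e2 : (q * p * q : ℍ[ℝ]) = quat 0 s 0 s := by
    rw [hpc, hqc, quat_mul, quat_mul]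
    congr 1 <;> first | ring1 | linear_combination 2 * s * hs'
  have h1 : p * q * p = q * p * q := Subtype.ext (e1.trans e2.symm)
  have h2 : (p * q * p) ^ 2 = q ^ 4 := by
    rw [hq4]
    apply Subtype.ext
    change (p * q * p : ℍ[ℝ]) ^ 2 = -1
    rw [e1, sq, quat_mul, ← quat_eq_neg_one]
    simp [hs']
    norm_num
  have hV : octahedron = {quat 0 1 0 0, quat 0 (-1) 0 0, quat 0 0 1 0, quat 0 0 (-1) 0,
    quat 0 0 0 1, quat 0 0 0 (-1)} := rfl
  refine nonempty_mulEquiv_binarySymmetryGroup (A := quat 0 0 0 1) (B := quat 0 1 0 0)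
    (p := p) (q := q) (by norm_num) (by rw [hV]; exact Set.toFinite _) (by simp [hV])
    (by simp [hV]) h1 h2 hq4 ?_ ?_ (by simp [hq]) {1, DBar.a, DBar.a ^ 2}
    DBar.exists_double_coset_four ?_ (orderOf_of_pow_eq_neg_one hq4 (Or.inr ⟨2, rfl⟩))
    DBar.a_pow_sq_four ?_ ?_ ?_
  · rw [hV]
    rintro v (rfl | rfl | rfl | rfl | rfl | rfl) <;> simp [hp]
  · rw [hV]
    rintro v (rfl | rfl | rfl | rfl | rfl | rfl) <;> simp [hq]
  · rintro r (rfl | rfl | rfl) h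
    · rfl
    · rw [DBar.lift_a, hp] at h
      have := congrArg (fun x : ℍ[ℝ] => x.imI) h
      norm_num at this
    · rw [map_pow, DBar.lift_a, sq, spin_mul, hp, hp] at h
      have := congrArg (fun x : ℍ[ℝ] => x.imI) h
      norm_num at this
  · rw [hV]
    intro O hB hpO hqO
    have e1 := hpO _ hB
    have e2 := hpO _ e1
    have e3 := hpO _ e2
    have e4 := hqO _ e1
    have e5 := hqO _ e3
    simp only [hp, hq, neg_zero] at e1 e2 e3 e4 e5
    rintro v (rfl | rfl | rfl | rfl | rfl | rfl) <;> assumption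
  · rw [hV]
    rintro v (rfl | rfl | rfl | rfl | rfl | rfl) h
    · norm_num at h
    · norm_num at h
    · exact ⟨3, by simp [pow_succ, spin_mul, hq]⟩
    · exact ⟨1, by simp [hq]⟩
    · exact ⟨0, by simp [spin_one]⟩
    · exact ⟨2, by simp [sq, spin_mul, hq]⟩
  · rintro ⟨t, x, y, z⟩ hA hB
    have hA := quat_mul_comm_iff.1 hA
    have hB := quat_mul_comm_iff.1 hB
    refine ⟨?_, ?_, ?_⟩ <;> dsimp only <;> linarith

/-- The vertices of the icosahedron, up to sign. -/
theorem mem_icosahedron_iff {v : ℍ[ℝ]} : v ∈ icosahedron ↔ ∃ s : ℝ, (s = 1 ∨ s = -1) ∧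
    (v = quat 0 0 s (s * Real.goldenRatio) ∨ v = quat 0 0 (-s) (s * Real.goldenRatio) ∨
      v = quat 0 s (s * Real.goldenRatio) 0 ∨ v = quat 0 (-s) (s * Real.goldenRatio) 0 ∨
      v = quat 0 (s * Real.goldenRatio) 0 s ∨ v = quat 0 (s * Real.goldenRatio) 0 (-s)) := by
  change (∃ s ∈ ({1, -1} : Set ℝ), ∃ t ∈ ({1, -1} : Set ℝ), v = quat 0 0 s (t * Real.goldenRatio) ∨
    v = quat 0 s (t * Real.goldenRatio) 0 ∨ v = quat 0 (t * Real.goldenRatio) 0 s) ↔ _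
  simp only [Set.mem_insert_iff, Set.mem_singleton_iff, exists_eq_or_imp, exists_eq_left, neg_neg]
  tauto

/-- The golden ratio is written `f`; the rotations by `2π / 5` are about the adjacent vertices
`(0, 1, f)` and `(0, -1, f)`. -/
theorem nonempty_mulEquiv_binaryIcosahedral : Nonempty (DBar 5 ≃* BinaryIcosahedral) := by
  have hV := @mem_icosahedron_iff
  have hf : Real.goldenRatio ^ 2 = Real.goldenRatio + 1 := Real.goldenRatio_sq
  have hf1 : 1 < Real.goldenRatio := Real.one_lt_goldenRatio
  generalize Real.goldenRatio = f at hV hf hf1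
  have hfin : icosahedron.Finite := by
    refine Set.Finite.subset (Set.Finite.biUnion (Set.toFinite {(1 : ℝ), -1}) fun s _ =>
      Set.toFinite {quat 0 0 s (s * f), quat 0 0 (-s) (s * f), quat 0 s (s * f) 0,
        quat 0 (-s) (s * f) 0, quat 0 (s * f) 0 s, quat 0 (s * f) 0 (-s)}) fun v hv => ?_
    obtain ⟨s, hs, h⟩ := hV.1 hv
    exact Set.mem_biUnion hs h
  let p := unitQuat (f / 2) 0 ((f - 1) / 2) (1 / 2) (by linear_combination hf / 2)
  let q := unitQuat (f / 2) 0 ((1 - f) / 2) (1 / 2) (by linear_combination hf / 2)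
  have hp : ∀ x y z, spin p (quat 0 x y z) = quat 0 (((f - 1) * x - f * y + z) / 2)
      ((f * x + y + (f - 1) * z) / 2) ((-x + (f - 1) * y + f * z) / 2) := by
    intro x y z
    rw [spin_unitQuat]; congr 1
    · linear_combination z * hf / 2
    · linear_combination y * hf / 2
    · linear_combination -x * hf / 2
  have hq : ∀ x y z, spin q (quat 0 x y z) = quat 0 (((f - 1) * x - f * y - z) / 2)
      ((f * x + y - (f - 1) * z) / 2) ((x - (f - 1) * y + f * z) / 2) := by
    intro x y z
    rw [spin_unitQuat]; congr 1
    · linear_combination -z * hf / 2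
    · linear_combination y * hf / 2
    · linear_combination x * hf / 2
  -- the action of the generators on the vertices
  let v₀ : ℝ → ℍ[ℝ] := fun s => quat 0 0 s (s * f)
  let v₁ : ℝ → ℍ[ℝ] := fun s => quat 0 0 (-s) (s * f)
  let v₂ : ℝ → ℍ[ℝ] := fun s => quat 0 s (s * f) 0
  let v₃ : ℝ → ℍ[ℝ] := fun s => quat 0 (-s) (s * f) 0
  let v₄ : ℝ → ℍ[ℝ] := fun s => quat 0 (s * f) 0 s
  let v₅ : ℝ → ℍ[ℝ] := fun s => quat 0 (s * f) 0 (-s)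
  replace hV : ∀ {v}, v ∈ icosahedron ↔ ∃ s : ℝ, (s = 1 ∨ s = -1) ∧
      (v = v₀ s ∨ v = v₁ s ∨ v = v₂ s ∨ v = v₃ s ∨ v = v₄ s ∨ v = v₅ s) := hV
  have p0 : ∀ s, spin p (v₀ s) = v₀ s := fun s => by
    refine (hp _ _ _).trans ?_
    congr 1 <;> first | ring1 | linear_combination s * hf / 2
  have p1 : ∀ s, spin p (v₁ s) = v₄ s := fun s => by
    refine (hp _ _ _).trans ?_
    congr 1 <;> first | ring1 | linear_combination s * hf / 2
  have p2 : ∀ s, spin p (v₂ s) = v₃ s := fun s => by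
    refine (hp _ _ _).trans ?_
    congr 1 <;> first | ring1 | linear_combination s * hf / 2 | linear_combination -s * hf / 2
  have p3 : ∀ s, spin p (v₃ s) = v₅ (-s) := fun s => by
    refine (hp _ _ _).trans ?_
    congr 1 <;> first | ring1 | linear_combination s * hf / 2 | linear_combination -s * hf / 2
  have p4 : ∀ s, spin p (v₄ s) = v₂ s := fun s => by
    refine (hp _ _ _).trans ?_
    congr 1 <;> first | ring1 | linear_combination s * hf / 2
  have p5 : ∀ s, spin p (v₅ s) = v₁ (-s) := fun s => by
    refine (hp _ _ _).trans ?_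
    congr 1 <;> first | ring1 | linear_combination s * hf / 2
  have q0 : ∀ s, spin q (v₀ s) = v₅ (-s) := fun s => by
    refine (hq _ _ _).trans ?_
    congr 1 <;> first | ring1 | linear_combination s * hf / 2 | linear_combination -s * hf / 2
  have q1 : ∀ s, spin q (v₁ s) = v₁ s := fun s => by
    refine (hq _ _ _).trans ?_
    congr 1 <;> first | ring1 | linear_combination s * hf / 2 | linear_combination -s * hf / 2
  have q2 : ∀ s, spin q (v₂ s) = v₃ s := fun s => by
    refine (hq _ _ _).trans ?_
    congr 1 <;> first | ring1 | linear_combination s * hf / 2 | linear_combination -s * hf / 2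
  have q3 : ∀ s, spin q (v₃ s) = v₄ (-s) := fun s => by
    refine (hq _ _ _).trans ?_
    congr 1 <;> first | ring1 | linear_combination s * hf / 2 | linear_combination -s * hf / 2
  have q4 : ∀ s, spin q (v₄ s) = v₀ s := fun s => by
    refine (hq _ _ _).trans ?_
    congr 1 <;> first | ring1 | linear_combination s * hf / 2
  have q5 : ∀ s, spin q (v₅ s) = v₂ s := fun s => by
    refine (hq _ _ _).trans ?_
    congr 1 <;> first | ring1 | linear_combination s * hf / 2
  have hpc : (p : ℍ[ℝ]) = quat (f / 2) 0 ((f - 1) / 2) (1 / 2) := rfl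
  have hqc : (q : ℍ[ℝ]) = quat (f / 2) 0 ((1 - f) / 2) (1 / 2) := rfl
  have hq2 : (q : ℍ[ℝ]) ^ 2 = quat ((f - 1) / 2) 0 (-1 / 2) (f / 2) := by
    rw [hqc, sq, quat_mul]
    congr 1
    · linear_combination hf / 2 - hf / 2
    · ring
    · linear_combination -hf / 2
    · ring
  have hq5 : q ^ 5 = -1 := by
    apply Subtype.ext
    change (q : ℍ[ℝ]) ^ 5 = -1
    have hq4 : (q : ℍ[ℝ]) ^ 4 = quat (-f / 2) 0 ((1 - f) / 2) (1 / 2) := by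
      rw [show 4 = 2 * 2 from rfl, pow_mul, hq2, sq, quat_mul]
      congr 1
      · ring
      · ring
      · ring
      · linear_combination hf / 2
    rw [pow_succ, hq4, hqc, quat_mul, ← quat_eq_neg_one]
    congr 1
    · linear_combination -hf / 2
    · ring
    · ring
    · ring
  have e1 : (p * q * p : ℍ[ℝ]) = quat 0 0 0 1 := by
    have e : (p * q : ℍ[ℝ]) = quat (1 / 2) ((f - 1) / 2) 0 (f / 2) := by
      rw [hpc, hqc, quat_mul]
      congr 1
      · linear_combination hf / 2
      · ring
      · ring
      · ring
    rw [e, hpc, quat_mul]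
    congr 1
    · ring
    · ring
    · ring
    · linear_combination hf / 2
  have e2 : (q * p * q : ℍ[ℝ]) = quat 0 0 0 1 := by
    have e : (q * p : ℍ[ℝ]) = quat (1 / 2) ((1 - f) / 2) 0 (f / 2) := by
      rw [hpc, hqc, quat_mul]
      congr 1
      · linear_combination hf / 2
      · ring
      · ring
      · ring
    rw [e, hqc, quat_mul]
    congr 1
    · ring
    · ring
    · ring
    · linear_combination hf / 2
  have h1 : p * q * p = q * p * q := Subtype.ext (e1.trans e2.symm)
  have h2 : (p * q * p) ^ 2 = q ^ 5 := by
    rw [hq5]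
    apply Subtype.ext
    change (p * q * p : ℍ[ℝ]) ^ 2 = -1
    rw [e1, sq, quat_mul, ← quat_eq_neg_one]
    norm_num
  have hneg : ∀ s : ℝ, s = 1 ∨ s = -1 → -s = 1 ∨ -s = -1 := by
    rintro s (rfl | rfl) <;> norm_num
  have hA : v₀ 1 ∈ icosahedron := hV.2 ⟨1, by simp [v₀]⟩
  have hB : v₁ 1 ∈ icosahedron := hV.2 ⟨1, by simp [v₁]⟩
  refine nonempty_mulEquiv_binarySymmetryGroup (A := v₀ 1) (B := v₁ 1)
    (p := p) (q := q) (by norm_num) hfin hA hB h1 h2 hq5 ?_ ?_ (q1 1)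
    {1, DBar.a, DBar.a ^ 2, DBar.a * DBar.b⁻¹ * DBar.a ^ 2}
    DBar.exists_double_coset_five ?_
    (orderOf_of_pow_eq_neg_one hq5 (Or.inl ⟨by norm_num, by norm_num, ?_⟩))
    DBar.a_pow_sq_five ?_ ?_ ?_
  · intro v hv
    obtain ⟨s, hs, rfl | rfl | rfl | rfl | rfl | rfl⟩ := hV.1 hv
    · exact hV.2 ⟨s, hs, by simp only [p0, true_or]⟩
    · exact hV.2 ⟨s, hs, by simp only [p1, true_or, or_true]⟩
    · exact hV.2 ⟨s, hs, by simp only [p2, true_or, or_true]⟩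
    · exact hV.2 ⟨-s, hneg s hs, by simp only [p3, or_true]⟩
    · exact hV.2 ⟨s, hs, by simp only [p4, true_or, or_true]⟩
    · exact hV.2 ⟨-s, hneg s hs, by simp only [p5, true_or, or_true]⟩
  · intro v hv
    obtain ⟨s, hs, rfl | rfl | rfl | rfl | rfl | rfl⟩ := hV.1 hv
    · exact hV.2 ⟨-s, hneg s hs, by simp only [q0, or_true]⟩
    · exact hV.2 ⟨s, hs, by simp only [q1, true_or, or_true]⟩
    · exact hV.2 ⟨s, hs, by simp only [q2, true_or, or_true]⟩
    · exact hV.2 ⟨-s, hneg s hs, by simp only [q3, true_or, or_true]⟩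
    · exact hV.2 ⟨s, hs, by simp only [q4, true_or]⟩
    · exact hV.2 ⟨s, hs, by simp only [q5, true_or, or_true]⟩
  · rintro r (rfl | rfl | rfl | rfl) h
    · rfl
    · rw [DBar.lift_a, p1] at h
      have := congrArg (fun x : ℍ[ℝ] => x.imI) h
      simp [v₁, v₄] at this
      linarith
    · rw [map_pow, DBar.lift_a, sq, spin_mul, p1, p4] at h
      have := congrArg (fun x : ℍ[ℝ] => x.imI) h
      simp [v₁, v₂] at this
    · rw [map_mul, map_mul, map_inv, map_pow, DBar.lift_a, DBar.lift_b, sq, spin_mul, spin_mul,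
        spin_mul, p1, p4, ← q5, spin_inv_spin, p5] at h
      have := congrArg (fun x : ℍ[ℝ] => x.imJ) h
      norm_num [v₁] at this
  · intro h
    have h3 : (q : ℍ[ℝ]) ^ 2 = 1 := congrArg Subtype.val h
    rw [hq2] at h3
    have h4 := congrArg (fun x : ℍ[ℝ] => x.imJ) h3
    norm_num at h4
  · intro O hB hpO hqO
    have e1 : v₄ 1 ∈ O := p1 1 ▸ hpO _ hB
    have e2 : v₂ 1 ∈ O := p4 1 ▸ hpO _ e1
    have e3 : v₃ 1 ∈ O := p2 1 ▸ hpO _ e2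
    have e4 : v₅ (-1) ∈ O := p3 1 ▸ hpO _ e3
    have e5 : v₀ 1 ∈ O := q4 1 ▸ hqO _ e1
    have e6 : v₄ (-1) ∈ O := q3 1 ▸ hqO _ e3
    have e7 : v₂ (-1) ∈ O := p4 (-1) ▸ hpO _ e6
    have e8 : v₃ (-1) ∈ O := p2 (-1) ▸ hpO _ e7
    have e9 : v₅ 1 ∈ O := neg_neg (1 : ℝ) ▸ p3 (-1) ▸ hpO _ e8
    have e10 : v₀ (-1) ∈ O := q4 (-1) ▸ hqO _ e6
    have e11 : v₁ (-1) ∈ O := p5 1 ▸ hpO _ e9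
    intro v hv
    obtain ⟨s, rfl | rfl, rfl | rfl | rfl | rfl | rfl | rfl⟩ := hV.1 hv <;> assumption
  · have i1 : spin q (v₀ 1) = v₅ (-1) := q0 1
    have i2 : spin q (v₅ (-1)) = v₂ (-1) := q5 (-1)
    have i3 : spin q (v₂ (-1)) = v₃ (-1) := q2 (-1)
    have i4 : spin q (v₃ (-1)) = v₄ 1 := by rw [q3, neg_neg]
    intro v hv h
    obtain ⟨s, hs, h'⟩ := hV.1 hv
    rcases hs with rfl | rfl <;> rcases h' with rfl | rfl | rfl | rfl | rfl | rfl
    · exact ⟨0, by rw [pow_zero, spin_one]⟩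
    · simp [v₀, v₁] at h
      nlinarith
    · simp [v₀, v₁, v₂] at h
      nlinarith
    · simp [v₀, v₁, v₃] at h
      nlinarith
    · exact ⟨4, by simp only [pow_succ, pow_zero, one_mul, spin_mul, i1, i2, i3, i4]⟩
    · simp [v₀, v₁, v₅] at h
      nlinarith
    · simp [v₀, v₁] at h
      nlinarith
    · simp [v₀, v₁] at h
      nlinarith
    · exact ⟨2, by simp only [pow_succ, pow_zero, one_mul, spin_mul, i1, i2]⟩
    · exact ⟨3, by simp only [pow_succ, pow_zero, one_mul, spin_mul, i1, i2, i3]⟩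
    · simp [v₀, v₁, v₄] at h
      nlinarith
    · exact ⟨1, by simp only [pow_one, i1]⟩
  · rintro ⟨t, x, y, z⟩ hA hB
    obtain ⟨hA1, hA2, hA3⟩ := quat_mul_comm_iff.1 hA
    obtain ⟨hB1, hB2, hB3⟩ := quat_mul_comm_iff.1 hB
    have hf0 : f ≠ 0 := by linarith
    have hx : x = 0 := by linarith
    have hz : z = 0 := by linarith
    have hy : y = 0 := by
      rw [hz] at hA1
      simpa [hf0] using hA1
    exact ⟨hx, hy, hz⟩

end Binary

/-! ### Infinite Von Dyck groups, and the extensions -/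

section Extension

/-- The homomorphism from `ℤ / m` onto a cyclic subgroup of order `m` (infinite, if `m = 0`). -/
theorem exists_hom_zmod {G : Type*} [Group G] {z : G} {m : ℕ}
    (h : ∀ k : ℤ, z ^ k = 1 ↔ (m : ℤ) ∣ k) :
    ∃ f : Multiplicative (ZMod m) →* G, Function.Injective f ∧
      f.range = Subgroup.zpowers z ∧ f (Multiplicative.ofAdd 1) = z := by
  have hm : zmultiplesHom (Additive G) (Additive.ofMul z) m = 0 := by
    change Additive.ofMul (z ^ (m : ℤ)) = 0
    rw [(h m).2 dvd_rfl]; rfl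
  let f : Multiplicative (ZMod m) →* G :=
    AddMonoidHom.toMultiplicativeLeft (ZMod.lift m ⟨_, hm⟩)
  have hf : ∀ k : ℤ, f (Multiplicative.ofAdd (k : ZMod m)) = z ^ k := fun k =>
    congrArg Additive.toMul (ZMod.lift_coe m ⟨_, hm⟩ k)
  refine ⟨f, ?_, ?_, ?_⟩
  · rw [injective_iff_map_eq_one]
    intro x hx
    obtain ⟨k, hk⟩ := ZMod.intCast_surjective (Multiplicative.toAdd x)
    have hx' : x = Multiplicative.ofAdd (k : ZMod m) := by rw [hk]; rfl
    rw [hx', hf, h, ← ZMod.intCast_zmod_eq_zero_iff_dvd] at hx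
    rw [hx', hx]; rfl
  · ext g
    constructor
    · rintro ⟨x, rfl⟩
      obtain ⟨k, hk⟩ := ZMod.intCast_surjective (Multiplicative.toAdd x)
      refine ⟨k, (hf k).symm.trans ?_⟩
      rw [hk]; rfl
    · rintro ⟨k, rfl⟩
      exact ⟨_, hf k⟩
  · have := hf 1
    rwa [zpow_one, Int.cast_one] at this

/-- The central extension with kernel `ℤ / m`, if `a ^ n` has the order `m`. -/
theorem exists_groupExtension {n : ℕ} (hn : 2 ≤ n) {m : ℕ}
    (h : ∀ k : ℤ, (DBar.a ^ n : DBar n) ^ k = 1 ↔ (m : ℤ) ∣ k) :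
    ∃ S : GroupExtension (Multiplicative (ZMod m)) (DBar n) (VonDyck 2 3 n),
      S.rightHom = projection hn ∧ S.inl (Multiplicative.ofAdd 1) = DBar.a ^ n := by
  obtain ⟨f, hf, hr, h1⟩ := exists_hom_zmod h
  exact ⟨⟨f, projection hn, hf, by rw [hr, ker_projection], projection_surjective hn⟩, rfl, h1⟩

theorem pow_eq_one_of_commute {H : Type*} [Group H] {s t : H} (h : Commute s t) {n : ℕ}
    (hn : 6 ≤ n) (h1 : s * t * s = t * s * t) (h2 : (s * t * s) ^ 2 = t ^ n) :
    s ^ (n - 6) = 1 := by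
  have hst : s = t := by
    rw [h.eq, mul_assoc, mul_assoc, mul_right_inj, mul_right_inj] at h1
    exact h1
  subst hst
  have e : s ^ (n - 6) * s ^ 6 = 1 * s ^ 6 := by
    rw [one_mul, ← pow_add, Nat.sub_add_cancel hn, ← h2]
    simp only [pow_succ, pow_zero, one_mul, mul_assoc]
  exact mul_right_cancel e

/-- The transfer to the centre is a power map. If `D(2, 3, n)` is finite, then it is available, and
it sends `a` and `b` to commuting elements `t` with `t ^ 6 = t ^ n`; hence `a ^ n` has finite order
unless `n = 6`. -/
theorem infinite_vonDyck {n : ℕ} (hn : 7 ≤ n)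
    (h : ∀ k : ℤ, (DBar.a ^ n : DBar n) ^ k = 1 → k = 0) : Infinite (VonDyck 2 3 n) := by
  have hn2 : 2 ≤ n := by omega
  by_contra hfin
  rw [not_infinite_iff_finite] at hfin
  have hker : (projection hn2).ker.FiniteIndex := by
    refine ⟨?_⟩
    rw [Subgroup.index_ker]
    exact Nat.card_pos.ne'
  have hcenter : (Subgroup.center (DBar n)).FiniteIndex :=
    Subgroup.finiteIndex_of_le (ker_projection_le_center hn2)
  set t := MonoidHom.transferCenterPow (DBar n) with ht
  obtain ⟨h1, h2⟩ := DBar.relations hn2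
  have e1 := congrArg t h1
  have e2 := congrArg t h2
  simp only [map_mul, map_pow] at e1 e2
  have e3 : t DBar.a ^ (n - 6) = 1 := pow_eq_one_of_commute
    (Subtype.ext (Subgroup.mem_center_iff.1 (t DBar.b).2 _)) (by omega) e1 e2
  have e4 : (DBar.a : DBar n) ^ ((Subgroup.center (DBar n)).index * (n - 6)) = 1 := by
    rw [pow_mul]
    exact congrArg Subtype.val e3
  have e5 := h ((Subgroup.center (DBar n)).index * (n - 6) : ℕ) (by
    rw [zpow_natCast, ← pow_mul, mul_comm, pow_mul, e4, one_pow])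
  have e6 : (Subgroup.center (DBar n)).index ≠ 0 := Subgroup.FiniteIndex.index_ne_zero
  have e7 : n - 6 ≠ 0 := by omega
  exact mul_ne_zero e6 e7 (by exact_mod_cast e5)

theorem euclideanMk_pow (v : ℂ) (k : ℕ) : euclideanMk 1 v ^ k = euclideanMk 1 (k * v) := by
  induction k with
  | zero => rw [pow_zero, Nat.cast_zero, zero_mul, euclideanMk_one]
  | succ k ih =>
    rw [pow_succ, ih, euclideanMk_mul]
    congr 1
    · rw [one_mul]
    · push_cast; ring

/-- The rotations about two points by the same angle differ by a translation, which has infinite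
order. -/
theorem infinite_vonDyck_six {π : DBar 6 →* VonDyck 2 3 6}
    (h : IsRestrictionOfUniversalCovering π (euclideanA 6) (euclideanB 6)) :
    Infinite (VonDyck 2 3 6) := by
  obtain ⟨ρ, Φ, ha, hb, hρ, -⟩ := h
  set u := Circle.exp (((1 : I) : ℝ) * (2 * Real.pi / (6 : ℕ))) with hu
  have hu1 : (u : ℂ) - 1 ≠ 0 := by
    have h1 : ((1 : I) : ℝ) * (2 * Real.pi / (6 : ℕ)) = Real.pi / 3 := by
      push_cast; ring
    rw [hu, h1, sub_ne_zero, Circle.coe_exp]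
    intro h2
    have h3 := congrArg Complex.re h2
    rw [Complex.exp_ofReal_mul_I_re, Real.cos_pi_div_three] at h3
    norm_num at h3
  have hA : coveringMap _ (Φ DBar.a) = euclideanMk u 0 := by
    rw [ha, coveringMap_coe]
    change 1 * euclideanMk u 0 * 1⁻¹ = _
    rw [one_mul, inv_one, mul_one]
  have hB : coveringMap _ (Φ DBar.b) = euclideanMk u (1 - u) := by
    rw [hb, coveringMap_coe]
    change euclideanMk 1 1 * euclideanMk u 0 * (euclideanMk 1 1)⁻¹ = _
    rw [mul_inv_eq_iff_eq_mul, euclideanMk_mul, euclideanMk_mul]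
    simp
  have hAB : ρ (π (DBar.a * DBar.b⁻¹)) = euclideanMk 1 (u - 1) := by
    rw [← hρ, map_mul, map_mul, map_inv, map_inv, hA, hB, mul_inv_eq_iff_eq_mul, euclideanMk_mul]
    congr 1
    · rw [one_mul]
    · simp
  by_contra hfin
  rw [not_infinite_iff_finite] at hfin
  have h1 : π (DBar.a * DBar.b⁻¹) ^ Nat.card (VonDyck 2 3 6) = 1 := pow_card_eq_one'
  have h2 := congrArg ρ h1
  rw [map_pow, hAB, euclideanMk_pow, map_one] at h2
  have h3 : (Nat.card (VonDyck 2 3 6) : ℂ) * (u - 1) = 0 := by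
    rw [← euclideanMk_one] at h2
    exact congrArg euclideanOrigin h2
  exact mul_ne_zero (Nat.cast_ne_zero.2 Nat.card_pos.ne') hu1 h3

theorem DBar.a_pow_sq {n : ℕ} (hn : 3 ≤ n) (hn' : n ≤ 5) : ((DBar.a : DBar n) ^ n) ^ 2 = 1 := by
  interval_cases n
  · exact a_pow_sq_three
  · exact a_pow_sq_four
  · exact a_pow_sq_five

/-- The full rotation has order two in the universal covering group of `SO(3)`, so the order of
`a ^ n` is at least two, and it is at most two by the relations. -/
theorem spherical_extension {n : ℕ} (hn : 3 ≤ n) (hn' : n ≤ 5) :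
    (∀ k : ℤ, (DBar.a ^ n : DBar n) ^ k = 1 ↔ ((2 : ℕ) : ℤ) ∣ k) ∧
    IsRestrictionOfUniversalCovering (projection (by omega : 2 ≤ n)) (sphereA n) (sphereB n) := by
  obtain ⟨Φ, ha, hb, hΦ⟩ := exists_hom_sphere hn hn'
  have h2 : ∀ k : ℤ, Even k → (DBar.a ^ n : DBar n) ^ k = 1 := by
    rintro k ⟨l, rfl⟩
    rw [← two_mul, zpow_mul, zpow_ofNat, DBar.a_pow_sq hn hn', one_zpow]
  refine ⟨fun k => ?_, isRestriction_of_hom _ sphereRotation_two_pi sphere_loops.1 Φ ha hb hΦ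
    fun k hk => h2 k (sphere_loops.2 k hk)⟩
  rw [Nat.cast_ofNat, ← even_iff_two_dvd]
  refine ⟨fun hk => sphere_loops.2 k ?_, h2 k⟩
  rw [← hΦ, ← map_zpow, hk, map_one]

/-- In the Euclidean and the hyperbolic cases, the full rotation, hence `a ^ n`, has infinite
order. -/
theorem infinite_order_and_isRestriction {G : Type*} [Group G] [TopologicalSpace G]
    [IsTopologicalGroup G] {r : C(ℝ, G)} {hr : r 0 = 1} {n : ℕ} (hn : 2 ≤ n)
    (h2π : r (2 * Real.pi) = 1) {α β : basedPaths G}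
    (hloops : (∀ g, coveringMap G g = 1 → g ∈ Subgroup.zpowers (fullRotation r hr)) ∧
      ∀ k : ℤ, fullRotation r hr ^ k = 1 → k = 0)
    (hΦ : ∃ Φ : DBar n →* UniversalCoveringGroup G, Φ DBar.a = α ∧ Φ DBar.b = β ∧
      Φ (DBar.a ^ n) = fullRotation r hr) :
    (∀ k : ℤ, (DBar.a ^ n : DBar n) ^ k = 1 → k = 0) ∧
    IsRestrictionOfUniversalCovering (projection hn) α β := by
  obtain ⟨Φ, ha, hb, hΦ⟩ := hΦ
  refine ⟨fun k hk => hloops.2 k ?_, isRestriction_of_hom hn h2π hloops.1 Φ ha hb hΦ fun k hk => ?_⟩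
  · rw [← hΦ, ← map_zpow, hk, map_one]
  · rw [hloops.2 k hk, zpow_zero]

end Extension

end VonDyckCover

theorem proposition2 (n : ℕ) (hn : 3 ≤ n) :
    ∃ π : VonDyckCover.DBar n →* VonDyckCover.VonDyck 2 3 n,
      π VonDyckCover.DBar.a = VonDyckCover.VonDyck.y ^ 2 * VonDyckCover.VonDyck.x ∧
      π VonDyckCover.DBar.b = VonDyckCover.VonDyck.x * VonDyckCover.VonDyck.y ^ 2 ∧
      -- a central extension by the cyclic group generated by `a ^ n = b ^ n`
      Function.Surjective π ∧
      (VonDyckCover.DBar.a : VonDyckCover.DBar n) ^ n = VonDyckCover.DBar.b ^ n ∧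
      π.ker = Subgroup.zpowers (VonDyckCover.DBar.a ^ n) ∧
      π.ker ≤ Subgroup.center (VonDyckCover.DBar n) ∧
      -- the spherical cases
      (n ≤ 5 → ∃ S : GroupExtension (Multiplicative (ZMod 2)) (VonDyckCover.DBar n)
          (VonDyckCover.VonDyck 2 3 n),
        S.rightHom = π ∧ S.inl (Multiplicative.ofAdd 1) = VonDyckCover.DBar.a ^ n) ∧
      (n = 3 → Nonempty (VonDyckCover.DBar n ≃* VonDyckCover.BinaryTetrahedral)) ∧
      (n = 4 → Nonempty (VonDyckCover.DBar n ≃* VonDyckCover.BinaryOctahedral)) ∧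
      (n = 5 → Nonempty (VonDyckCover.DBar n ≃* VonDyckCover.BinaryIcosahedral)) ∧
      -- the Euclidean and the hyperbolic cases
      (6 ≤ n → Infinite (VonDyckCover.VonDyck 2 3 n) ∧
        ∃ S : GroupExtension (Multiplicative ℤ) (VonDyckCover.DBar n)
          (VonDyckCover.VonDyck 2 3 n),
        S.rightHom = π ∧ S.inl (Multiplicative.ofAdd 1) = VonDyckCover.DBar.a ^ n) ∧
      -- universality: the extension is the restriction of the universal covering
      (n ≤ 5 → VonDyckCover.IsRestrictionOfUniversalCovering π
        (VonDyckCover.sphereA n) (VonDyckCover.sphereB n)) ∧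
      (n = 6 → VonDyckCover.IsRestrictionOfUniversalCovering π
        (VonDyckCover.euclideanA n) (VonDyckCover.euclideanB n)) ∧
      (7 ≤ n → VonDyckCover.IsRestrictionOfUniversalCovering π
        (VonDyckCover.hyperbolicA n) (VonDyckCover.hyperbolicB n)) := by
  have hn2 : 2 ≤ n := by omega
  have hsph := fun h : n ≤ 5 => VonDyckCover.spherical_extension hn h
  have heuc : n = 6 → (∀ k : ℤ, (VonDyckCover.DBar.a ^ n : VonDyckCover.DBar n) ^ k = 1 → k = 0) ∧
      VonDyckCover.IsRestrictionOfUniversalCovering (VonDyckCover.projection hn2)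
        (VonDyckCover.euclideanA n) (VonDyckCover.euclideanB n) := by
    rintro rfl
    exact VonDyckCover.infinite_order_and_isRestriction hn2 VonDyckCover.euclideanRotation_two_pi
      VonDyckCover.euclidean_loops VonDyckCover.exists_hom_euclidean
  have hhyp := fun h : 7 ≤ n => VonDyckCover.infinite_order_and_isRestriction hn2
    VonDyckCover.hyperbolicRotation_two_pi VonDyckCover.hyperbolic_loops
    (VonDyckCover.exists_hom_hyperbolic h)
  refine ⟨VonDyckCover.projection hn2, VonDyckCover.projection_a hn2,
    VonDyckCover.projection_b hn2, VonDyckCover.projection_surjective hn2,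
    VonDyckCover.DBar.a_pow_eq_b_pow hn2, VonDyckCover.ker_projection hn2,
    VonDyckCover.ker_projection_le_center hn2,
    fun h => VonDyckCover.exists_groupExtension hn2 (hsph h).1, ?_, ?_, ?_, fun h => ?_,
    fun h => (hsph h).2, fun h => (heuc h).2, fun h => (hhyp h).2⟩
  · rintro rfl
    exact VonDyckCover.nonempty_mulEquiv_binaryTetrahedral
  · rintro rfl
    exact VonDyckCover.nonempty_mulEquiv_binaryOctahedral
  · rintro rfl
    exact VonDyckCover.nonempty_mulEquiv_binaryIcosahedral
  · have hinf : ∀ k : ℤ, (VonDyckCover.DBar.a ^ n : VonDyckCover.DBar n) ^ k = 1 → k = 0 :=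
      h.eq_or_lt'.elim (fun h' => (heuc h').1) fun h' => (hhyp h').1
    refine ⟨?_, VonDyckCover.exists_groupExtension (m := 0) hn2 fun k => ?_⟩
    · rcases h.eq_or_lt' with rfl | h'
      · exact VonDyckCover.infinite_vonDyck_six (heuc rfl).2
      · exact VonDyckCover.infinite_vonDyck h' hinf
    · rw [Nat.cast_zero, zero_dvd_iff]
      exact ⟨hinf k, fun hk => by rw [hk, zpow_zero]⟩
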